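/- Let $k$ be a commutative ring. All dg categories are small and $k$-linear, with cohomological grading and $d(g\circ f)=dg\circ f+(-1)^{|g|}g\circ df$. A dg category is *semifree* if its morphisms are freely generated, as an algebra, by a well-ordered family $\{f_i\}$ of homogeneous morphisms with each $df_i$ generated by $\{f_j : j<i\}$. A dg functor $\mathcal C\to\mathcal D$ is a *semifree extension* (cofibration) if it is injective on objects and morphisms and the morphisms of $\mathcal D$ are a free extension, as an algebra, of those of the image of $\mathcal C$ (and the identities of the remaining objects of $\mathcal D$) by a well-ordered family $\{f_i\}$ of homogeneous morphisms with each $df_i$ generated by the image of $\mathcal C$ and $\{f_j : j<i\}$. A *quasi-equivalence* is a dg functor inducing isomorphisms on the cohomology of all morphism complexes and an essentially surjective functor on $H^0$. Let $\mathrm{dgCat}_s$ be the category of semifree dg categories (with a set of generating morphisms fixed on each) and all dg functors. For $F\colon\mathcal A\to\mathcal B$ in $\mathrm{dgCat}_s$, the *mapping cylinder* $M_F$ is the semifree extension of $\mathcal B\amalg\mathcal A$ by morphisms, for each object $A$ of $\mathcal A$, $$t_A\colon F(A)\to A,\quad t'_A\colon A\to F(A),\quad \hat t_A\colon F(A)\to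 F(A),\quad \check t_A\colon A\to A,\quad \bar t_A\colon F(A)\to A$$ of degrees $0,0,-1,-1,-2$, and a morphism $t_a\colon F(X)\to Y$ of degree $|a|-1$ for each generating morphism $a\colon X\to Y$ of $\mathcal A$, with differentials $$dt_A=dt'_A=0,\quad d\hat t_A=1_{F(A)}-t'_At_A,\quad d\check t_A=1_A-t_At'_A,\quad d\bar t_A=t_A\hat t_A-\check t_At_A,$$ $$dt_a=(-1)^{|a|}\bigl(a\circ t_X-t_Y\circ F(a)\bigr)+t_{da},$$ where $\theta\mapsto t_\theta$ is the $k$-linear extension to all morphisms of $\mathcal A$ given by $t_{1_A}=0$ and, for generating morphisms $a_1,\dots,a_n$, $t_{a_n\cdots a_1}=\sum_j(-1)^{|a_{j-1}|+\dots+|a_1|}a_n\cdots a_{j+1}\,t_{a_j}\,F(a_{j-1}\cdots a_1)$. Put $\mathrm{Cyl}(\mathcal A)=M_{1_{\mathcal A}}$, let $i_1\colon\mathcal A\to\mathrm{Cyl}(\mathcal A)$ be the inclusion of the copy of the target, and let $j\colon\mathcal A\to M_F$ be the inclusion. **Theorem.** 1. $M_F$ is a semifree dg category, and there is a unique dg functor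 $q\colon M_F\to\mathcal B$ with $q|_{\mathcal B}=1_{\mathcal B}$, $q|_{\mathcal A}=F$, $q(t_A)=q(t'_A)=1_{F(A)}$ and $q(\hat t_A)=q(\check t_A)=q(\bar t_A)=q(t_a)=0$. It satisfies $q\circ j=F$; moreover $j$ is a semifree extension and $q$ is a quasi-equivalence. 2. For every commutative square $\beta\circ F=F'\circ\alpha$ in $\mathrm{dgCat}_s$, with $F\colon\mathcal A\to\mathcal B$, $F'\colon\mathcal A'\to\mathcal B'$, $\alpha\colon\mathcal A\to\mathcal A'$, $\beta\colon\mathcal B\to\mathcal B'$, there is a unique dg functor $M(\alpha,\beta)\colon M_F\to M_{F'}$ with $M(\alpha,\beta)|_{\mathcal B}=\beta$, $M(\alpha,\beta)|_{\mathcal A}=\alpha$ (followed by the inclusions), $t^*_A\mapsto t^*_{\alpha(A)}$ for $t^*\in\{t,t',\hat t,\check t,\bar t\}$, and $t_a\mapsto t_{\alpha(a)}$. The factorization in (1) is functorial: with $j',q'$ the functors of (1) for $F'$, one has $M(\alpha,\beta)\circ j=j'\circ\alpha$ and $q'\circ M(\alpha,\beta)=\beta\circ q$; also $M(1_{\mathcal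 A},1_{\mathcal B})=1_{M_F}$ and $M(\alpha',\beta')\circ M(\alpha,\beta)=M(\alpha'\circ\alpha,\beta'\circ\beta)$ for composable squares. 3. $M_F$ is the pushout, in the category of small dg categories, of $\mathrm{Cyl}(\mathcal A)\xleftarrow{\,i_1\,}\mathcal A\xrightarrow{\,F\,}\mathcal B$, with structure maps $M(1_{\mathcal A},F)\colon\mathrm{Cyl}(\mathcal A)\to M_F$ and the inclusion $\mathcal B\to M_F$. -/

import Mathlib

open CategoryTheory

universe u

namespace DGCyl

/-- The sign `(-1)^n` in `k`, for an integer `n`. -/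
def sgn (k : Type u) [CommRing k] (n : ℤ) : k := ((n.negOnePow : ℤ) : k)

section Sign

variable (k : Type u) [CommRing k]

theorem sgn_zero : sgn k 0 = 1 := by simp [sgn]

theorem sgn_add (m n : ℤ) : sgn k (m + n) = sgn k m * sgn k n := by
  simp [sgn, Int.negOnePow_add]

theorem sgn_one : sgn k 1 = -1 := by simp [sgn]

theorem sgn_sq (n : ℤ) : sgn k n * sgn k n = 1 := by
  rw [← sgn_add, sgn, Int.negOnePow_even _ ⟨n, rfl⟩]; simp

end Sign

/-! ### Dg categories and dg functors -/

/-- A small dg category over `k` (with cohomological grading): a `k`-linear category in which every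
module of morphisms is the direct sum of its homogeneous components `deg X Y n`, `n : ℤ`, and
carries a differential `d` of degree `1`, satisfying the graded Leibniz rule
`d(g ∘ f) = dg ∘ f + (-1)^|g| g ∘ df`. Note that `f ≫ g` is `g ∘ f`. -/
structure DGCat (k : Type u) [CommRing k] : Type (u + 1) where
  Obj : Type u
  [category : Category.{u} Obj]
  [preadditive : Preadditive Obj]
  [linear : Linear k Obj]
  deg : (X Y : Obj) → ℤ → Submodule k (X ⟶ Y)
  isInternal : ∀ X Y : Obj, DirectSum.IsInternal (deg X Y)
  id_mem : ∀ X : Obj, 𝟙 X ∈ deg X X 0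
  comp_mem : ∀ {X Y Z : Obj} {m n : ℤ} {f : X ⟶ Y} {g : Y ⟶ Z},
    f ∈ deg X Y m → g ∈ deg Y Z n → f ≫ g ∈ deg X Z (m + n)
  d : (X Y : Obj) → (X ⟶ Y) →ₗ[k] (X ⟶ Y)
  d_mem : ∀ {X Y : Obj} {n : ℤ} {f : X ⟶ Y}, f ∈ deg X Y n → d X Y f ∈ deg X Y (n + 1)
  d_d : ∀ {X Y : Obj} (f : X ⟶ Y), d X Y (d X Y f) = 0
  leibniz : ∀ {X Y Z : Obj} {n : ℤ} (f : X ⟶ Y) {g : Y ⟶ Z}, g ∈ deg Y Z n →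
    d X Z (f ≫ g) = f ≫ d Y Z g + sgn k n • (d X Y f ≫ g)

attribute [instance] DGCat.category DGCat.preadditive DGCat.linear

variable {k : Type u} [CommRing k]

/-- A dg functor: a `k`-linear functor that preserves degrees and commutes with `d`. -/
structure DGFunctor (C D : DGCat k) : Type u where
  toFunctor : C.Obj ⥤ D.Obj
  map_add : ∀ {X Y : C.Obj} (f g : X ⟶ Y),
    toFunctor.map (f + g) = toFunctor.map f + toFunctor.map g
  map_smul : ∀ {X Y : C.Obj} (c : k) (f : X ⟶ Y), toFunctor.map (c • f) = c • toFunctor.map f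
  map_deg : ∀ {X Y : C.Obj} {n : ℤ} {f : X ⟶ Y}, f ∈ C.deg X Y n →
    toFunctor.map f ∈ D.deg (toFunctor.obj X) (toFunctor.obj Y) n
  map_d : ∀ {X Y : C.Obj} (f : X ⟶ Y), toFunctor.map (C.d X Y f) = D.d _ _ (toFunctor.map f)

/-- The category of small dg categories and dg functors. -/
instance : Category (DGCat k) where
  Hom C D := DGFunctor C D
  id C :=
    { toFunctor := 𝟭 C.Obj
      map_add := fun _ _ => rfl
      map_smul := fun _ _ => rfl
      map_deg := fun h => h
      map_d := fun _ => rfl }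
  comp F G :=
    { toFunctor := F.toFunctor ⋙ G.toFunctor
      map_add := fun f g => by simp [F.map_add, G.map_add]
      map_smul := fun c f => by simp [F.map_smul, G.map_smul]
      map_deg := fun h => G.map_deg (F.map_deg h)
      map_d := fun f => by simp [F.map_d, G.map_d] }

/-- A dg functor as a linear map on morphisms. -/
def DGFunctor.mapL {C D : DGCat k} (F : DGFunctor C D) (X Y : C.Obj) :
    (X ⟶ Y) →ₗ[k] (F.toFunctor.obj X ⟶ F.toFunctor.obj Y) where
  toFun f := F.toFunctor.map f
  map_add' := F.map_add
  map_smul' := F.map_smul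

/-! ### Quasi-equivalences -/

namespace DGCat

/-- Closed morphisms of degree `n`. -/
def cocycles (C : DGCat k) (X Y : C.Obj) (n : ℤ) : Submodule k (X ⟶ Y) :=
  C.deg X Y n ⊓ LinearMap.ker (C.d X Y)

/-- Exact morphisms of degree `n`: the differentials of the morphisms of degree `n - 1`. -/
def coboundaries (C : DGCat k) (X Y : C.Obj) (n : ℤ) : Submodule k (X ⟶ Y) :=
  (C.deg X Y (n - 1)).map (C.d X Y)

/-- The cohomology `Hⁿ(hom^*(X, Y))`. -/
abbrev Cohomology (C : DGCat k) (X Y : C.Obj) (n : ℤ) : Type u :=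
  C.cocycles X Y n ⧸ (C.coboundaries X Y n).submoduleOf (C.cocycles X Y n)

/-- `X` and `Y` are isomorphic in the category `H⁰(C)`, which has the same objects as `C` and the
modules `H⁰(hom^*(X, Y))` as morphisms. -/
def IsoInH0 (C : DGCat k) (X Y : C.Obj) : Prop :=
  ∃ (r : X ⟶ Y) (s : Y ⟶ X), r ∈ C.cocycles X Y 0 ∧ s ∈ C.cocycles Y X 0 ∧
    𝟙 X - r ≫ s ∈ C.coboundaries X X 0 ∧ 𝟙 Y - s ≫ r ∈ C.coboundaries Y Y 0

end DGCat

namespace DGFunctor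

variable {C D : DGCat k} (F : DGFunctor C D)

/-- The map induced by a dg functor on closed morphisms of degree `n`. -/
def mapCocycles (X Y : C.Obj) (n : ℤ) :
    C.cocycles X Y n →ₗ[k] D.cocycles (F.toFunctor.obj X) (F.toFunctor.obj Y) n :=
  (F.mapL X Y).restrict (fun f hf => ⟨F.map_deg hf.1, by
    have h : C.d X Y f = 0 := hf.2
    change D.d _ _ (F.toFunctor.map f) = 0
    rw [← F.map_d, h]
    exact (F.mapL X Y).map_zero⟩)

/-- The map induced by a dg functor on `Hⁿ` of the complexes of morphisms. -/
def mapCohomology (X Y : C.Obj) (n : ℤ) :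
    C.Cohomology X Y n →ₗ[k] D.Cohomology (F.toFunctor.obj X) (F.toFunctor.obj Y) n :=
  Submodule.mapQ _ _ (F.mapCocycles X Y n) (by
    rintro ⟨f, hf⟩ ⟨g, hg, hgf⟩
    exact ⟨F.toFunctor.map g, F.map_deg hg, by
      rw [← F.map_d, hgf]; rfl⟩)

/-- A quasi-equivalence: a dg functor inducing isomorphisms on the cohomology of all complexes of
morphisms, and an essentially surjective functor on `H⁰`. -/
structure IsQuasiEquivalence : Prop where
  bijective : ∀ (X Y : C.Obj) (n : ℤ), Function.Bijective (F.mapCohomology X Y n)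
  essSurj : ∀ Y : D.Obj, ∃ X : C.Obj, D.IsoInH0 (F.toFunctor.obj X) Y

end DGFunctor

/-! ### Semifree dg categories and semifree extensions -/

/-- `GenPath V X Y` is the type of composable words `X = X₀ → X₁ → ⋯ → Xₙ = Y` (`n ≥ 0`) in the
letters `V`. -/
inductive GenPath {O : Type u} (V : O → O → Type u) (X : O) : O → Type u
  | nil : GenPath V X X
  | cons {Y Z : O} (p : GenPath V X Y) (e : V Y Z) : GenPath V X Z

namespace GenPath

variable {O : Type u} {V : O → O → Type u}

/-- Concatenation of words. -/
def comp {X Y : O} (p : GenPath V X Y) : {Z : O} → GenPath V Y Z → GenPath V X Z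
  | _, nil => p
  | _, cons q e => cons (p.comp q) e

theorem nil_comp {X Y : O} (p : GenPath V X Y) : (nil : GenPath V X X).comp p = p := by
  induction p with
  | nil => rfl
  | cons p e ih => exact congrArg (fun q => cons q e) ih

theorem comp_assoc {W X Y Z : O} (p : GenPath V W X) (q : GenPath V X Y) (r : GenPath V Y Z) :
    (p.comp q).comp r = p.comp (q.comp r) := by
  induction r with
  | nil => rfl
  | cons r e ih => exact congrArg (fun q => cons q e) ih

/-- The degree of a word: the sum of the degrees of its letters. -/
def degree (δ : ∀ X Y : O, V X Y → ℤ) {X : O} : {Y : O} → GenPath V X Y → ℤ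
  | _, nil => 0
  | _, cons p e => p.degree δ + δ _ _ e

theorem degree_comp (δ : ∀ X Y : O, V X Y → ℤ) {X Y Z : O} (p : GenPath V X Y)
    (q : GenPath V Y Z) : (p.comp q).degree δ = p.degree δ + q.degree δ := by
  induction q with
  | nil => simp [comp, degree]
  | cons q e ih => simp [comp, degree, ih, add_assoc]

/-- The composite of a word whose letters are interpreted as morphisms of a category; the empty
word gives an identity. -/
def eval {C : Type*} [Category C] (o : O → C) (v : ∀ X Y : O, V X Y → (o X ⟶ o Y)) {X : O} :
    {Y : O} → GenPath V X Y → (o X ⟶ o Y)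
  | _, nil => 𝟙 (o X)
  | _, cons p e => p.eval o v ≫ v _ _ e

theorem eval_comp {C : Type*} [Category C] (o : O → C) (v : ∀ X Y : O, V X Y → (o X ⟶ o Y))
    {X Y Z : O} (p : GenPath V X Y) (q : GenPath V Y Z) :
    (p.comp q).eval o v = p.eval o v ≫ q.eval o v := by
  induction q with
  | nil => simp [comp, eval]
  | cons q e ih => simp [comp, eval, ih]

end GenPath

/-- `Generated k S f`: the morphism `f` lies in the smallest `k`-linear subcategory (on all
objects) containing the morphisms that satisfy `S`. -/
inductive Generated (k : Type u) [CommRing k] {C : Type u} [Category.{u} C] [Preadditive C]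
    [Linear k C] (S : ∀ ⦃X Y : C⦄, (X ⟶ Y) → Prop) : ∀ {X Y : C}, (X ⟶ Y) → Prop
  | of {X Y : C} {f : X ⟶ Y} : S f → Generated k S f
  | id (X : C) : Generated k S (𝟙 X)
  | comp {X Y Z : C} {f : X ⟶ Y} {g : Y ⟶ Z} :
      Generated k S f → Generated k S g → Generated k S (f ≫ g)
  | zero {X Y : C} : Generated k S (0 : X ⟶ Y)
  | add {X Y : C} {f g : X ⟶ Y} : Generated k S f → Generated k S g → Generated k S (f + g)
  | smul {X Y : C} (c : k) {f : X ⟶ Y} : Generated k S f → Generated k S (c • f)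

/-- A family of homogeneous morphisms of a dg category, indexed by a well-ordered set. -/
structure MorphismFamily (C : DGCat k) : Type (u + 1) where
  Gen : C.Obj → C.Obj → Type u
  val : (X Y : C.Obj) → Gen X Y → (X ⟶ Y)
  degree : (X Y : C.Obj) → Gen X Y → ℤ
  val_mem : ∀ {X Y : C.Obj} (f : Gen X Y), val X Y f ∈ C.deg X Y (degree X Y f)
  lt : (Σ X Y : C.Obj, Gen X Y) → (Σ X Y : C.Obj, Gen X Y) → Prop
  isWellOrder : IsWellOrder _ lt

/-- `S.IsBelow f g`: the morphism `g` is a member of the family preceding `f`. -/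
def MorphismFamily.IsBelow {C : DGCat k} (S : MorphismFamily C) {U V : C.Obj} (f : S.Gen U V)
    ⦃X Y : C.Obj⦄ (g : X ⟶ Y) : Prop :=
  ∃ g' : S.Gen X Y, S.val X Y g' = g ∧ S.lt ⟨X, Y, g'⟩ ⟨U, V, f⟩

/-- A set of generating morphisms of a semifree dg category: a well-ordered family of
homogeneous morphisms which freely generates the morphisms as an algebra (the composites of the
words in the family form a `k`-basis of every module of morphisms) and such that `df` is generated
by the members of the family preceding `f`. -/
structure GeneratingMorphisms (C : DGCat k) : Type (u + 1) extends MorphismFamily C where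
  bijective : ∀ X Y : C.Obj, Function.Bijective
    (Finsupp.linearCombination k (fun p : GenPath Gen X Y => p.eval (fun X => X) val))
  d_val : ∀ {X Y : C.Obj} (f : Gen X Y),
    Generated k (toMorphismFamily.IsBelow f) (C.d X Y (val X Y f))

/-- A dg category is semifree if it has a set of generating morphisms. -/
def DGCat.IsSemifree (C : DGCat k) : Prop := Nonempty (GeneratingMorphisms C)

/-- A semifree dg category with a chosen set of generating morphisms. -/
structure SemifreeDGCat (k : Type u) [CommRing k] : Type (u + 1) where
  dg : DGCat k
  gens : GeneratingMorphisms dg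

/-- The category of semifree dg categories; its morphisms are all dg functors (the choice of
generating morphisms is used for constructions only). -/
abbrev DGCatS (k : Type u) [CommRing k] : Type (u + 1) :=
  InducedCategory (DGCat k) (SemifreeDGCat.dg (k := k))

/-- The structure of a `k`-linear functor with prescribed values `o` on objects. -/
structure LinearFunctorOn (k : Type u) [CommRing k] {C E : Type u} [Category.{u} C]
    [Preadditive C] [Linear k C] [Category.{u} E] [Preadditive E] [Linear k E] (o : C → E) :
    Type u where
  map : (X Y : C) → (X ⟶ Y) →ₗ[k] (o X ⟶ o Y)
  map_id : ∀ X : C, map X X (𝟙 X) = 𝟙 (o X)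
  map_comp : ∀ {X Y Z : C} (f : X ⟶ Y) (g : Y ⟶ Z), map X Z (f ≫ g) = map X Y f ≫ map Y Z g

/-- The dg functor `F : C → D` is a semifree extension by the set `R` of objects and the
well-ordered family `S` of morphisms. The field `free` says that the `k`-linear category `D` is
the free extension of `C` by the objects `R` and the morphisms `S`: a `k`-linear functor out of `D`
amounts to a `k`-linear functor out of `C`, values on the objects of `R`, and arbitrary values on
the morphisms of `S`. -/
structure IsSemifreeExtensionBy {C D : DGCat k} (F : DGFunctor C D) (R : Set D.Obj)
    (S : MorphismFamily D) : Prop where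
  injective_obj : Function.Injective F.toFunctor.obj
  injective_map : ∀ X Y : C.Obj, Function.Injective (F.mapL X Y)
  isCompl : IsCompl (Set.range F.toFunctor.obj) R
  free : ∀ (E : Type u) [Category.{u} E] [Preadditive E] [Linear k E] (o : D.Obj → E)
    (G : LinearFunctorOn k (fun X : C.Obj => o (F.toFunctor.obj X)))
    (v : ∀ X Y : D.Obj, S.Gen X Y → (o X ⟶ o Y)),
    ∃! H : LinearFunctorOn k o,
      (∀ {X Y : C.Obj} (f : X ⟶ Y), H.map _ _ (F.toFunctor.map f) = G.map X Y f) ∧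
      (∀ {X Y : D.Obj} (g : S.Gen X Y), H.map X Y (S.val X Y g) = v X Y g)
  d_val : ∀ {U V : D.Obj} (f : S.Gen U V),
    Generated k (fun X Y g => (∃ (X' Y' : C.Obj) (g' : X' ⟶ Y'),
        Arrow.mk (F.toFunctor.map g') = Arrow.mk g) ∨ S.IsBelow f (X := X) (Y := Y) g)
      (D.d U V (S.val U V f))

/-- Cofibrations are semifree extensions. -/
def IsSemifreeExtension {C D : DGCat k} (F : DGFunctor C D) : Prop :=
  ∃ (R : Set D.Obj) (S : MorphismFamily D), IsSemifreeExtensionBy F R S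

namespace GeneratingMorphisms

variable {C : DGCat k} (G : GeneratingMorphisms C)

/-- The composite in `C` of a word in the generating morphisms. -/
abbrev word {X Y : C.Obj} (p : GenPath G.Gen X Y) : X ⟶ Y := p.eval (fun X => X) G.val

/-- The `k`-linear map out of a module of morphisms of a semifree dg category with given values on
the words in the generating morphisms. -/
noncomputable def extend {M : Type u} [AddCommGroup M] [Module k M] {X Y : C.Obj}
    (φ : GenPath G.Gen X Y → M) : (X ⟶ Y) →ₗ[k] M :=
  (Finsupp.linearCombination k φ).comp
    (LinearEquiv.ofBijective _ (G.bijective X Y)).symm.toLinearMap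

theorem extend_word {M : Type u} [AddCommGroup M] [Module k M] {X Y : C.Obj}
    (φ : GenPath G.Gen X Y → M) (p : GenPath G.Gen X Y) : G.extend φ (G.word p) = φ p := by
  have h : G.word p = LinearEquiv.ofBijective _ (G.bijective X Y) (Finsupp.single p 1) := by
    simp [word]
  rw [extend, h, LinearMap.comp_apply, LinearEquiv.coe_coe, LinearEquiv.symm_apply_apply,
    Finsupp.linearCombination_single, one_smul]

theorem hom_induction {X Y : C.Obj} {P : (X ⟶ Y) → Prop} (f : X ⟶ Y)
    (word : ∀ p, P (G.word p)) (zero : P 0) (add : ∀ f g, P f → P g → P (f + g))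
    (smul : ∀ (c : k) f, P f → P (c • f)) : P f := by
  obtain ⟨x, rfl⟩ := (G.bijective X Y).2 f
  induction x using Finsupp.induction_linear with
  | zero => simpa using zero
  | add x y hx hy => rw [map_add]; exact add _ _ hx hy
  | single p c => rw [Finsupp.linearCombination_single]; exact smul _ _ (word p)

theorem word_mem {X Y : C.Obj} (p : GenPath G.Gen X Y) :
    G.word p ∈ C.deg X Y (p.degree G.degree) := by
  induction p with
  | nil => exact C.id_mem _
  | cons p e ih => exact C.comp_mem ih (G.val_mem e)

theorem deg_induction {X Y : C.Obj} {n : ℤ} {P : (X ⟶ Y) → Prop} {f : X ⟶ Y}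
    (hf : f ∈ C.deg X Y n) (word : ∀ p : GenPath G.Gen X Y, p.degree G.degree = n → P (G.word p))
    (zero : P 0) (add : ∀ f g, P f → P g → P (f + g)) (smul : ∀ (c : k) f, P f → P (c • f)) :
    P f := by
  let W (m : ℤ) : Submodule k (X ⟶ Y) := Submodule.span k
    ((fun p : GenPath G.Gen X Y => G.word p) '' {p | p.degree G.degree = m})
  have hW (m : ℤ) : W m ≤ C.deg X Y m := by
    rw [Submodule.span_le]
    rintro _ ⟨p, rfl, rfl⟩
    exact G.word_mem p
  have htop : f ∈ W n ⊔ ⨆ m, ⨆ (_ : m ≠ n), W m := by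
    clear hf
    induction f using G.hom_induction with
    | zero => exact zero_mem _
    | add f g h h' => exact add_mem h h'
    | smul c f h => exact Submodule.smul_mem _ c h
    | word p =>
      have hp : G.word p ∈ W (p.degree G.degree) := Submodule.subset_span ⟨p, rfl, rfl⟩
      by_cases h : p.degree G.degree = n
      · rw [h] at hp
        exact Submodule.mem_sup_left hp
      · exact Submodule.mem_sup_right (Submodule.mem_iSup_of_mem _ (Submodule.mem_iSup_of_mem h hp))
  obtain ⟨a, ha, b, hb, hab⟩ := Submodule.mem_sup.1 htop
  have hb0 : b = 0 := by
    refine (Submodule.disjoint_def.1 ((C.isInternal X Y).submodule_iSupIndep n)) b ?_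
      (iSup₂_mono (fun m _ => hW m) hb)
    rw [← eq_sub_iff_add_eq'] at hab
    rw [hab]
    exact sub_mem hf (hW n ha)
  rw [hb0, add_zero] at hab
  subst hab
  clear hf htop hb hb0
  induction ha using Submodule.span_induction with
  | mem x hx => obtain ⟨p, hp, rfl⟩ := hx; exact word p hp
  | zero => exact zero
  | add x y _ _ hx hy => exact add x y hx hy
  | smul c x _ hx => exact smul c x hx

/-- The `k`-linear functor out of a semifree dg category with given values `o` on objects and `v`
on generating morphisms, as a map on morphisms. -/
noncomputable def lift {E : Type u} [Category.{u} E] [Preadditive E] [Linear k E] (o : C.Obj → E)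
    (v : ∀ X Y : C.Obj, G.Gen X Y → (o X ⟶ o Y)) {X Y : C.Obj} : (X ⟶ Y) →ₗ[k] (o X ⟶ o Y) :=
  G.extend (fun p => p.eval o v)

section lift

variable {E : Type u} [Category.{u} E] [Preadditive E] [Linear k E] (o : C.Obj → E)
    (v : ∀ X Y : C.Obj, G.Gen X Y → (o X ⟶ o Y))

theorem lift_word {X Y : C.Obj} (p : GenPath G.Gen X Y) : G.lift o v (G.word p) = p.eval o v :=
  G.extend_word _ p

theorem lift_id (X : C.Obj) : G.lift o v (𝟙 X) = 𝟙 (o X) := G.lift_word o v GenPath.nil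

theorem lift_comp {X Y Z : C.Obj} (f : X ⟶ Y) (g : Y ⟶ Z) :
    G.lift o v (f ≫ g) = G.lift o v f ≫ G.lift o v g := by
  induction f using G.hom_induction with
  | zero => simp
  | add f f' h h' => simp [h, h']
  | smul c f h => simp [h]
  | word p =>
    induction g using G.hom_induction with
    | zero => simp
    | add g g' h h' => simp [h, h']
    | smul c g h => simp [h]
    | word q =>
      rw [← GenPath.eval_comp, lift_word, lift_word, lift_word, GenPath.eval_comp]

theorem lift_val {X Y : C.Obj} (e : G.Gen X Y) : G.lift o v (G.val X Y e) = v X Y e := by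
  have := G.lift_word o v (GenPath.nil.cons e)
  simpa [word, GenPath.eval] using this

end lift

end GeneratingMorphisms

/-! ### The free `k`-linear category on a graph, and differentials on it -/

/-- The objects of the free `k`-linear category on the graph `V`. -/
structure FreeLin (k : Type u) {O : Type u} (V : O → O → Type u) : Type u where
  obj : O

namespace FreeLin

variable {O : Type u} {V : O → O → Type u}

/-- Bilinear extension of the concatenation of words. -/
noncomputable def mul (k : Type u) [CommRing k] {X Y Z : O} :
    (GenPath V X Y →₀ k) →ₗ[k] (GenPath V Y Z →₀ k) →ₗ[k] (GenPath V X Z →₀ k) :=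
  Finsupp.linearCombination k
    (fun p : GenPath V X Y => Finsupp.lmapDomain k k (fun q : GenPath V Y Z => p.comp q))

theorem mul_single {X Y Z : O} (p : GenPath V X Y) (q : GenPath V Y Z) (a b : k) :
    mul k (Finsupp.single p a) (Finsupp.single q b) = Finsupp.single (p.comp q) (a * b) := by
  simp [mul]

/-- The free `k`-linear category on a graph: morphisms are formal `k`-linear combinations of words. -/
noncomputable instance : Category.{u} (FreeLin k V) where
  Hom X Y := GenPath V X.obj Y.obj →₀ k
  id X := Finsupp.single GenPath.nil 1
  comp f g := mul k f g
  id_comp {X Y} f := by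
    induction f using Finsupp.induction_linear with
    | zero => exact map_zero _
    | add f g hf hg => exact (map_add _ _ _).trans (congrArg₂ (· + ·) hf hg)
    | single p a => rw [mul_single, GenPath.nil_comp, one_mul]
  comp_id {X Y} f := by
    induction f using Finsupp.induction_linear with
    | zero => rw [map_zero]; rfl
    | add f g hf hg => rw [map_add]; exact congrArg₂ (· + ·) hf hg
    | single p a => rw [mul_single, mul_one]; rfl
  assoc {W X Y Z} f g h := by
    induction f using Finsupp.induction_linear with
    | zero => simp only [map_zero, LinearMap.zero_apply]
    | add f f' hf hf' => simp only [map_add, LinearMap.add_apply, hf, hf']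
    | single p a =>
      induction g using Finsupp.induction_linear with
      | zero => simp only [map_zero, LinearMap.zero_apply]
      | add g g' hg hg' => simp only [map_add, LinearMap.add_apply, hg, hg']
      | single q b =>
        induction h using Finsupp.induction_linear with
        | zero => simp only [map_zero]
        | add h h' hh hh' => simp only [map_add, hh, hh']
        | single r c => simp only [mul_single, GenPath.comp_assoc, mul_assoc]

noncomputable instance : Preadditive (FreeLin k V) where
  homGroup X Y := inferInstanceAs (AddCommGroup (GenPath V X.obj Y.obj →₀ k))
  add_comp _ _ _ f f' g := LinearMap.map_add₂ (mul k) f f' g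
  comp_add _ _ _ f g g' := LinearMap.map_add (mul k f) g g'

noncomputable instance : Linear k (FreeLin k V) where
  homModule X Y := inferInstanceAs (Module k (GenPath V X.obj Y.obj →₀ k))
  smul_comp _ _ _ c f g := LinearMap.map_smul₂ (mul k) c f g
  comp_smul _ _ _ f c g := LinearMap.map_smul (mul k f) c g

variable (k) in
/-- A word as a morphism of the free `k`-linear category. -/
noncomputable def path {X Y : O} (p : GenPath V X Y) : (⟨X⟩ : FreeLin k V) ⟶ ⟨Y⟩ :=
  (Finsupp.single p 1 : GenPath V X Y →₀ k)

variable (k) in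
/-- A letter as a morphism of the free `k`-linear category. -/
noncomputable def edge {X Y : O} (e : V X Y) : (⟨X⟩ : FreeLin k V) ⟶ ⟨Y⟩ :=
  path k (GenPath.nil.cons e)

theorem path_nil (X : O) : path k (GenPath.nil : GenPath V X X) = 𝟙 _ := rfl

theorem path_comp {X Y Z : O} (p : GenPath V X Y) (q : GenPath V Y Z) :
    path k (p.comp q) = path k p ≫ path k q :=
  ((mul_single p q (1 : k) 1).trans (by rw [mul_one]; rfl)).symm

theorem path_cons {X Y Z : O} (p : GenPath V X Y) (e : V Y Z) :
    path k (p.cons e) = path k p ≫ edge k e :=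
  path_comp p (GenPath.nil.cons e)

/-- The `k`-linear map out of a module of morphisms of the free `k`-linear category with given
values on the words. -/
noncomputable def extend {M : Type u} [AddCommGroup M] [Module k M] {X Y : FreeLin k V}
    (φ : GenPath V X.obj Y.obj → M) : (X ⟶ Y) →ₗ[k] M :=
  (Finsupp.linearCombination k φ : (GenPath V X.obj Y.obj →₀ k) →ₗ[k] M)

theorem extend_path {M : Type u} [AddCommGroup M] [Module k M] {X Y : O}
    (φ : GenPath V X Y → M) (p : GenPath V X Y) :
    extend (X := (⟨X⟩ : FreeLin k V)) (Y := ⟨Y⟩) φ (path k p) = φ p :=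
  (Finsupp.linearCombination_single k 1 p).trans (one_smul _ _)

theorem hom_induction {X Y : FreeLin k V} {P : (X ⟶ Y) → Prop} (f : X ⟶ Y)
    (path : ∀ p : GenPath V X.obj Y.obj, P (path k p)) (zero : P 0)
    (add : ∀ f g, P f → P g → P (f + g)) (smul : ∀ (c : k) f, P f → P (c • f)) : P f := by
  refine Finsupp.induction_linear (motive := fun x : GenPath V X.obj Y.obj →₀ k => P x) f zero
    (fun x y hx hy => add _ _ hx hy) (fun p a => ?_)
  have h : (Finsupp.single p a : GenPath V X.obj Y.obj →₀ k) =
      (a • Finsupp.single p (1 : k) : GenPath V X.obj Y.obj →₀ k) := by simp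
  rw [h]
  exact smul a _ (path p)

variable (δ : ∀ X Y : O, V X Y → ℤ)

/-- The homogeneous morphisms of degree `n`: the combinations of words of degree `n`. -/
noncomputable def deg (k : Type u) [CommRing k] (X Y : FreeLin k V) (n : ℤ) :
    Submodule k (X ⟶ Y) :=
  (Finsupp.supported k k {p : GenPath V X.obj Y.obj | p.degree δ = n} :
    Submodule k (GenPath V X.obj Y.obj →₀ k))

theorem path_mem {X Y : O} (p : GenPath V X Y) : path k p ∈ deg δ k ⟨X⟩ ⟨Y⟩ (p.degree δ) :=
  Finsupp.single_mem_supported k 1 rfl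

theorem edge_mem {X Y : O} (e : V X Y) : edge k e ∈ deg δ k ⟨X⟩ ⟨Y⟩ (δ X Y e) := by
  have h := path_mem (k := k) δ (GenPath.nil.cons e)
  rwa [GenPath.degree, GenPath.degree, zero_add] at h

theorem deg_induction {X Y : FreeLin k V} {n : ℤ} {P : (X ⟶ Y) → Prop} {f : X ⟶ Y}
    (hf : f ∈ deg δ k X Y n)
    (path : ∀ p : GenPath V X.obj Y.obj, p.degree δ = n → P (path k p)) (zero : P 0)
    (add : ∀ f g, P f → P g → P (f + g)) (smul : ∀ (c : k) f, P f → P (c • f)) : P f := by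
  have h : deg δ k X Y n = Submodule.span k
      ((fun p : GenPath V X.obj Y.obj => FreeLin.path k p) '' {p | p.degree δ = n}) :=
    Finsupp.supported_eq_span_single k {p : GenPath V X.obj Y.obj | p.degree δ = n}
  rw [h] at hf
  induction hf using Submodule.span_induction with
  | mem x hx => obtain ⟨p, hp, rfl⟩ := hx; exact path p hp
  | zero => exact zero
  | add x y _ _ hx hy => exact add x y hx hy
  | smul c x _ hx => exact smul c x hx

theorem deg_isInternal (X Y : FreeLin k V) : DirectSum.IsInternal (deg δ k X Y) := by
  have key : DirectSum.IsInternal (fun n : ℤ =>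
      Finsupp.supported k k {p : GenPath V X.obj Y.obj | p.degree δ = n}) := by
    apply DirectSum.isInternal_submodule_of_iSupIndep_of_iSup_eq_top
    · intro n
      refine Disjoint.mono_right (c := Finsupp.supported k k 
          {p : GenPath V X.obj Y.obj | p.degree δ ≠ n})
        (iSup₂_le fun j hj => Finsupp.supported_mono fun p hp => ?_) ?_
      · exact fun h => hj (hp.symm.trans h)
      · exact Finsupp.disjoint_supported_supported
          (Set.disjoint_left.2 fun p hp hp' => hp' hp)
    · rw [← Finsupp.supported_iUnion]
      have : (⋃ n : ℤ, {p : GenPath V X.obj Y.obj | p.degree δ = n}) = Set.univ := by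
        ext p; simp
      rw [this, Finsupp.supported_univ]
  exact key

theorem comp_mem {X Y Z : FreeLin k V} {m n : ℤ} {f : X ⟶ Y} {g : Y ⟶ Z}
    (hf : f ∈ deg δ k X Y m) (hg : g ∈ deg δ k Y Z n) : f ≫ g ∈ deg δ k X Z (m + n) := by
  refine deg_induction δ (P := fun f => f ≫ g ∈ deg δ k X Z (m + n)) hf (fun p hp => ?_)
    (by simp) (fun f f' h h' => by rw [Preadditive.add_comp]; exact add_mem h h')
    (fun c f h => by rw [Linear.smul_comp]; exact Submodule.smul_mem _ c h)
  refine deg_induction δ (P := fun g => path k p ≫ g ∈ deg δ k X Z (m + n)) hg (fun q hq => ?_)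
    (by simp) (fun g g' h h' => by rw [Preadditive.comp_add]; exact add_mem h h')
    (fun c g h => by rw [Linear.comp_smul]; exact Submodule.smul_mem _ c h)
  subst hp hq
  rw [← GenPath.degree_comp]
  exact (path_comp (k := k) p q) ▸ path_mem δ _

variable (ε : ∀ X Y : O, V X Y → ((⟨X⟩ : FreeLin k V) ⟶ ⟨Y⟩))

/-- The differential of a word, from the differentials `ε` of the letters by the Leibniz rule. -/
noncomputable def dPath {X : O} : {Y : O} → GenPath V X Y → ((⟨X⟩ : FreeLin k V) ⟶ ⟨Y⟩)
  | _, .nil => 0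
  | _, .cons p e => path k p ≫ ε _ _ e + sgn k (δ _ _ e) • (dPath p ≫ edge k e)

/-- The differential on the free `k`-linear category with given values `ε` on the letters. -/
noncomputable def d (X Y : FreeLin k V) : (X ⟶ Y) →ₗ[k] (X ⟶ Y) :=
  extend (fun p => dPath δ ε p)

theorem d_path {X Y : O} (p : GenPath V X Y) : d δ ε ⟨X⟩ ⟨Y⟩ (path k p) = dPath δ ε p :=
  extend_path _ p

theorem d_id (X : FreeLin k V) : d δ ε X X (𝟙 X) = 0 := d_path δ ε GenPath.nil

theorem d_edge {X Y : O} (e : V X Y) : d δ ε ⟨X⟩ ⟨Y⟩ (edge k e) = ε X Y e := by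
  rw [edge, d_path, dPath, path_nil, Category.id_comp, dPath]
  simp

theorem leibniz_path {X Y Z : O} (p : GenPath V X Y) (q : GenPath V Y Z) :
    d δ ε ⟨X⟩ ⟨Z⟩ (path k p ≫ path k q) = path k p ≫ d δ ε ⟨Y⟩ ⟨Z⟩ (path k q) +
      sgn k (q.degree δ) • (d δ ε ⟨X⟩ ⟨Y⟩ (path k p) ≫ path k q) := by
  rw [← path_comp, d_path, d_path, d_path]
  induction q with
  | nil => simp [GenPath.comp, GenPath.degree, dPath, path_nil, sgn_zero]
  | cons q e ih =>
    simp only [GenPath.comp, GenPath.degree, dPath, ih, path_cons, path_comp, sgn_add,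
      Preadditive.comp_add, Preadditive.add_comp, Linear.smul_comp, Linear.comp_smul,
      Category.assoc, smul_add, smul_smul]
    rw [mul_comm (sgn k (δ _ _ e))]
    abel

theorem leibniz {X Y Z : FreeLin k V} {n : ℤ} (f : X ⟶ Y) {g : Y ⟶ Z}
    (hg : g ∈ deg δ k Y Z n) :
    d δ ε X Z (f ≫ g) = f ≫ d δ ε Y Z g + sgn k n • (d δ ε X Y f ≫ g) := by
  induction f using hom_induction with
  | zero => simp
  | add f f' h h' => simp only [Preadditive.add_comp, map_add, h, h', smul_add]; abel
  | smul c f h =>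
    simp only [Linear.smul_comp, map_smul, h, smul_add]
    rw [smul_comm]
  | path p =>
    refine deg_induction δ (P := fun g => d δ ε X Z (path k p ≫ g) =
        path k p ≫ d δ ε Y Z g + sgn k n • (d δ ε X Y (path k p) ≫ g)) hg (fun q hq => ?_)
      (by simp)
      (fun g g' h h' => by simp only [Preadditive.comp_add, map_add, h, h', smul_add]; abel)
      (fun c g h => by
        simp only [Linear.comp_smul, map_smul, h, smul_add]
        rw [smul_comm])
    subst hq
    exact leibniz_path δ ε p q

theorem d_mem (hε : ∀ {X Y : O} (e : V X Y), ε X Y e ∈ deg δ k ⟨X⟩ ⟨Y⟩ (δ X Y e + 1))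
    {X Y : FreeLin k V} {n : ℤ} {f : X ⟶ Y} (hf : f ∈ deg δ k X Y n) :
    d δ ε X Y f ∈ deg δ k X Y (n + 1) := by
  refine deg_induction δ (P := fun f => d δ ε X Y f ∈ deg δ k X Y (n + 1)) hf (fun p hp => ?_)
    (by simp) (fun f f' h h' => by rw [map_add]; exact add_mem h h')
    (fun c f h => by rw [map_smul]; exact Submodule.smul_mem _ c h)
  subst hp
  clear hf f
  obtain ⟨X⟩ := X
  obtain ⟨Y⟩ := Y
  change GenPath V X Y at p
  rw [d_path]
  induction p with
  | nil => exact zero_mem _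
  | cons p e ih =>
    simp only [dPath, GenPath.degree]
    refine add_mem ?_ (Submodule.smul_mem _ _ ?_)
    · rw [add_assoc]; exact comp_mem δ (path_mem δ p) (hε e)
    · have := comp_mem δ ih (edge_mem (k := k) δ e)
      rwa [add_right_comm] at this

theorem d_d (hε : ∀ {X Y : O} (e : V X Y), ε X Y e ∈ deg δ k ⟨X⟩ ⟨Y⟩ (δ X Y e + 1))
    (hdε : ∀ {X Y : O} (e : V X Y), d δ ε ⟨X⟩ ⟨Y⟩ (ε X Y e) = 0)
    {X Y : FreeLin k V} (f : X ⟶ Y) : d δ ε X Y (d δ ε X Y f) = 0 := by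
  induction f using hom_induction with
  | zero => simp
  | add f f' h h' => simp only [map_add, h, h', add_zero]
  | smul c f h => simp only [map_smul, h, smul_zero]
  | path p =>
    obtain ⟨X⟩ := X
    obtain ⟨Y⟩ := Y
    change GenPath V X Y at p
    induction p with
    | nil => rw [d_path]; exact map_zero _
    | cons p e ih =>
      rw [path_cons, leibniz δ ε _ (edge_mem δ e), d_edge, map_add, map_smul,
        leibniz δ ε _ (hε e), leibniz δ ε _ (edge_mem δ e), d_edge, hdε, ih, sgn_add, sgn_one]
      simp

/-- The free `k`-linear category on a graph with degrees `δ`, with the differential determined by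
the differentials `ε` of the letters, as a dg category. -/
noncomputable def toDGCat (hε : ∀ {X Y : O} (e : V X Y), ε X Y e ∈ deg δ k ⟨X⟩ ⟨Y⟩ (δ X Y e + 1))
    (hdε : ∀ {X Y : O} (e : V X Y), d δ ε ⟨X⟩ ⟨Y⟩ (ε X Y e) = 0) : DGCat k where
  Obj := FreeLin k V
  deg := deg δ k
  isInternal := deg_isInternal δ
  id_mem _ := path_mem δ GenPath.nil
  comp_mem := comp_mem δ
  d := d δ ε
  d_mem := d_mem δ ε hε
  d_d := d_d δ ε hε hdε
  leibniz := leibniz δ ε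

section lift

variable {C : DGCat k} (G : GeneratingMorphisms C) (o : C.Obj → O)
  (v : ∀ X Y : C.Obj, G.Gen X Y → ((⟨o X⟩ : FreeLin k V) ⟶ ⟨o Y⟩))

theorem lift_mem
    (hv : ∀ {X Y : C.Obj} (e : G.Gen X Y), v X Y e ∈ deg δ k ⟨o X⟩ ⟨o Y⟩ (G.degree X Y e))
    {X Y : C.Obj} {n : ℤ} {f : X ⟶ Y} (hf : f ∈ C.deg X Y n) :
    G.lift (fun X => (⟨o X⟩ : FreeLin k V)) v f ∈ deg δ k ⟨o X⟩ ⟨o Y⟩ n := by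
  refine G.deg_induction (P := fun f => G.lift (fun X => (⟨o X⟩ : FreeLin k V)) v f ∈
    deg δ k ⟨o X⟩ ⟨o Y⟩ n) hf (fun p hp => ?_) (by simp)
    (fun f f' h h' => by rw [map_add]; exact add_mem h h')
    (fun c f h => by rw [map_smul]; exact Submodule.smul_mem _ c h)
  subst hp
  rw [G.lift_word]
  clear hf f
  induction p with
  | nil => exact path_mem δ GenPath.nil
  | cons p e ih => exact comp_mem δ ih (hv e)

theorem lift_d
    (hv : ∀ {X Y : C.Obj} (e : G.Gen X Y), v X Y e ∈ deg δ k ⟨o X⟩ ⟨o Y⟩ (G.degree X Y e))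
    (hdv : ∀ {X Y : C.Obj} (e : G.Gen X Y), d δ ε ⟨o X⟩ ⟨o Y⟩ (v X Y e) =
      G.lift (fun X => (⟨o X⟩ : FreeLin k V)) v (C.d X Y (G.val X Y e)))
    {X Y : C.Obj} (f : X ⟶ Y) :
    d δ ε ⟨o X⟩ ⟨o Y⟩ (G.lift (fun X => (⟨o X⟩ : FreeLin k V)) v f) =
      G.lift (fun X => (⟨o X⟩ : FreeLin k V)) v (C.d X Y f) := by
  induction f using G.hom_induction with
  | zero => simp
  | add f f' h h' => simp only [map_add, h, h']
  | smul c f h => simp only [map_smul, h]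
  | word p =>
    induction p with
    | nil =>
      have h : C.d X X (𝟙 X) = 0 := by
        have := C.leibniz (𝟙 X) (C.id_mem X)
        simpa [sgn_zero] using this
      change d δ ε _ _ (G.lift _ v (𝟙 X)) = G.lift _ v (C.d X X (𝟙 X))
      rw [G.lift_id, d_id, h, map_zero]
    | cons p e ih =>
      change d δ ε _ _ (G.lift _ v (G.word p ≫ G.val _ _ e)) =
        G.lift _ v (C.d _ _ (G.word p ≫ G.val _ _ e))
      rw [G.lift_comp, G.lift_val, leibniz δ ε _ (hv e), C.leibniz _ (G.val_mem e), ih, hdv,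
        map_add, map_smul, G.lift_comp, G.lift_comp, G.lift_val]

end lift

end FreeLin

/-! ### The mapping cylinder -/

namespace MapCyl

variable {A B : DGCat k} (GA : GeneratingMorphisms A) (GB : GeneratingMorphisms B)
  (F : DGFunctor A B)

/-- The generating morphisms of the mapping cylinder of `F : A → B`. Its objects are those of `B`
(`Sum.inl`) and those of `A` (`Sum.inr`); its generating morphisms are those of `B` and of `A`,
the morphisms `t_X : F X → X`, `t'_X : X → F X`, `t̂_X : F X → F X`, `ť_X : X → X`,
`t̄_X : F X → X` for every object `X` of `A`, and `t_a : F X → Y` for every generating morphism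
`a : X → Y` of `A`. -/
inductive Gen : B.Obj ⊕ A.Obj → B.Obj ⊕ A.Obj → Type u
  | ofB {X Y : B.Obj} (b : GB.Gen X Y) : Gen (Sum.inl X) (Sum.inl Y)
  | ofA {X Y : A.Obj} (a : GA.Gen X Y) : Gen (Sum.inr X) (Sum.inr Y)
  | t (X : A.Obj) : Gen (Sum.inl (F.toFunctor.obj X)) (Sum.inr X)
  | t' (X : A.Obj) : Gen (Sum.inr X) (Sum.inl (F.toFunctor.obj X))
  | tHat (X : A.Obj) : Gen (Sum.inl (F.toFunctor.obj X)) (Sum.inl (F.toFunctor.obj X))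
  | tCheck (X : A.Obj) : Gen (Sum.inr X) (Sum.inr X)
  | tBar (X : A.Obj) : Gen (Sum.inl (F.toFunctor.obj X)) (Sum.inr X)
  | tGen {X Y : A.Obj} (a : GA.Gen X Y) : Gen (Sum.inl (F.toFunctor.obj X)) (Sum.inr Y)

/-- The degrees of the generating morphisms. -/
def degree : ∀ X Y : B.Obj ⊕ A.Obj, Gen GA GB F X Y → ℤ
  | _, _, .ofB b => GB.degree _ _ b
  | _, _, .ofA a => GA.degree _ _ a
  | _, _, .t _ => 0
  | _, _, .t' _ => 0
  | _, _, .tHat _ => -1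
  | _, _, .tCheck _ => -1
  | _, _, .tBar _ => -2
  | _, _, .tGen a => GA.degree _ _ a - 1

/-- The free `k`-linear category underlying the mapping cylinder. -/
abbrev Cat : Type u := FreeLin k (Gen GA GB F)

/-- An object of `B` as an object of the mapping cylinder. -/
abbrev objB (X : B.Obj) : Cat GA GB F := ⟨Sum.inl X⟩

/-- An object of `A` as an object of the mapping cylinder. -/
abbrev objA (X : A.Obj) : Cat GA GB F := ⟨Sum.inr X⟩

/-- The inclusion of the morphisms of `B`. -/
noncomputable def mapB {X Y : B.Obj} : (X ⟶ Y) →ₗ[k] (objB GA GB F X ⟶ objB GA GB F Y) :=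
  GB.lift (objB GA GB F) (fun _ _ b => FreeLin.edge k (Gen.ofB b))

/-- The inclusion of the morphisms of `A`. -/
noncomputable def mapA {X Y : A.Obj} : (X ⟶ Y) →ₗ[k] (objA GA GB F X ⟶ objA GA GB F Y) :=
  GA.lift (objA GA GB F) (fun _ _ a => FreeLin.edge k (Gen.ofA a))

/-- The morphism `t_X : F X → X`. -/
noncomputable def t (X : A.Obj) : objB GA GB F (F.toFunctor.obj X) ⟶ objA GA GB F X :=
  FreeLin.edge k (Gen.t X)

/-- The morphism `t'_X : X → F X`. -/
noncomputable def t' (X : A.Obj) : objA GA GB F X ⟶ objB GA GB F (F.toFunctor.obj X) :=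
  FreeLin.edge k (Gen.t' X)

/-- The morphism `t̂_X : F X → F X`. -/
noncomputable def tHat (X : A.Obj) :
    objB GA GB F (F.toFunctor.obj X) ⟶ objB GA GB F (F.toFunctor.obj X) :=
  FreeLin.edge k (Gen.tHat X)

/-- The morphism `ť_X : X → X`. -/
noncomputable def tCheck (X : A.Obj) : objA GA GB F X ⟶ objA GA GB F X :=
  FreeLin.edge k (Gen.tCheck X)

/-- The morphism `t̄_X : F X → X`. -/
noncomputable def tBar (X : A.Obj) : objB GA GB F (F.toFunctor.obj X) ⟶ objA GA GB F X :=
  FreeLin.edge k (Gen.tBar X)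

/-- The morphism `t_a : F X → Y`, for a generating morphism `a : X → Y` of `A`. -/
noncomputable def tGen {X Y : A.Obj} (a : GA.Gen X Y) :
    objB GA GB F (F.toFunctor.obj X) ⟶ objA GA GB F Y :=
  FreeLin.edge k (Gen.tGen a)

/-- The morphism `t_θ` for a word `θ = aₙ ∘ ⋯ ∘ a₁` in the generating morphisms of `A`: the sum over
`j` of `(-1)^(|aⱼ₋₁| + ⋯ + |a₁|) aₙ ∘ ⋯ ∘ aⱼ₊₁ ∘ t_{aⱼ} ∘ F(aⱼ₋₁ ∘ ⋯ ∘ a₁)`, computed recursively. -/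
noncomputable def tWord {X : A.Obj} : {Y : A.Obj} → GenPath GA.Gen X Y →
    (objB GA GB F (F.toFunctor.obj X) ⟶ objA GA GB F Y)
  | _, .nil => 0
  | _, .cons p a =>
      sgn k (p.degree GA.degree) • (mapB GA GB F (F.toFunctor.map (GA.word p)) ≫ tGen GA GB F a) +
        tWord p ≫ mapA GA GB F (GA.val _ _ a)

/-- The morphism `t_θ : F X → Y` for an arbitrary morphism `θ : X → Y` of `A`, extending `tWord`
linearly. -/
noncomputable def tMap {X Y : A.Obj} :
    (X ⟶ Y) →ₗ[k] (objB GA GB F (F.toFunctor.obj X) ⟶ objA GA GB F Y) :=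
  GA.extend (fun p => tWord GA GB F p)

/-- The differentials of the generating morphisms. In the usual notation:
`d t_X = d t'_X = 0`, `d t̂_X = 1 - t'_X ∘ t_X`, `d ť_X = 1 - t_X ∘ t'_X`,
`d t̄_X = t_X ∘ t̂_X - ť_X ∘ t_X` and
`d t_a = (-1)^|a| (a ∘ t_X - t_Y ∘ F(a)) + t_{da}` for `a : X → Y`. -/
noncomputable def diff : ∀ X Y : B.Obj ⊕ A.Obj, Gen GA GB F X Y →
    ((⟨X⟩ : Cat GA GB F) ⟶ ⟨Y⟩)
  | _, _, .ofB b => mapB GA GB F (B.d _ _ (GB.val _ _ b))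
  | _, _, .ofA a => mapA GA GB F (A.d _ _ (GA.val _ _ a))
  | _, _, .t _ => 0
  | _, _, .t' _ => 0
  | _, _, .tHat X => 𝟙 _ - t GA GB F X ≫ t' GA GB F X
  | _, _, .tCheck X => 𝟙 _ - t' GA GB F X ≫ t GA GB F X
  | _, _, .tBar X => tHat GA GB F X ≫ t GA GB F X - t GA GB F X ≫ tCheck GA GB F X
  | _, _, .tGen (X := X) (Y := Y) a =>
      sgn k (GA.degree X Y a) •
        (t GA GB F X ≫ mapA GA GB F (GA.val X Y a) -
          mapB GA GB F (F.toFunctor.map (GA.val X Y a)) ≫ t GA GB F Y) +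
        tMap GA GB F (A.d X Y (GA.val X Y a))

section Lemmas

open FreeLin

/-- Abbreviation for the differential on the free category. -/
local notation "δM" => degree GA GB F
local notation "dM" => FreeLin.d (degree GA GB F) (diff GA GB F)
local notation "degM" => FreeLin.deg (degree GA GB F) k

theorem mapB_mem {X Y : B.Obj} {n : ℤ} {f : X ⟶ Y} (hf : f ∈ B.deg X Y n) :
    mapB GA GB F f ∈ degM (objB GA GB F X) (objB GA GB F Y) n :=
  lift_mem (δM) GB Sum.inl _ (fun e => edge_mem (δM) (Gen.ofB e)) hf

theorem mapA_mem {X Y : A.Obj} {n : ℤ} {f : X ⟶ Y} (hf : f ∈ A.deg X Y n) :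
    mapA GA GB F f ∈ degM (objA GA GB F X) (objA GA GB F Y) n :=
  lift_mem (δM) GA Sum.inr _ (fun e => edge_mem (δM) (Gen.ofA e)) hf

theorem mapB_d {X Y : B.Obj} (f : X ⟶ Y) :
    dM _ _ (mapB GA GB F f) = mapB GA GB F (B.d X Y f) :=
  lift_d (δM) (diff GA GB F) GB Sum.inl _ (fun e => edge_mem (δM) (Gen.ofB e))
    (fun e => d_edge (δM) (diff GA GB F) (Gen.ofB e)) f

theorem mapA_d {X Y : A.Obj} (f : X ⟶ Y) :
    dM _ _ (mapA GA GB F f) = mapA GA GB F (A.d X Y f) :=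
  lift_d (δM) (diff GA GB F) GA Sum.inr _ (fun e => edge_mem (δM) (Gen.ofA e))
    (fun e => d_edge (δM) (diff GA GB F) (Gen.ofA e)) f

theorem mapB_id (X : B.Obj) : mapB GA GB F (𝟙 X) = 𝟙 _ := GB.lift_id _ _ X

theorem mapA_id (X : A.Obj) : mapA GA GB F (𝟙 X) = 𝟙 _ := GA.lift_id _ _ X

theorem mapB_comp {X Y Z : B.Obj} (f : X ⟶ Y) (g : Y ⟶ Z) :
    mapB GA GB F (f ≫ g) = mapB GA GB F f ≫ mapB GA GB F g := GB.lift_comp _ _ f g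

theorem mapA_comp {X Y Z : A.Obj} (f : X ⟶ Y) (g : Y ⟶ Z) :
    mapA GA GB F (f ≫ g) = mapA GA GB F f ≫ mapA GA GB F g := GA.lift_comp _ _ f g

theorem map_zero' {X Y : A.Obj} : F.toFunctor.map (0 : X ⟶ Y) = 0 := (F.mapL X Y).map_zero

theorem tMap_word {X Y : A.Obj} (p : GenPath GA.Gen X Y) :
    tMap GA GB F (GA.word p) = tWord GA GB F p := GA.extend_word _ p

theorem tMap_id (X : A.Obj) : tMap GA GB F (𝟙 X) = 0 := tMap_word GA GB F GenPath.nil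

theorem tMap_val {X Y : A.Obj} (a : GA.Gen X Y) :
    tMap GA GB F (GA.val X Y a) = tGen GA GB F a := by
  have h := tMap_word GA GB F (GenPath.nil.cons a)
  have h' : GA.word (GenPath.nil.cons a) = GA.val X Y a := Category.id_comp _
  rw [h', tWord, tWord] at h
  rw [h, GenPath.degree, sgn_zero, one_smul]
  change mapB GA GB F (F.toFunctor.map (𝟙 X)) ≫ _ + _ = _
  rw [F.toFunctor.map_id, mapB_id, Category.id_comp, Limits.zero_comp, add_zero]

theorem tMap_comp {X Y Z : A.Obj} {m : ℤ} {f : X ⟶ Y} (hf : f ∈ A.deg X Y m) (g : Y ⟶ Z) :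
    tMap GA GB F (f ≫ g) =
      sgn k m • (mapB GA GB F (F.toFunctor.map f) ≫ tMap GA GB F g) +
        tMap GA GB F f ≫ mapA GA GB F g := by
  refine GA.deg_induction (P := fun f => tMap GA GB F (f ≫ g) =
      sgn k m • (mapB GA GB F (F.toFunctor.map f) ≫ tMap GA GB F g) +
        tMap GA GB F f ≫ mapA GA GB F g) hf (fun p hp => ?_) (by simp [map_zero'])
    (fun f f' h h' => by
      simp only [Preadditive.add_comp, map_add, h, h', F.map_add, smul_add]; abel)
    (fun c f h => by
      simp only [Linear.smul_comp, map_smul, h, F.map_smul, smul_add]; rw [smul_comm])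
  subst hp
  clear hf f
  induction g using GA.hom_induction with
  | zero => simp
  | add g g' h h' => simp only [Preadditive.comp_add, map_add, h, h', smul_add]; abel
  | smul c g h => simp only [Linear.comp_smul, map_smul, h, smul_add]; rw [smul_comm]
  | word q =>
    rw [← GenPath.eval_comp, tMap_word, tMap_word, tMap_word]
    induction q with
    | nil =>
      change tWord GA GB F p = _ • (_ ≫ 0) + _ ≫ mapA GA GB F (𝟙 _)
      rw [mapA_id]; simp
    | cons q e ih =>
      have hq : GA.word (q.cons e) = GA.word q ≫ GA.val _ _ e := rfl
      have hpq : GA.word (p.comp q) = GA.word p ≫ GA.word q := GenPath.eval_comp _ _ p q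
      simp only [GenPath.comp, tWord, ih, GenPath.degree_comp, hq, hpq, mapA_comp, sgn_add,
        F.toFunctor.map_comp, mapB_comp]
      simp only [Preadditive.add_comp, Preadditive.comp_add, Linear.smul_comp, Linear.comp_smul,
        smul_add, smul_smul, Category.assoc]
      abel

theorem tMap_mem {X Y : A.Obj} {n : ℤ} {f : X ⟶ Y} (hf : f ∈ A.deg X Y n) :
    tMap GA GB F f ∈ degM (objB GA GB F (F.toFunctor.obj X)) (objA GA GB F Y) (n - 1) := by
  refine GA.deg_induction (P := fun f => tMap GA GB F f ∈ degM _ _ (n - 1)) hf (fun p hp => ?_)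
    (by simp) (fun f f' h h' => by rw [map_add]; exact add_mem h h')
    (fun c f h => by rw [map_smul]; exact Submodule.smul_mem _ c h)
  subst hp
  clear hf f
  rw [tMap_word]
  induction p with
  | nil => exact zero_mem _
  | cons p e ih =>
    simp only [tWord, GenPath.degree]
    refine add_mem (Submodule.smul_mem _ _ ?_) ?_
    · rw [add_sub_assoc]
      exact comp_mem (δM) (mapB_mem GA GB F (F.map_deg (GA.word_mem p)))
        (edge_mem (δM) (Gen.tGen e))
    · rw [add_sub_right_comm]
      exact comp_mem (δM) ih (mapA_mem GA GB F (GA.val_mem e))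

theorem t_mem (X : A.Obj) : t GA GB F X ∈ degM _ _ 0 := edge_mem (δM) (Gen.t X)

theorem t'_mem (X : A.Obj) : t' GA GB F X ∈ degM _ _ 0 := edge_mem (δM) (Gen.t' X)

theorem tHat_mem (X : A.Obj) : tHat GA GB F X ∈ degM _ _ (-1) := edge_mem (δM) (Gen.tHat X)

theorem tCheck_mem (X : A.Obj) : tCheck GA GB F X ∈ degM _ _ (-1) := edge_mem (δM) (Gen.tCheck X)

theorem d_t (X : A.Obj) : dM _ _ (t GA GB F X) = 0 := d_edge (δM) (diff GA GB F) (Gen.t X)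

theorem d_t' (X : A.Obj) : dM _ _ (t' GA GB F X) = 0 := d_edge (δM) (diff GA GB F) (Gen.t' X)

theorem d_tHat (X : A.Obj) : dM _ _ (tHat GA GB F X) = 𝟙 _ - t GA GB F X ≫ t' GA GB F X :=
  d_edge (δM) (diff GA GB F) (Gen.tHat X)

theorem d_tCheck (X : A.Obj) : dM _ _ (tCheck GA GB F X) = 𝟙 _ - t' GA GB F X ≫ t GA GB F X :=
  d_edge (δM) (diff GA GB F) (Gen.tCheck X)

theorem d_tGen {X Y : A.Obj} (a : GA.Gen X Y) :
    dM _ _ (tGen GA GB F a) = sgn k (GA.degree X Y a) •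
        (t GA GB F X ≫ mapA GA GB F (GA.val X Y a) -
          mapB GA GB F (F.toFunctor.map (GA.val X Y a)) ≫ t GA GB F Y) +
        tMap GA GB F (A.d X Y (GA.val X Y a)) :=
  d_edge (δM) (diff GA GB F) (Gen.tGen a)

theorem tGen_mem {X Y : A.Obj} (a : GA.Gen X Y) :
    tGen GA GB F a ∈ degM (objB GA GB F (F.toFunctor.obj X)) (objA GA GB F Y)
      (GA.degree X Y a - 1) := edge_mem (δM) (Gen.tGen a)

theorem tMap_d {X Y : A.Obj} {n : ℤ} {f : X ⟶ Y} (hf : f ∈ A.deg X Y n) :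
    dM _ _ (tMap GA GB F f) = sgn k n •
        (t GA GB F X ≫ mapA GA GB F f - mapB GA GB F (F.toFunctor.map f) ≫ t GA GB F Y) +
        tMap GA GB F (A.d X Y f) := by
  refine GA.deg_induction (P := fun f => dM _ _ (tMap GA GB F f) = sgn k n •
        (t GA GB F X ≫ mapA GA GB F f - mapB GA GB F (F.toFunctor.map f) ≫ t GA GB F Y) +
        tMap GA GB F (A.d X Y f)) hf (fun p hp => ?_) (by simp [map_zero'])
    (fun f f' h h' => by
      simp only [Preadditive.add_comp, Preadditive.comp_add, map_add, h, h', F.map_add, smul_add,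
        smul_sub]
      abel)
    (fun c f h => by
      simp only [Linear.smul_comp, Linear.comp_smul, map_smul, h, F.map_smul, smul_add, smul_sub]
      simp only [smul_comm c])
  subst hp
  clear hf f
  induction p with
  | nil =>
    have h : A.d X X (𝟙 X) = 0 := by
      have := A.leibniz (𝟙 X) (A.id_mem X)
      simpa [sgn_zero] using this
    change dM _ _ (tMap GA GB F (𝟙 X)) = _ • (_ ≫ mapA GA GB F (𝟙 X) -
      mapB GA GB F (F.toFunctor.map (𝟙 X)) ≫ _) + tMap GA GB F (A.d X X (𝟙 X))
    rw [tMap_id, h, F.toFunctor.map_id, mapA_id, mapB_id]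
    simp
  | cons p e ih =>
    have hp : GA.word (p.cons e) = GA.word p ≫ GA.val _ _ e := rfl
    have hd : A.d _ _ (GA.word p) ∈ A.deg _ _ (p.degree GA.degree + 1) :=
      A.d_mem (GA.word_mem p)
    rw [hp, tMap_comp GA GB F (GA.word_mem p), A.leibniz _ (GA.val_mem e), map_add, map_add,
      map_smul, map_smul, tMap_val, leibniz (δM) (diff GA GB F) _ (tGen_mem GA GB F e),
      leibniz (δM) (diff GA GB F) _ (mapA_mem GA GB F (GA.val_mem e)), ih, mapB_d, mapA_d,
      ← F.map_d, tMap_comp GA GB F (GA.word_mem p), tMap_comp GA GB F hd, tMap_val,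
      F.toFunctor.map_comp, mapA_comp, mapB_comp]
    rw [d_tGen]
    have h1 : sgn k (GA.degree _ _ e - 1) = - sgn k (GA.degree _ _ e) := by
      have := sgn_add k (GA.degree _ _ e - 1) 1
      rw [sub_add_cancel, sgn_one] at this
      rw [this]; ring
    simp only [h1, GenPath.degree, sgn_add, sgn_one, Preadditive.add_comp, Preadditive.comp_add,
      Preadditive.sub_comp, Preadditive.comp_sub, Linear.smul_comp, Linear.comp_smul,
      smul_add, smul_sub, smul_smul, Category.assoc, neg_smul, mul_neg, mul_one,
      smul_neg]
    rw [mul_comm (sgn k (GA.degree _ _ e)) (sgn k (p.degree GA.degree))]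
    abel

theorem diff_mem {X Y : B.Obj ⊕ A.Obj} (e : Gen GA GB F X Y) :
    diff GA GB F X Y e ∈ degM ⟨X⟩ ⟨Y⟩ (degree GA GB F X Y e + 1) := by
  cases e with
  | ofB b => exact mapB_mem GA GB F (B.d_mem (GB.val_mem b))
  | ofA a => exact mapA_mem GA GB F (A.d_mem (GA.val_mem a))
  | t X => exact zero_mem _
  | t' X => exact zero_mem _
  | tHat X =>
    have h := comp_mem (δM) (t_mem GA GB F X) (t'_mem GA GB F X)
    exact sub_mem (path_mem (δM) GenPath.nil) h
  | tCheck X =>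
    have h := comp_mem (δM) (t'_mem GA GB F X) (t_mem GA GB F X)
    exact sub_mem (path_mem (δM) GenPath.nil) h
  | tBar X =>
    have h := comp_mem (δM) (tHat_mem GA GB F X) (t_mem GA GB F X)
    have h' := comp_mem (δM) (t_mem GA GB F X) (tCheck_mem GA GB F X)
    exact sub_mem h h'
  | tGen a =>
    simp only [diff, degree, sub_add_cancel]
    refine add_mem (Submodule.smul_mem _ _ (sub_mem ?_ ?_)) ?_
    · have h := comp_mem (δM) (t_mem GA GB F _) (mapA_mem GA GB F (GA.val_mem a))
      rwa [zero_add] at h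
    · have h := comp_mem (δM) (mapB_mem GA GB F (F.map_deg (GA.val_mem a))) (t_mem GA GB F _)
      rwa [add_zero] at h
    · have h := tMap_mem GA GB F (A.d_mem (GA.val_mem a))
      rwa [add_sub_cancel_right] at h

theorem d_diff {X Y : B.Obj ⊕ A.Obj} (e : Gen GA GB F X Y) :
    dM ⟨X⟩ ⟨Y⟩ (diff GA GB F X Y e) = 0 := by
  cases e with
  | ofB b => simp only [diff, mapB_d, B.d_d, map_zero]
  | ofA a => simp only [diff, mapA_d, A.d_d, map_zero]
  | t X => exact map_zero _
  | t' X => exact map_zero _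
  | tHat X =>
    simp only [diff]
    rw [map_sub, leibniz (δM) (diff GA GB F) _ (t'_mem GA GB F X), d_t, d_t', d_id]
    simp
  | tCheck X =>
    simp only [diff]
    rw [map_sub, leibniz (δM) (diff GA GB F) _ (t_mem GA GB F X), d_t, d_t', d_id]
    simp
  | tBar X =>
    simp only [diff]
    rw [map_sub, leibniz (δM) (diff GA GB F) _ (t_mem GA GB F X),
      leibniz (δM) (diff GA GB F) _ (tCheck_mem GA GB F X), d_t, d_tHat, d_tCheck, sgn_zero]
    simp
  | tGen a =>
    simp only [diff]
    rw [map_add, map_smul, map_sub,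
      leibniz (δM) (diff GA GB F) _ (mapA_mem GA GB F (GA.val_mem a)),
      leibniz (δM) (diff GA GB F) _ (t_mem GA GB F _), d_t, d_t, mapA_d, mapB_d,
      tMap_d GA GB F (A.d_mem (GA.val_mem a)), A.d_d, ← F.map_d, sgn_add, sgn_one, sgn_zero]
    simp

end Lemmas

end MapCyl

/-- The mapping cylinder `M_F` of a dg functor `F : A → B` between semifree dg categories. -/
noncomputable def mapCyl {A B : DGCatS k} (F : A ⟶ B) : DGCat k :=
  FreeLin.toDGCat (MapCyl.degree A.gens B.gens F.hom) (MapCyl.diff A.gens B.gens F.hom)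
    (MapCyl.diff_mem A.gens B.gens F.hom) (MapCyl.d_diff A.gens B.gens F.hom)

namespace mapCyl

variable {A B A' B' : DGCatS k}

/-- The inclusion `B → M_F`. -/
noncomputable def inclB (F : A ⟶ B) : B.dg ⟶ mapCyl F where
  toFunctor :=
    { obj := MapCyl.objB A.gens B.gens F.hom
      map := fun f => MapCyl.mapB A.gens B.gens F.hom f
      map_id := MapCyl.mapB_id A.gens B.gens F.hom
      map_comp := MapCyl.mapB_comp A.gens B.gens F.hom }
  map_add f g := _root_.map_add (MapCyl.mapB A.gens B.gens F.hom) f g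
  map_smul c f := _root_.map_smul (MapCyl.mapB A.gens B.gens F.hom) c f
  map_deg := MapCyl.mapB_mem A.gens B.gens F.hom
  map_d f := (MapCyl.mapB_d A.gens B.gens F.hom f).symm

/-- The inclusion `A → M_F`; this is the dg functor `j` of the factorization. -/
noncomputable def inclA (F : A ⟶ B) : A.dg ⟶ mapCyl F where
  toFunctor :=
    { obj := MapCyl.objA A.gens B.gens F.hom
      map := fun f => MapCyl.mapA A.gens B.gens F.hom f
      map_id := MapCyl.mapA_id A.gens B.gens F.hom
      map_comp := MapCyl.mapA_comp A.gens B.gens F.hom }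
  map_add f g := _root_.map_add (MapCyl.mapA A.gens B.gens F.hom) f g
  map_smul c f := _root_.map_smul (MapCyl.mapA A.gens B.gens F.hom) c f
  map_deg := MapCyl.mapA_mem A.gens B.gens F.hom
  map_d f := (MapCyl.mapA_d A.gens B.gens F.hom f).symm

/-- The value of a dg functor `Φ : M_F → C` on a morphism `f` of `M_F`, as a morphism of `C` together
with its source and target (`Arrow.mk` records these, so that an equality between arrows is an
equality of morphisms including their sources and targets). -/
def val {F : A ⟶ B} {C : DGCat k} (Φ : mapCyl F ⟶ C) {X Y : MapCyl.Cat A.gens B.gens F.hom}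
    (f : X ⟶ Y) : Arrow C.Obj :=
  Arrow.mk (DGFunctor.toFunctor (C := mapCyl F) Φ |>.map f)

open MapCyl

/-- The dg functor `q : M_F → B` is given by `q|_B = 1`, `q|_A = F`, `q(t_X) = q(t'_X) = 1_{F X}` and
`q(t̂_X) = q(ť_X) = q(t̄_X) = q(t_a) = 0`. -/
structure IsProjection (F : A ⟶ B) (q : mapCyl F ⟶ B.dg) : Prop where
  inclB_comp : inclB F ≫ q = 𝟙 B.dg
  inclA_comp : inclA F ≫ q = F.hom
  map_t : ∀ X : A.dg.Obj,
    val q (t A.gens B.gens F.hom X) = Arrow.mk (𝟙 (F.hom.toFunctor.obj X))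
  map_t' : ∀ X : A.dg.Obj,
    val q (t' A.gens B.gens F.hom X) = Arrow.mk (𝟙 (F.hom.toFunctor.obj X))
  map_tHat : ∀ X : A.dg.Obj, val q (tHat A.gens B.gens F.hom X) =
    Arrow.mk (0 : F.hom.toFunctor.obj X ⟶ F.hom.toFunctor.obj X)
  map_tCheck : ∀ X : A.dg.Obj, val q (tCheck A.gens B.gens F.hom X) =
    Arrow.mk (0 : F.hom.toFunctor.obj X ⟶ F.hom.toFunctor.obj X)
  map_tBar : ∀ X : A.dg.Obj, val q (tBar A.gens B.gens F.hom X) =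
    Arrow.mk (0 : F.hom.toFunctor.obj X ⟶ F.hom.toFunctor.obj X)
  map_tGen : ∀ {X Y : A.dg.Obj} (a : A.gens.Gen X Y), val q (tGen A.gens B.gens F.hom a) =
    Arrow.mk (0 : F.hom.toFunctor.obj X ⟶ F.hom.toFunctor.obj Y)

/-- The dg functor `M(α, β) : M_F → M_F'` is given by `β` on `B`, by `α` on `A`, by
`t*_X ↦ t*_{α X}` for each `t* = t, t', t̂, ť, t̄`, and by `t_a ↦ t_{α(a)}` for the generating
morphisms `a` of `A`. -/
structure IsInducedMap (F : A ⟶ B) (F' : A' ⟶ B') (α : A ⟶ A') (β : B ⟶ B')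
    (Φ : mapCyl F ⟶ mapCyl F') : Prop where
  inclB_comp : inclB F ≫ Φ = β.hom ≫ inclB F'
  inclA_comp : inclA F ≫ Φ = α.hom ≫ inclA F'
  map_t : ∀ X : A.dg.Obj, val Φ (t A.gens B.gens F.hom X) =
    Arrow.mk (t A'.gens B'.gens F'.hom (α.hom.toFunctor.obj X))
  map_t' : ∀ X : A.dg.Obj, val Φ (t' A.gens B.gens F.hom X) =
    Arrow.mk (t' A'.gens B'.gens F'.hom (α.hom.toFunctor.obj X))
  map_tHat : ∀ X : A.dg.Obj, val Φ (tHat A.gens B.gens F.hom X) =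
    Arrow.mk (tHat A'.gens B'.gens F'.hom (α.hom.toFunctor.obj X))
  map_tCheck : ∀ X : A.dg.Obj, val Φ (tCheck A.gens B.gens F.hom X) =
    Arrow.mk (tCheck A'.gens B'.gens F'.hom (α.hom.toFunctor.obj X))
  map_tBar : ∀ X : A.dg.Obj, val Φ (tBar A.gens B.gens F.hom X) =
    Arrow.mk (tBar A'.gens B'.gens F'.hom (α.hom.toFunctor.obj X))
  map_tGen : ∀ {X Y : A.dg.Obj} (a : A.gens.Gen X Y), val Φ (tGen A.gens B.gens F.hom a) =
    Arrow.mk (tMap A'.gens B'.gens F'.hom (α.hom.toFunctor.map (A.gens.val X Y a)))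

end mapCyl

end DGCyl

open DGCyl

namespace DGCyl

variable {k : Type u} [CommRing k]

/-! The cylinder represents coherent homotopy equivalences. Put `t_A`, `t'_A`, `t̂_A`, `ť_A`, `t̄_A`
and the derivation `θ ↦ t_θ` into one structure, `CohEquiv P Q`, between two dg functors. Since
`M_F` is free on its letters, a dg functor out of it amounts to a dg functor `Φ` on `B`, a dg
functor `Ψ` on `A` and a `CohEquiv` from `Φ ∘ F` to `Ψ`: the axioms of the structure are exactly the
compatibility with `d` on letters (`d_descGen`). Existence and uniqueness are `exists_isDesc` and
`IsDesc.unique`.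

Most claims are instances of this property. The projection `q` corresponds to the identity
equivalence of `F`, and `M(α, β)` to the universal equivalence of `M_{F'}` restricted along `α`;
functoriality is then uniqueness. For the pushout, a dg functor on `Cyl(A)` is itself an equivalence
between two dg functors on `A`. When the one on the target copy factors through `F`, this is the
datum needed on `M_F` (`IsInducedMap.isDesc_iff`). The step beyond letters is that `t_a` must go to
`t_θ` with `θ = α(a)` not a generator; `IsDesc.map_tMap` handles it, as both sides are derivations
agreeing on generators.

For the quasi-equivalence, let `i` be the inclusion of `B`, so `q ∘ i = 1`. One builds a
derivation-type homotopy `S` from `i ∘ q` to the identity with components `1` on `B` and `t_A` on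
`A`. It is zero on the letters of `B` and satisfies `S(a) = t_a`, `S(t'_A) = -t̂_A`, `S(ť_A) =
t̄_A`, and is zero on the other letters (`d_contrGen`). The generator `t̄_A` is what makes the
equation at `ť_A` solvable. Together with the homotopy inverses `t'_A` this gives bijectivity on
cohomology by `Homotopy.bijective_mapCohomology`.

Semifreeness comes from ordering the letters by levels so that each differential only involves
earlier ones (`generated_diff`). Dropping the letters of `A` leaves the family that exhibits `j` as
a semifree extension. -/

theorem DGCat.d_id (C : DGCat k) (X : C.Obj) : C.d X X (𝟙 X) = 0 := by
  have := C.leibniz (𝟙 X) (C.id_mem X)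
  simpa [sgn_zero] using this

theorem sgn_sub_one (n : ℤ) : sgn k (n - 1) = - sgn k n := by
  have := sgn_add k (n - 1) 1
  rw [sub_add_cancel, sgn_one] at this
  rw [this]; ring

theorem sgn_smul_sgn_smul {M : Type*} [AddCommGroup M] [Module k M] (n : ℤ) (x : M) :
    sgn k n • sgn k n • x = x := by
  rw [smul_smul, sgn_sq, one_smul]

namespace DGFunctor

variable {C D : DGCat k}

theorem ext_toFunctor {F G : DGFunctor C D} (h : F.toFunctor = G.toFunctor) : F = G := by
  cases F; cases G; cases h; rfl

theorem map_zero (F : DGFunctor C D) (X Y : C.Obj) : F.toFunctor.map (0 : X ⟶ Y) = 0 :=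
  (F.mapL X Y).map_zero

theorem map_sub (F : DGFunctor C D) {X Y : C.Obj} (f g : X ⟶ Y) :
    F.toFunctor.map (f - g) = F.toFunctor.map f - F.toFunctor.map g :=
  (F.mapL X Y).map_sub f g

end DGFunctor

/-! ### Functors out of a semifree dg category -/

namespace Generated

variable {C D : Type u} [Category.{u} C] [Preadditive C] [Linear k C]
  [Category.{u} D] [Preadditive D] [Linear k D]

theorem mono {S T : ∀ ⦃X Y : C⦄, (X ⟶ Y) → Prop} (h : ∀ ⦃X Y : C⦄ (f : X ⟶ Y), S f → T f)
    {X Y : C} {f : X ⟶ Y} (hf : Generated k S f) : Generated k T f := by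
  induction hf with
  | of hf => exact .of (h _ hf)
  | id X => exact .id X
  | comp _ _ hf hg => exact .comp hf hg
  | zero => exact .zero
  | add _ _ hf hg => exact .add hf hg
  | smul c _ hf => exact .smul c hf

theorem neg {S : ∀ ⦃X Y : C⦄, (X ⟶ Y) → Prop} {X Y : C} {f : X ⟶ Y} (hf : Generated k S f) :
    Generated k S (-f) := by
  simpa using hf.smul (-1)

theorem sub {S : ∀ ⦃X Y : C⦄, (X ⟶ Y) → Prop} {X Y : C} {f g : X ⟶ Y} (hf : Generated k S f)
    (hg : Generated k S g) : Generated k S (f - g) := by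
  simpa [sub_eq_add_neg] using hf.add hg.neg

end Generated

namespace GeneratingMorphisms

variable {C D : DGCat k} (G : GeneratingMorphisms C)

theorem word_cons {X Y Z : C.Obj} (p : GenPath G.Gen X Y) (e : G.Gen Y Z) :
    G.word (p.cons e) = G.word p ≫ G.val Y Z e := rfl

/-- Words span every module of morphisms. This is used to see that a letter of the cylinder lying
above all of `A` or `B` may have any morphism of that category in its differential. -/
theorem generated {X Y : C.Obj} (f : X ⟶ Y) :
    Generated k (fun X Y g => ∃ e : G.Gen X Y, G.val X Y e = g) f := by
  induction f using G.hom_induction with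
  | zero => exact .zero
  | add f g hf hg => exact .add hf hg
  | smul c f hf => exact .smul c hf
  | word p =>
    induction p with
    | nil => exact .id _
    | cons p e ih => exact .comp ih (.of ⟨e, rfl⟩)

/-- The object maps agree only propositionally, so values on generators are compared as arrows. Each
such equality unpacks to conjugation by `eqToHom`, and these conjugations cancel along a word. -/
theorem dgFunctor_ext {Φ Ψ : DGFunctor C D}
    (hobj : ∀ X, Φ.toFunctor.obj X = Ψ.toFunctor.obj X)
    (hval : ∀ {X Y : C.Obj} (e : G.Gen X Y),
      Arrow.mk (Φ.toFunctor.map (G.val X Y e)) = Arrow.mk (Ψ.toFunctor.map (G.val X Y e))) :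
    Φ = Ψ := by
  refine DGFunctor.ext_toFunctor (CategoryTheory.Functor.ext hobj fun X Y f => ?_)
  induction f using G.hom_induction with
  | zero => simp [DGFunctor.map_zero]
  | add f g hf hg => simp [DGFunctor.map_add, hf, hg]
  | smul c f hf => simp [DGFunctor.map_smul, hf]
  | word p =>
    induction p with
    | nil =>
      change Φ.toFunctor.map (𝟙 X) = _ ≫ Ψ.toFunctor.map (𝟙 X) ≫ _
      simp
    | cons p e ih =>
      obtain ⟨_, _, h⟩ := (Arrow.mk_eq_mk_iff _ _).1 (hval e)
      rw [word_cons, Functor.map_comp, Functor.map_comp, ih, h]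
      simp

/-- The `k`-linear functor with given values on objects and on generating morphisms. -/
noncomputable def linearFunctor {E : Type u} [Category.{u} E] [Preadditive E] [Linear k E]
    (o : C.Obj → E) (v : ∀ X Y : C.Obj, G.Gen X Y → (o X ⟶ o Y)) : LinearFunctorOn k o where
  map _ _ := G.lift o v
  map_id := G.lift_id o v
  map_comp := G.lift_comp o v

theorem linearFunctor_ext {E : Type u} [Category.{u} E] [Preadditive E] [Linear k E]
    {o : C.Obj → E} {H K : LinearFunctorOn k o}
    (h : ∀ {X Y : C.Obj} (e : G.Gen X Y), H.map X Y (G.val X Y e) = K.map X Y (G.val X Y e)) :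
    H = K := by
  have : H.map = K.map := by
    ext X Y f
    induction f using G.hom_induction with
    | zero => simp
    | add f g hf hg => simp [hf, hg]
    | smul c f hf => simp [hf]
    | word p =>
      induction p with
      | nil => exact (H.map_id X).trans (K.map_id X).symm
      | cons p e ih => rw [word_cons, H.map_comp, K.map_comp, ih, h]
  cases H; cases K; cases this; rfl

/-- The dg functor with given values on objects and on generating morphisms. -/
noncomputable def dgFunctor (o : C.Obj → D.Obj) (v : ∀ X Y : C.Obj, G.Gen X Y → (o X ⟶ o Y))
    (v_mem : ∀ {X Y : C.Obj} (e : G.Gen X Y), v X Y e ∈ D.deg (o X) (o Y) (G.degree X Y e))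
    (d_v : ∀ {X Y : C.Obj} (e : G.Gen X Y),
      D.d (o X) (o Y) (v X Y e) = G.lift o v (C.d X Y (G.val X Y e))) :
    DGFunctor C D where
  toFunctor :=
    { obj := o
      map := fun f => G.lift o v f
      map_id := G.lift_id o v
      map_comp := G.lift_comp o v }
  map_add f g := _root_.map_add (G.lift o v) f g
  map_smul c f := _root_.map_smul (G.lift o v) c f
  map_deg {X Y n f} hf := by
    refine G.deg_induction (P := fun f => G.lift o v f ∈ D.deg (o X) (o Y) n) hf
      (fun p hp => ?_) (by simp) (fun f f' h h' => by rw [_root_.map_add]; exact add_mem h h')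
      (fun c f h => by rw [_root_.map_smul]; exact Submodule.smul_mem _ c h)
    subst hp
    rw [G.lift_word]
    clear hf f
    induction p with
    | nil => exact D.id_mem _
    | cons p e ih => exact D.comp_mem ih (v_mem e)
  map_d {X Y} f := by
    dsimp only
    induction f using G.hom_induction with
    | zero => simp
    | add f f' h h' => simp only [_root_.map_add, h, h']
    | smul c f h => simp only [_root_.map_smul, h]
    | word p =>
      induction p with
      | nil =>
        change G.lift o v (C.d X X (𝟙 X)) = D.d _ _ (G.lift o v (𝟙 X))
        rw [G.lift_id, D.d_id, C.d_id, _root_.map_zero]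
      | cons p e ih =>
        rw [word_cons, G.lift_comp, G.lift_val, C.leibniz _ (G.val_mem e), D.leibniz _ (v_mem e),
          ← ih, d_v, _root_.map_add, _root_.map_smul, G.lift_comp, G.lift_comp, G.lift_val]

end GeneratingMorphisms

/-! ### Homotopies between dg functors -/

/-- A natural transformation up to homotopy between dg functors: closed morphisms
`P X ⟶ Q X` of degree `0` and morphisms `P X ⟶ Q Y` of degree `|f| - 1` for `f : X ⟶ Y`,
which form a derivation and witness the naturality squares. -/
structure Homotopy {C D : DGCat k} (P Q : DGFunctor C D) : Type u where
  app : ∀ X : C.Obj, P.toFunctor.obj X ⟶ Q.toFunctor.obj X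
  app_mem : ∀ X : C.Obj, app X ∈ D.deg _ _ 0
  d_app : ∀ X : C.Obj, D.d _ _ (app X) = 0
  map : ∀ {X Y : C.Obj}, (X ⟶ Y) →ₗ[k] (P.toFunctor.obj X ⟶ Q.toFunctor.obj Y)
  map_comp : ∀ {X Y Z : C.Obj} {m : ℤ} {f : X ⟶ Y}, f ∈ C.deg X Y m → ∀ g : Y ⟶ Z,
    map (f ≫ g) = sgn k m • (P.toFunctor.map f ≫ map g) + map f ≫ Q.toFunctor.map g
  map_mem : ∀ {X Y : C.Obj} {n : ℤ} {f : X ⟶ Y}, f ∈ C.deg X Y n → map f ∈ D.deg _ _ (n - 1)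
  d_map : ∀ {X Y : C.Obj} {n : ℤ} {f : X ⟶ Y}, f ∈ C.deg X Y n →
    D.d _ _ (map f) = sgn k n • (app X ≫ Q.toFunctor.map f - P.toFunctor.map f ≫ app Y) +
      map (C.d X Y f)

/-- The derivation rule for `1 ∘ 1` gives `x = x + x`. -/
theorem Homotopy.map_id {C D : DGCat k} {P Q : DGFunctor C D} (H : Homotopy P Q) (X : C.Obj) :
    H.map (𝟙 X) = 0 := by
  have h := H.map_comp (C.id_mem X) (𝟙 X)
  simpa [sgn_zero] using h

namespace GeneratingMorphisms

variable {C D : DGCat k} (G : GeneratingMorphisms C) {P Q : DGFunctor C D}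

section twist

variable (s : ∀ X Y : C.Obj, G.Gen X Y → (P.toFunctor.obj X ⟶ Q.toFunctor.obj Y))

/-- The value on a word of the derivation with given values on the generating morphisms. -/
noncomputable def twistWord {X : C.Obj} : {Y : C.Obj} → GenPath G.Gen X Y →
    (P.toFunctor.obj X ⟶ Q.toFunctor.obj Y)
  | _, .nil => 0
  | _, .cons p e => sgn k (p.degree G.degree) • (P.toFunctor.map (G.word p) ≫ s _ _ e) +
      twistWord p ≫ Q.toFunctor.map (G.val _ _ e)

/-- The derivation, relative to two dg functors, with given values on the generating morphisms. -/
noncomputable def twist {X Y : C.Obj} :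
    (X ⟶ Y) →ₗ[k] (P.toFunctor.obj X ⟶ Q.toFunctor.obj Y) :=
  G.extend (fun p => G.twistWord s p)

theorem twist_word {X Y : C.Obj} (p : GenPath G.Gen X Y) :
    G.twist s (G.word p) = G.twistWord s p :=
  G.extend_word _ p

theorem twist_id (X : C.Obj) : G.twist s (𝟙 X) = 0 := G.twist_word s GenPath.nil

theorem twist_val {X Y : C.Obj} (e : G.Gen X Y) : G.twist s (G.val X Y e) = s X Y e := by
  have h := G.twist_word s (GenPath.nil.cons e)
  have h' : G.word (GenPath.nil.cons e) = G.val X Y e := Category.id_comp _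
  rw [h', twistWord, twistWord] at h
  rw [h, GenPath.degree, sgn_zero, one_smul]
  change P.toFunctor.map (𝟙 X) ≫ _ + _ = _
  simp

/-- Only the first factor contributes a sign, so only it has to be homogeneous. By linearity both
factors become words, and the induction runs over the second because `twistWord` peels off last
letters. -/
theorem twist_comp {X Y Z : C.Obj} {m : ℤ} {f : X ⟶ Y} (hf : f ∈ C.deg X Y m) (g : Y ⟶ Z) :
    G.twist s (f ≫ g) =
      sgn k m • (P.toFunctor.map f ≫ G.twist s g) + G.twist s f ≫ Q.toFunctor.map g := by
  refine G.deg_induction (P := fun f => G.twist s (f ≫ g) =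
      sgn k m • (P.toFunctor.map f ≫ G.twist s g) + G.twist s f ≫ Q.toFunctor.map g)
    hf (fun p hp => ?_) (by simp [DGFunctor.map_zero])
    (fun f f' h h' => by
      simp only [Preadditive.add_comp, map_add, h, h', P.map_add, smul_add]; abel)
    (fun c f h => by
      simp only [Linear.smul_comp, map_smul, h, P.map_smul, smul_add]; rw [smul_comm])
  subst hp
  clear hf f
  induction g using G.hom_induction with
  | zero => simp [DGFunctor.map_zero]
  | add g g' h h' =>
    simp only [Preadditive.comp_add, map_add, h, h', smul_add, Q.map_add]; abel
  | smul c g h =>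
    simp only [Linear.comp_smul, map_smul, h, smul_add, Q.map_smul]; rw [smul_comm]
  | word q =>
    rw [← GenPath.eval_comp, twist_word, twist_word, twist_word]
    induction q with
    | nil =>
      change G.twistWord s p = _ • (_ ≫ 0) + _ ≫ Q.toFunctor.map (𝟙 _)
      simp
    | cons q e ih =>
      have hpq : G.word (p.comp q) = G.word p ≫ G.word q := GenPath.eval_comp _ _ p q
      simp only [GenPath.comp, twistWord, ih, GenPath.degree_comp, word_cons, hpq, sgn_add,
        Functor.map_comp]
      simp only [Preadditive.add_comp, Preadditive.comp_add, Linear.smul_comp, Linear.comp_smul,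
        smul_add, smul_smul, Category.assoc]
      abel

variable {s}

theorem twist_mem
    (s_mem : ∀ {X Y : C.Obj} (e : G.Gen X Y), s X Y e ∈ D.deg _ _ (G.degree X Y e - 1))
    {X Y : C.Obj} {n : ℤ} {f : X ⟶ Y} (hf : f ∈ C.deg X Y n) :
    G.twist s f ∈ D.deg (P.toFunctor.obj X) (Q.toFunctor.obj Y) (n - 1) := by
  refine G.deg_induction (P := fun f => G.twist s f ∈ D.deg _ _ (n - 1)) hf (fun p hp => ?_)
    (by simp) (fun f f' h h' => by rw [map_add]; exact add_mem h h')
    (fun c f h => by rw [map_smul]; exact Submodule.smul_mem _ c h)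
  subst hp
  clear hf f
  rw [twist_word]
  induction p with
  | nil => exact zero_mem _
  | cons p e ih =>
    simp only [twistWord, GenPath.degree]
    refine add_mem (Submodule.smul_mem _ _ ?_) ?_
    · rw [add_sub_assoc]
      exact D.comp_mem (P.map_deg (G.word_mem p)) (s_mem e)
    · rw [add_sub_right_comm]
      exact D.comp_mem ih (Q.map_deg (G.val_mem e))

/-- The homotopy equation propagates from letters to words. When a letter is appended, the component
at the intermediate object occurs twice with opposite signs, once from the word and once from the
letter, and cancels. The remaining terms assemble into the derivation applied to the Leibniz
expansion of `d`. -/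
theorem d_twist (app : ∀ X : C.Obj, P.toFunctor.obj X ⟶ Q.toFunctor.obj X)
    (s_mem : ∀ {X Y : C.Obj} (e : G.Gen X Y), s X Y e ∈ D.deg _ _ (G.degree X Y e - 1))
    (d_s : ∀ {X Y : C.Obj} (e : G.Gen X Y), D.d _ _ (s X Y e) = sgn k (G.degree X Y e) •
        (app X ≫ Q.toFunctor.map (G.val X Y e) - P.toFunctor.map (G.val X Y e) ≫ app Y) +
      G.twist s (C.d X Y (G.val X Y e)))
    {X Y : C.Obj} {n : ℤ} {f : X ⟶ Y} (hf : f ∈ C.deg X Y n) :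
    D.d _ _ (G.twist s f) = sgn k n •
        (app X ≫ Q.toFunctor.map f - P.toFunctor.map f ≫ app Y) + G.twist s (C.d X Y f) := by
  refine G.deg_induction (P := fun f => D.d _ _ (G.twist s f) = sgn k n •
        (app X ≫ Q.toFunctor.map f - P.toFunctor.map f ≫ app Y) + G.twist s (C.d X Y f))
    hf (fun p hp => ?_) (by simp [DGFunctor.map_zero])
    (fun f f' h h' => by
      simp only [Preadditive.add_comp, Preadditive.comp_add, map_add, h, h', P.map_add, Q.map_add,
        smul_add, smul_sub]
      abel)
    (fun c f h => by
      simp only [Linear.smul_comp, Linear.comp_smul, map_smul, h, P.map_smul, Q.map_smul, smul_add,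
        smul_sub]
      simp only [smul_comm c])
  subst hp
  clear hf f
  induction p with
  | nil =>
    change D.d _ _ (G.twist s (𝟙 X)) = _ • (_ ≫ Q.toFunctor.map (𝟙 X) -
      P.toFunctor.map (𝟙 X) ≫ _) + G.twist s (C.d X X (𝟙 X))
    rw [twist_id, C.d_id]
    simp
  | cons p e ih =>
    -- The derivation rule is also applied to `d` of the word, whose degree is one higher; this
    -- supplies the opposite sign.
    have hd : C.d _ _ (G.word p) ∈ C.deg _ _ (p.degree G.degree + 1) := C.d_mem (G.word_mem p)
    rw [word_cons, twist_comp G s (G.word_mem p), C.leibniz _ (G.val_mem e), map_add, map_add,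
      map_smul, map_smul, twist_val, D.leibniz _ (s_mem e),
      D.leibniz _ (Q.map_deg (G.val_mem e)), ih, ← P.map_d, ← Q.map_d,
      twist_comp G s (G.word_mem p), twist_comp G s hd, twist_val, Functor.map_comp,
      Functor.map_comp, d_s]
    simp only [sgn_sub_one, GenPath.degree, sgn_add, sgn_one, Preadditive.add_comp,
      Preadditive.comp_add, Preadditive.sub_comp, Preadditive.comp_sub, Linear.smul_comp,
      Linear.comp_smul, smul_add, smul_sub, smul_smul, Category.assoc, neg_smul, mul_neg, mul_one,
      smul_neg]
    rw [mul_comm (sgn k (G.degree _ _ e)) (sgn k (p.degree G.degree))]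
    abel

/-- The homotopy with given values on objects and on generating morphisms. -/
noncomputable def homotopy (app : ∀ X : C.Obj, P.toFunctor.obj X ⟶ Q.toFunctor.obj X)
    (app_mem : ∀ X : C.Obj, app X ∈ D.deg _ _ 0) (d_app : ∀ X : C.Obj, D.d _ _ (app X) = 0)
    (s : ∀ X Y : C.Obj, G.Gen X Y → (P.toFunctor.obj X ⟶ Q.toFunctor.obj Y))
    (s_mem : ∀ {X Y : C.Obj} (e : G.Gen X Y), s X Y e ∈ D.deg _ _ (G.degree X Y e - 1))
    (d_s : ∀ {X Y : C.Obj} (e : G.Gen X Y), D.d _ _ (s X Y e) = sgn k (G.degree X Y e) •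
        (app X ≫ Q.toFunctor.map (G.val X Y e) - P.toFunctor.map (G.val X Y e) ≫ app Y) +
      G.twist s (C.d X Y (G.val X Y e))) : Homotopy P Q where
  app := app
  app_mem := app_mem
  d_app := d_app
  map := G.twist s
  map_comp := G.twist_comp s
  map_mem := G.twist_mem s_mem
  d_map := G.d_twist app s_mem d_s

end twist

/-- A derivation is determined by its values on the generating morphisms. -/
theorem derivation_ext
    {S T : ∀ {X Y : C.Obj}, (X ⟶ Y) →ₗ[k] (P.toFunctor.obj X ⟶ Q.toFunctor.obj Y)}
    (hS : ∀ {X Y Z : C.Obj} {m : ℤ} {f : X ⟶ Y}, f ∈ C.deg X Y m → ∀ g : Y ⟶ Z,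
      S (f ≫ g) = sgn k m • (P.toFunctor.map f ≫ S g) + S f ≫ Q.toFunctor.map g)
    (hT : ∀ {X Y Z : C.Obj} {m : ℤ} {f : X ⟶ Y}, f ∈ C.deg X Y m → ∀ g : Y ⟶ Z,
      T (f ≫ g) = sgn k m • (P.toFunctor.map f ≫ T g) + T f ≫ Q.toFunctor.map g)
    (h : ∀ {X Y : C.Obj} (e : G.Gen X Y), S (G.val X Y e) = T (G.val X Y e))
    {X Y : C.Obj} (f : X ⟶ Y) : S f = T f := by
  induction f using G.hom_induction with
  | zero => simp
  | add f g hf hg => simp [hf, hg]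
  | smul c f hf => simp [hf]
  | word p =>
    induction p with
    | nil =>
      have h1 := hS (C.id_mem X) (𝟙 X)
      have h2 := hT (C.id_mem X) (𝟙 X)
      change S (𝟙 X) = T (𝟙 X)
      simp only [Category.comp_id, sgn_zero, one_smul, CategoryTheory.Functor.map_id,
        Category.id_comp, left_eq_add] at h1 h2
      rw [h1, h2]
    | cons p e ih => rw [word_cons, hS (G.word_mem p), hT (G.word_mem p), ih, h]

end GeneratingMorphisms

/-- A coherent homotopy equivalence between dg functors `P` and `Q`: a homotopy whose components
have homotopy inverses, with the coherence datum `bar`. -/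
structure CohEquiv {C D : DGCat k} (P Q : DGFunctor C D) : Type u extends Homotopy P Q where
  inv : ∀ X : C.Obj, Q.toFunctor.obj X ⟶ P.toFunctor.obj X
  hat : ∀ X : C.Obj, P.toFunctor.obj X ⟶ P.toFunctor.obj X
  check : ∀ X : C.Obj, Q.toFunctor.obj X ⟶ Q.toFunctor.obj X
  bar : ∀ X : C.Obj, P.toFunctor.obj X ⟶ Q.toFunctor.obj X
  inv_mem : ∀ X : C.Obj, inv X ∈ D.deg _ _ 0
  hat_mem : ∀ X : C.Obj, hat X ∈ D.deg _ _ (-1)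
  check_mem : ∀ X : C.Obj, check X ∈ D.deg _ _ (-1)
  bar_mem : ∀ X : C.Obj, bar X ∈ D.deg _ _ (-2)
  d_inv : ∀ X : C.Obj, D.d _ _ (inv X) = 0
  d_hat : ∀ X : C.Obj, D.d _ _ (hat X) = 𝟙 _ - app X ≫ inv X
  d_check : ∀ X : C.Obj, D.d _ _ (check X) = 𝟙 _ - inv X ≫ app X
  d_bar : ∀ X : C.Obj, D.d _ _ (bar X) = hat X ≫ app X - app X ≫ check X

/-! ### Identity, images and restrictions of coherent homotopy equivalences -/

namespace CohEquiv

variable {C D : DGCat k}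

/-- The identity of a dg functor. -/
def refl (P : DGFunctor C D) : CohEquiv P P where
  app _ := 𝟙 _
  app_mem _ := D.id_mem _
  d_app _ := D.d_id _
  map := 0
  map_comp _ _ := by simp
  map_mem _ := zero_mem _
  d_map _ := by simp
  inv _ := 𝟙 _
  hat _ := 0
  check _ := 0
  bar _ := 0
  inv_mem _ := D.id_mem _
  hat_mem _ := zero_mem _
  check_mem _ := zero_mem _
  bar_mem _ := zero_mem _
  d_inv _ := D.d_id _
  d_hat _ := by simp
  d_check _ := by simp
  d_bar _ := by simp

/-- The image of a coherent homotopy equivalence under a dg functor. -/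
def mapTarget {P Q : C ⟶ D} (E : CohEquiv P Q) {D' : DGCat k} (u : D ⟶ D') :
    CohEquiv (P ≫ u) (Q ≫ u) where
  app X := u.toFunctor.map (E.app X)
  app_mem X := u.map_deg (E.app_mem X)
  d_app X := by
    have := u.map_d (E.app X)
    rw [E.d_app, DGFunctor.map_zero] at this
    exact this.symm
  map {X Y} := (u.mapL _ _).comp (E.map (X := X) (Y := Y))
  map_comp {X Y Z m f} hf g := by
    refine (congrArg u.toFunctor.map (E.map_comp hf g)).trans ?_
    rw [u.map_add, u.map_smul, Functor.map_comp, Functor.map_comp]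
    rfl
  map_mem hf := u.map_deg (E.map_mem hf)
  d_map {X Y n f} hf := by
    refine (u.map_d (E.map f)).symm.trans ((congrArg u.toFunctor.map (E.d_map hf)).trans ?_)
    rw [u.map_add, u.map_smul, u.map_sub, Functor.map_comp, Functor.map_comp]
    rfl
  inv X := u.toFunctor.map (E.inv X)
  hat X := u.toFunctor.map (E.hat X)
  check X := u.toFunctor.map (E.check X)
  bar X := u.toFunctor.map (E.bar X)
  inv_mem X := u.map_deg (E.inv_mem X)
  hat_mem X := u.map_deg (E.hat_mem X)
  check_mem X := u.map_deg (E.check_mem X)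
  bar_mem X := u.map_deg (E.bar_mem X)
  d_inv X := by
    have := u.map_d (E.inv X)
    rw [E.d_inv, DGFunctor.map_zero] at this
    exact this.symm
  d_hat X := by
    have := u.map_d (E.hat X)
    rw [E.d_hat, DGFunctor.map_sub, Functor.map_comp, u.toFunctor.map_id] at this
    exact this.symm
  d_check X := by
    have := u.map_d (E.check X)
    rw [E.d_check, DGFunctor.map_sub, Functor.map_comp, u.toFunctor.map_id] at this
    exact this.symm
  d_bar X := by
    have := u.map_d (E.bar X)
    rw [E.d_bar, DGFunctor.map_sub, Functor.map_comp, Functor.map_comp] at this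
    exact this.symm

/-- The restriction of a coherent homotopy equivalence along a dg functor. -/
def comap {P Q : C ⟶ D} (E : CohEquiv P Q) {C' : DGCat k} (u : C' ⟶ C) :
    CohEquiv (u ≫ P) (u ≫ Q) where
  app X := E.app (u.toFunctor.obj X)
  app_mem X := E.app_mem _
  d_app X := E.d_app _
  map {X Y} := E.map.comp (u.mapL X Y)
  map_comp {X Y Z m f} hf g := by
    change E.map (u.toFunctor.map (f ≫ g)) = _
    rw [Functor.map_comp, E.map_comp (u.map_deg hf)]
    rfl
  map_mem hf := E.map_mem (u.map_deg hf)
  d_map {X Y n f} hf := by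
    refine (E.d_map (u.map_deg hf)).trans ?_
    rw [← u.map_d]
    rfl
  inv X := E.inv _
  hat X := E.hat _
  check X := E.check _
  bar X := E.bar _
  inv_mem X := E.inv_mem _
  hat_mem X := E.hat_mem _
  check_mem X := E.check_mem _
  bar_mem X := E.bar_mem _
  d_inv X := E.d_inv _
  d_hat X := E.d_hat _
  d_check X := E.d_check _
  d_bar X := E.d_bar _

end CohEquiv

/-! ### Generating morphisms of the mapping cylinder -/

/-- The composite of a dg functor and a linear functor. -/
def LinearFunctorOn.precomp {C D : DGCat k} {E : Type u} [Category.{u} E] [Preadditive E]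
    [Linear k E] {o : D.Obj → E} (H : LinearFunctorOn k o) (F : DGFunctor C D) :
    LinearFunctorOn k (fun X : C.Obj => o (F.toFunctor.obj X)) where
  map X Y := (H.map _ _).comp (F.mapL X Y)
  map_id X := (congrArg (H.map _ _) (F.toFunctor.map_id X)).trans (H.map_id _)
  map_comp f g := (congrArg (H.map _ _) (F.toFunctor.map_comp f g)).trans (H.map_comp _ _)

/-! ### Words form a basis of the free linear category -/

namespace FreeLin

variable {O : Type u} {V : O → O → Type u}

/-- A word in a graph as a word in the graph re-indexed by the objects of the free category. -/
def wrap {X : FreeLin k V} : {Y : O} → GenPath V X.obj Y →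
    GenPath (fun X Y : FreeLin k V => V X.obj Y.obj) X ⟨Y⟩
  | _, .nil => .nil
  | _, .cons p e => .cons (wrap p) e

/-- The inverse of `wrap`. -/
def unwrap {X : FreeLin k V} : {Y : FreeLin k V} →
    GenPath (fun X Y : FreeLin k V => V X.obj Y.obj) X Y → GenPath V X.obj Y.obj
  | _, .nil => .nil
  | _, .cons p e => .cons (unwrap p) e

theorem unwrap_wrap {k : Type u} {X : FreeLin k V} {Y : O} (p : GenPath V X.obj Y) :
    unwrap (wrap p) = p := by
  induction p with
  | nil => rfl
  | cons p e ih => exact congrArg (fun q => GenPath.cons q e) ih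

theorem wrap_unwrap {k : Type u} {X Y : FreeLin k V}
    (p : GenPath (fun X Y : FreeLin k V => V X.obj Y.obj) X Y) : wrap (unwrap p) = p := by
  induction p with
  | nil => rfl
  | cons p e ih =>
    change (wrap (unwrap p)).cons e = p.cons e
    rw [ih]

/-- The words in the two graphs agree. -/
def wordEquiv (X Y : FreeLin k V) :
    GenPath (fun X Y : FreeLin k V => V X.obj Y.obj) X Y ≃ GenPath V X.obj Y.obj where
  toFun := unwrap
  invFun := wrap
  left_inv := wrap_unwrap
  right_inv := unwrap_wrap

theorem eval_edge {X Y : FreeLin k V}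
    (p : GenPath (fun X Y : FreeLin k V => V X.obj Y.obj) X Y) :
    p.eval (fun X => X) (fun _ _ e => edge k e) = path k (unwrap p) := by
  induction p with
  | nil => rfl
  | cons p e ih =>
    rw [GenPath.eval, ih]
    exact (path_cons (unwrap p) e).symm

/-- The morphisms of `FreeLin` are by construction finitely supported functions on words, so this
evaluation is just reindexing along `wordEquiv`. -/
theorem bijective_eval (X Y : FreeLin k V) : Function.Bijective (Finsupp.linearCombination k
    (fun p : GenPath (fun X Y : FreeLin k V => V X.obj Y.obj) X Y =>
      p.eval (fun X => X) (fun _ _ e => edge k e))) := by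
  refine (congrArg Function.Bijective (funext fun x => ?_)).mpr
    (Finsupp.domLCongr (R := k) (M := k) (wordEquiv X Y)).bijective
  induction x using Finsupp.induction_linear with
  | zero => exact (map_zero _).trans (map_zero _).symm
  | add x y hx hy =>
    exact (map_add _ _ _).trans ((congrArg₂ (· + ·) hx hy).trans (map_add _ _ _).symm)
  | single p a =>
    rw [Finsupp.linearCombination_single, eval_edge, Finsupp.domLCongr_single]
    refine (Finsupp.smul_single a (unwrap p) (1 : k)).trans ?_
    rw [smul_eq_mul, mul_one]
    rfl

end FreeLin

namespace MapCyl

variable {A B : DGCat k} (GA : GeneratingMorphisms A) (GB : GeneratingMorphisms B)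
  (F : DGFunctor A B)

/-- The rank of a generating morphism of the mapping cylinder, in a well-ordered set. -/
def rank : ∀ {X Y : B.Obj ⊕ A.Obj}, Gen GA GB F X Y →
    ℕ × ((Σ X Y : B.Obj, GB.Gen X Y) ⊕ (Σ X Y : A.Obj, GA.Gen X Y) ⊕ A.Obj)
  | _, _, .ofB b => (0, .inl ⟨_, _, b⟩)
  | _, _, .ofA a => (1, .inr (.inl ⟨_, _, a⟩))
  | _, _, .t X => (2, .inr (.inr X))
  | _, _, .t' X => (3, .inr (.inr X))
  | _, _, .tHat X => (4, .inr (.inr X))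
  | _, _, .tCheck X => (5, .inr (.inr X))
  | _, _, .tBar X => (6, .inr (.inr X))
  | _, _, .tGen a => (7, .inr (.inl ⟨_, _, a⟩))

/-- A left inverse of `rank`. -/
def unrank : ℕ × ((Σ X Y : B.Obj, GB.Gen X Y) ⊕ (Σ X Y : A.Obj, GA.Gen X Y) ⊕ A.Obj) →
    Option (Σ X Y : Cat GA GB F, Gen GA GB F X.obj Y.obj)
  | (_, .inl ⟨_, _, b⟩) => some ⟨⟨_⟩, ⟨_⟩, .ofB b⟩
  | (1, .inr (.inl ⟨_, _, a⟩)) => some ⟨⟨_⟩, ⟨_⟩, .ofA a⟩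
  | (_, .inr (.inl ⟨_, _, a⟩)) => some ⟨⟨_⟩, ⟨_⟩, .tGen a⟩
  | (2, .inr (.inr X)) => some ⟨⟨_⟩, ⟨_⟩, .t X⟩
  | (3, .inr (.inr X)) => some ⟨⟨_⟩, ⟨_⟩, .t' X⟩
  | (4, .inr (.inr X)) => some ⟨⟨_⟩, ⟨_⟩, .tHat X⟩
  | (5, .inr (.inr X)) => some ⟨⟨_⟩, ⟨_⟩, .tCheck X⟩
  | (_, .inr (.inr X)) => some ⟨⟨_⟩, ⟨_⟩, .tBar X⟩

theorem unrank_rank : ∀ g : Σ X Y : Cat GA GB F, Gen GA GB F X.obj Y.obj,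
    unrank GA GB F (rank GA GB F g.2.2) = some g := by
  rintro ⟨⟨X⟩, ⟨Y⟩, e⟩
  cases e <;> rfl

/-- The well-ordering on the ranks. -/
def rankLT : ℕ × ((Σ X Y : B.Obj, GB.Gen X Y) ⊕ (Σ X Y : A.Obj, GA.Gen X Y) ⊕ A.Obj) →
    ℕ × ((Σ X Y : B.Obj, GB.Gen X Y) ⊕ (Σ X Y : A.Obj, GA.Gen X Y) ⊕ A.Obj) → Prop :=
  Prod.Lex (· < ·) (Sum.Lex GB.lt (Sum.Lex GA.lt WellOrderingRel))

instance : IsWellOrder _ (rankLT GA GB) := by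
  have := GA.isWellOrder
  have := GB.isWellOrder
  unfold rankLT
  infer_instance

/-- The order is pulled back along `rank`, which is injective because `unrank` recovers the letter.
-/
theorem isWellOrder_rank : IsWellOrder (Σ X Y : Cat GA GB F, Gen GA GB F X.obj Y.obj)
    (fun g h => rankLT GA GB (rank GA GB F g.2.2) (rank GA GB F h.2.2)) := by
  have hinj : Function.Injective
      (fun g : Σ X Y : Cat GA GB F, Gen GA GB F X.obj Y.obj => rank GA GB F g.2.2) := by
    intro g h hgh
    have := congrArg (unrank GA GB F) hgh
    simpa [unrank_rank] using this
  exact (RelEmbedding.preimage ⟨_, hinj⟩ (rankLT GA GB)).isWellOrder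

/-- The morphism `g` is a generating morphism of rank lower than `r`. -/
def IsBelow (r : ℕ × ((Σ X Y : B.Obj, GB.Gen X Y) ⊕ (Σ X Y : A.Obj, GA.Gen X Y) ⊕ A.Obj))
    ⦃X Y : Cat GA GB F⦄ (g : X ⟶ Y) : Prop :=
  ∃ e : Gen GA GB F X.obj Y.obj, FreeLin.edge k e = g ∧ rankLT GA GB (rank GA GB F e) r

variable {GA GB F}

theorem generated_mapB {S : ∀ ⦃X Y : Cat GA GB F⦄, (X ⟶ Y) → Prop}
    {T : ∀ ⦃X Y : B.Obj⦄, (X ⟶ Y) → Prop}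
    (h : ∀ ⦃X Y : B.Obj⦄ (f : X ⟶ Y), T f → Generated k S (mapB GA GB F f))
    {X Y : B.Obj} {f : X ⟶ Y} (hf : Generated k T f) : Generated k S (mapB GA GB F f) := by
  induction hf with
  | of hf => exact h _ hf
  | id X => rw [mapB_id]; exact .id _
  | comp _ _ hf hg => rw [mapB_comp]; exact .comp hf hg
  | zero => rw [map_zero]; exact .zero
  | add _ _ hf hg => rw [map_add]; exact .add hf hg
  | smul c _ hf => rw [map_smul]; exact .smul c hf

theorem generated_mapA {S : ∀ ⦃X Y : Cat GA GB F⦄, (X ⟶ Y) → Prop}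
    {T : ∀ ⦃X Y : A.Obj⦄, (X ⟶ Y) → Prop}
    (h : ∀ ⦃X Y : A.Obj⦄ (f : X ⟶ Y), T f → Generated k S (mapA GA GB F f))
    {X Y : A.Obj} {f : X ⟶ Y} (hf : Generated k T f) : Generated k S (mapA GA GB F f) := by
  induction hf with
  | of hf => exact h _ hf
  | id X => rw [mapA_id]; exact .id _
  | comp _ _ hf hg => rw [mapA_comp]; exact .comp hf hg
  | zero => rw [map_zero]; exact .zero
  | add _ _ hf hg => rw [map_add]; exact .add hf hg
  | smul c _ hf => rw [map_smul]; exact .smul c hf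

variable (GA) in
/-- The linear map multiplying every word by the sign of its degree. -/
noncomputable def signed {X Y : A.Obj} : (X ⟶ Y) →ₗ[k] (X ⟶ Y) :=
  GA.extend (fun p => sgn k (p.degree GA.degree) • GA.word p)

/-- Absorbing the sign into the linear map `signed` makes the derivation rule valid for
inhomogeneous morphisms. The factors met in an induction on `Generated` are not known to be
homogeneous. -/
theorem tMap_comp_signed {X Y Z : A.Obj} (f : X ⟶ Y) (g : Y ⟶ Z) :
    tMap GA GB F (f ≫ g) = mapB GA GB F (F.toFunctor.map (signed GA f)) ≫ tMap GA GB F g +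
      tMap GA GB F f ≫ mapA GA GB F g := by
  induction f using GA.hom_induction with
  | zero => simp [map_zero']
  | add f f' h h' => simp only [Preadditive.add_comp, map_add, h, h', F.map_add]; abel
  | smul c f h => simp only [Linear.smul_comp, map_smul, h, F.map_smul, smul_add]
  | word p =>
    rw [tMap_comp GA GB F (GA.word_mem p), signed, GA.extend_word, F.map_smul, map_smul,
      Linear.smul_comp]

theorem mapB_val {X Y : B.Obj} (b : GB.Gen X Y) :
    mapB GA GB F (GB.val X Y b) = FreeLin.edge k (Gen.ofB b) := GB.lift_val _ _ b

theorem mapA_val {X Y : A.Obj} (a : GA.Gen X Y) :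
    mapA GA GB F (GA.val X Y a) = FreeLin.edge k (Gen.ofA a) := GA.lift_val _ _ a

/-- By the derivation rule, `t` of a composite needs only `t` of the factors together with arbitrary
morphisms of `A` and `B`. -/
theorem generated_tMap {S : ∀ ⦃X Y : Cat GA GB F⦄, (X ⟶ Y) → Prop}
    {T : ∀ ⦃X Y : A.Obj⦄, (X ⟶ Y) → Prop}
    (hB : ∀ ⦃X Y : B.Obj⦄ (f : X ⟶ Y), Generated k S (mapB GA GB F f))
    (hA : ∀ ⦃X Y : A.Obj⦄ (f : X ⟶ Y), Generated k S (mapA GA GB F f))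
    (h : ∀ ⦃X Y : A.Obj⦄ (f : X ⟶ Y), T f → Generated k S (tMap GA GB F f))
    {X Y : A.Obj} {f : X ⟶ Y} (hf : Generated k T f) : Generated k S (tMap GA GB F f) := by
  induction hf with
  | of hf => exact h _ hf
  | id X => rw [tMap_id]; exact .zero
  | comp _ _ hf hg => rw [tMap_comp_signed]; exact .add (.comp (hB _) hg) (.comp hf (hA _))
  | zero => rw [map_zero]; exact .zero
  | add _ _ hf hg => rw [map_add]; exact .add hf hg
  | smul c _ hf => rw [map_smul]; exact .smul c hf

/-- The first coordinate of `rank` is a level, chosen so that most letters have differentials made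
of lower levels. Only the letters of `B`, the letters of `A` and the `t_a` meet their own level, and
there the given orders on the generators of `B` and `A` decide: `t_{da}` involves only `t_{a'}` with
`a'` preceding `a`. -/
theorem generated_diff {X Y : B.Obj ⊕ A.Obj} (e : Gen GA GB F X Y) :
    Generated k (IsBelow GA GB F (rank GA GB F e)) (diff GA GB F X Y e) := by
  have edge_lt {X' Y' : B.Obj ⊕ A.Obj} (e' : Gen GA GB F X' Y')
      (h : (rank GA GB F e').1 < (rank GA GB F e).1) :
      Generated k (IsBelow GA GB F (rank GA GB F e))
        (FreeLin.edge k e' : (⟨X'⟩ : Cat GA GB F) ⟶ ⟨Y'⟩) :=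
    .of ⟨e', rfl, Prod.Lex.left _ _ h⟩
  have hB (h : 0 < (rank GA GB F e).1) ⦃X' Y' : B.Obj⦄ (f : X' ⟶ Y') :
      Generated k (IsBelow GA GB F (rank GA GB F e)) (mapB GA GB F f) := by
    refine generated_mapB (fun X Y g hg => ?_) (GB.generated f)
    obtain ⟨b, rfl⟩ := hg
    rw [mapB_val]
    exact edge_lt _ h
  have hA (h : 1 < (rank GA GB F e).1) ⦃X' Y' : A.Obj⦄ (f : X' ⟶ Y') :
      Generated k (IsBelow GA GB F (rank GA GB F e)) (mapA GA GB F f) := by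
    refine generated_mapA (fun X Y g hg => ?_) (GA.generated f)
    obtain ⟨a, rfl⟩ := hg
    rw [mapA_val]
    exact edge_lt _ h
  cases e with
  | ofB b =>
    refine generated_mapB (fun X Y g hg => ?_) (GB.d_val b)
    obtain ⟨b', rfl, hb'⟩ := hg
    rw [mapB_val]
    exact .of ⟨_, rfl, Prod.Lex.right _ (Sum.Lex.inl hb')⟩
  | ofA a =>
    refine generated_mapA (fun X Y g hg => ?_) (GA.d_val a)
    obtain ⟨a', rfl, ha'⟩ := hg
    rw [mapA_val]
    exact .of ⟨_, rfl, Prod.Lex.right _ (Sum.Lex.inr (Sum.Lex.inl ha'))⟩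
  | t X => exact .zero
  | t' X => exact .zero
  | tHat X =>
    exact (Generated.id _).sub
      (.comp (edge_lt (.t X) (by simp [rank])) (edge_lt (.t' X) (by simp [rank])))
  | tCheck X =>
    exact (Generated.id _).sub
      (.comp (edge_lt (.t' X) (by simp [rank])) (edge_lt (.t X) (by simp [rank])))
  | tBar X =>
    exact .sub (.comp (edge_lt (.tHat X) (by simp [rank])) (edge_lt (.t X) (by simp [rank])))
      (.comp (edge_lt (.t X) (by simp [rank])) (edge_lt (.tCheck X) (by simp [rank])))
  | tGen a =>
    refine .add (.smul _ (.sub (.comp (edge_lt (.t _) (by simp [rank])) (hA (by simp [rank]) _))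
      (.comp (hB (by simp [rank]) _) (edge_lt (.t _) (by simp [rank])))))
      (generated_tMap (hB (by simp [rank])) (hA (by simp [rank])) (fun X Y g hg => ?_) (GA.d_val a))
    obtain ⟨a', rfl, ha'⟩ := hg
    rw [tMap_val]
    exact .of ⟨_, rfl, Prod.Lex.right _ (Sum.Lex.inr (Sum.Lex.inl ha'))⟩

end MapCyl

/-! ### Semifreeness of `M_F` and of the inclusion of `A` -/

namespace mapCyl

variable {A B : DGCatS k}

/-- The generating morphisms of the mapping cylinder. -/
noncomputable def gens (F : A ⟶ B) : GeneratingMorphisms (mapCyl F) where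
  Gen X Y := MapCyl.Gen A.gens B.gens F.hom X.obj Y.obj
  val _ _ e := FreeLin.edge k e
  degree _ _ e := MapCyl.degree A.gens B.gens F.hom _ _ e
  val_mem e := FreeLin.edge_mem _ e
  lt g h := MapCyl.rankLT A.gens B.gens (MapCyl.rank A.gens B.gens F.hom g.2.2)
    (MapCyl.rank A.gens B.gens F.hom h.2.2)
  isWellOrder := MapCyl.isWellOrder_rank A.gens B.gens F.hom
  bijective := FreeLin.bijective_eval
  d_val {X Y} e := by
    have h := FreeLin.d_edge (MapCyl.degree A.gens B.gens F.hom)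
      (MapCyl.diff A.gens B.gens F.hom) e
    exact h.symm ▸ MapCyl.generated_diff e

section generators

variable (F : A ⟶ B)

/-- The generating morphism of `M_F` given by a generating morphism of `B`. -/
def genB {X Y : B.dg.Obj} (b : B.gens.Gen X Y) :
    (gens F).Gen ((inclB F).toFunctor.obj X) ((inclB F).toFunctor.obj Y) := MapCyl.Gen.ofB b

/-- The generating morphism of `M_F` given by a generating morphism of `A`. -/
def genA {X Y : A.dg.Obj} (a : A.gens.Gen X Y) :
    (gens F).Gen ((inclA F).toFunctor.obj X) ((inclA F).toFunctor.obj Y) := MapCyl.Gen.ofA a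

theorem inclA_val {X Y : A.dg.Obj} (a : A.gens.Gen X Y) :
    (inclA F).toFunctor.map (A.gens.val X Y a) = (gens F).val _ _ (genA F a) :=
  MapCyl.mapA_val a

theorem inclB_val {X Y : B.dg.Obj} (b : B.gens.Gen X Y) :
    (inclB F).toFunctor.map (B.gens.val X Y b) = (gens F).val _ _ (genB F b) :=
  MapCyl.mapB_val b

end generators

theorem isSemifree (F : A ⟶ B) : (mapCyl F).IsSemifree := ⟨gens F⟩

/-- The generating morphisms of the mapping cylinder that are not in `A`. -/
noncomputable def extensionFamily (F : A ⟶ B) : MorphismFamily (mapCyl F) where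
  Gen X Y := {e : (gens F).Gen X Y // (MapCyl.rank A.gens B.gens F.hom e).1 ≠ 1}
  val X Y e := (gens F).val X Y e.1
  degree X Y e := (gens F).degree X Y e.1
  val_mem e := (gens F).val_mem e.1
  lt g h := (gens F).lt ⟨g.1, g.2.1, g.2.2.1⟩ ⟨h.1, h.2.1, h.2.2.1⟩
  isWellOrder := by
    have := (gens F).isWellOrder
    have hinj : Function.Injective (fun g : Σ X Y : (mapCyl F).Obj,
        {e : (gens F).Gen X Y // (MapCyl.rank A.gens B.gens F.hom e).1 ≠ 1} =>
        (⟨g.1, g.2.1, g.2.2.1⟩ : Σ X Y : (mapCyl F).Obj, (gens F).Gen X Y)) := by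
      rintro ⟨X, Y, e, he⟩ ⟨X', Y', e', he'⟩ h
      cases h
      rfl
    exact (RelEmbedding.preimage ⟨_, hinj⟩ (gens F).lt).isWellOrder

/-- A family of values on the generating morphisms, from values on those of `A` and on the
others. -/
theorem exists_glue (F : A ⟶ B) {E : Type u} [Category.{u} E] (o : (mapCyl F).Obj → E)
    (vA : ∀ X Y : A.dg.Obj, A.gens.Gen X Y →
      (o ((inclA F).toFunctor.obj X) ⟶ o ((inclA F).toFunctor.obj Y)))
    (v : ∀ X Y : (mapCyl F).Obj, (extensionFamily F).Gen X Y → (o X ⟶ o Y)) :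
    ∃ w : ∀ X Y : (mapCyl F).Obj, (gens F).Gen X Y → (o X ⟶ o Y),
      (∀ (X Y : A.dg.Obj) (a : A.gens.Gen X Y), w ((inclA F).toFunctor.obj X)
        ((inclA F).toFunctor.obj Y) (genA F a) = vA X Y a) ∧
      ∀ (X Y : (mapCyl F).Obj) (g : (extensionFamily F).Gen X Y), w X Y g.1 = v X Y g := by
  -- The endpoints of a general letter are not visibly objects of `A`, so the condition on letters
  -- of `A` is phrased through equalities of objects and heterogeneous equality. Level `1` singles
  -- out exactly the letters of `A`.
  have key : ∀ (X Y : (mapCyl F).Obj) (e : (gens F).Gen X Y), ∃ x : o X ⟶ o Y,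
      (∀ (X' Y' : A.dg.Obj) (a : A.gens.Gen X' Y') (hX : (inclA F).toFunctor.obj X' = X)
        (hY : (inclA F).toFunctor.obj Y' = Y), genA F a ≍ e → vA X' Y' a ≍ x) ∧
      ∀ he, x = v X Y ⟨e, he⟩ := by
    rintro ⟨X⟩ ⟨Y⟩ e
    by_cases he : (MapCyl.rank A.gens B.gens F.hom e).1 = 1
    · cases e with
      | ofA a =>
        refine ⟨vA _ _ a, fun X' Y' a' hX hY h => ?_, fun he' => absurd he he'⟩
        cases hX
        cases hY
        cases h
        rfl
      | _ => simp [MapCyl.rank] at he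
    · refine ⟨v _ _ ⟨e, he⟩, fun X' Y' a' hX hY h => ?_, fun _ => rfl⟩
      cases hX
      cases hY
      cases h
      exact absurd rfl he
  choose w hwA hwS using key
  exact ⟨w, fun X Y a => (eq_of_heq (hwA _ _ _ X Y a rfl rfl HEq.rfl)).symm,
    fun X Y g => hwS X Y g.1 g.2⟩

/-- The inclusion has a `k`-linear retraction: it fixes the letters of `A`, kills all others and
sends every object of `B` to the given object `X`, an arbitrary choice. Compatibility with `d` is
not needed. -/
theorem injective_mapL_inclA (F : A ⟶ B) (X Y : A.dg.Obj) :
    Function.Injective ((inclA F).mapL X Y) := by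
  let o : (mapCyl F).Obj → A.dg.Obj := fun Z => Sum.elim (fun _ => X) id Z.obj
  obtain ⟨w, hw, -⟩ := exists_glue F o (fun X Y a => A.gens.val X Y a) (fun _ _ _ => 0)
  have h : ((gens F).linearFunctor o w).precomp (inclA F) =
      (⟨fun _ _ => LinearMap.id, fun _ => rfl, fun _ _ => rfl⟩ :
        LinearFunctorOn k (fun X : A.dg.Obj => X)) := by
    refine A.gens.linearFunctor_ext fun {X Y} a => ?_
    change (gens F).lift o w ((inclA F).toFunctor.map (A.gens.val X Y a)) = A.gens.val X Y a
    rw [inclA_val, GeneratingMorphisms.lift_val, hw]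
  have key (f : X ⟶ Y) : (gens F).lift o w ((inclA F).mapL X Y f) = f :=
    congrArg (fun H : LinearFunctorOn k (fun X : A.dg.Obj => X) => H.map X Y f) h
  exact fun f g hfg =>
    (key f).symm.trans ((congrArg (fun z => (gens F).lift o w z) hfg).trans (key g))

/-- The new objects are those of `B` and the new letters are all letters outside `A`. Since `A` and
`M_F` are both free on their letters, a linear functor on `M_F` is the same as one on `A` with free
values on the rest. -/
theorem isSemifreeExtension_inclA (F : A ⟶ B) : IsSemifreeExtension (inclA F) := by
  refine ⟨Set.range (inclB F).toFunctor.obj, extensionFamily F, ?_, injective_mapL_inclA F, ?_,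
    ?_, ?_⟩
  · rintro X Y h
    cases h
    rfl
  · refine ⟨Set.disjoint_left.2 ?_, codisjoint_iff.2 (Set.eq_univ_of_forall ?_)⟩
    · rintro _ ⟨X, rfl⟩ ⟨Y, h⟩
      cases h
    · rintro ⟨X | X⟩
      · exact Or.inr ⟨X, rfl⟩
      · exact Or.inl ⟨X, rfl⟩
  · intro E _ _ _ o K v
    obtain ⟨w, hwA, hwS⟩ := exists_glue F o (fun X Y a => K.map X Y (A.gens.val X Y a)) v
    refine ⟨(gens F).linearFunctor o w, ⟨fun {X Y} f => ?_, fun {X Y} g => ?_⟩, ?_⟩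
    · have h : ((gens F).linearFunctor o w).precomp (inclA F) = K := by
        refine A.gens.linearFunctor_ext fun {X Y} a => ?_
        change (gens F).lift o w ((inclA F).toFunctor.map (A.gens.val X Y a)) = _
        rw [inclA_val, GeneratingMorphisms.lift_val, hwA]
      rw [← h]
      rfl
    · exact ((gens F).lift_val o w g.1).trans (hwS X Y g)
    · rintro H ⟨hA, hS⟩
      refine (gens F).linearFunctor_ext fun {X Y} e => ?_
      change _ = (gens F).lift o w _
      rw [GeneratingMorphisms.lift_val]
      by_cases he : (MapCyl.rank A.gens B.gens F.hom e).1 = 1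
      · obtain ⟨X⟩ := X
        obtain ⟨Y⟩ := Y
        cases e with
        | ofA a => exact (congrArg _ (inclA_val F a).symm).trans ((hA _).trans (hwA _ _ a).symm)
        | _ => simp [MapCyl.rank] at he
      · exact (hS ⟨e, he⟩).trans (hwS X Y ⟨e, he⟩).symm
  · rintro U V ⟨f, hf⟩
    -- The family inherits its order from all the letters, so each letter preceding `f` either comes
    -- from `A` or is an earlier member of the family.
    refine ((gens F).d_val f).mono ?_
    rintro X Y _ ⟨e, rfl, hlt⟩
    by_cases he : (MapCyl.rank A.gens B.gens F.hom e).1 = 1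
    · left
      obtain ⟨X⟩ := X
      obtain ⟨Y⟩ := Y
      cases e with
      | ofA a => exact ⟨_, _, A.gens.val _ _ a, congrArg Arrow.mk (inclA_val F a)⟩
      | _ => simp [MapCyl.rank] at he
    · exact Or.inr ⟨⟨e, he⟩, rfl, hlt⟩

end mapCyl

namespace mapCyl

variable {A B : DGCatS k} (F : A ⟶ B)

/-! ### The universal property of the mapping cylinder -/

/-- The universal coherent homotopy equivalence on the mapping cylinder. -/
noncomputable def univ : CohEquiv (F.hom ≫ inclB F) (inclA F) where
  app := MapCyl.t A.gens B.gens F.hom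
  app_mem := MapCyl.t_mem A.gens B.gens F.hom
  d_app := MapCyl.d_t A.gens B.gens F.hom
  map := MapCyl.tMap A.gens B.gens F.hom
  map_comp := MapCyl.tMap_comp A.gens B.gens F.hom
  map_mem := MapCyl.tMap_mem A.gens B.gens F.hom
  d_map := MapCyl.tMap_d A.gens B.gens F.hom
  inv := MapCyl.t' A.gens B.gens F.hom
  hat := MapCyl.tHat A.gens B.gens F.hom
  check := MapCyl.tCheck A.gens B.gens F.hom
  bar := MapCyl.tBar A.gens B.gens F.hom
  inv_mem := MapCyl.t'_mem A.gens B.gens F.hom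
  hat_mem := MapCyl.tHat_mem A.gens B.gens F.hom
  check_mem := MapCyl.tCheck_mem A.gens B.gens F.hom
  bar_mem X := FreeLin.edge_mem (MapCyl.degree A.gens B.gens F.hom) (MapCyl.Gen.tBar X)
  d_inv := MapCyl.d_t' A.gens B.gens F.hom
  d_hat := MapCyl.d_tHat A.gens B.gens F.hom
  d_check := MapCyl.d_tCheck A.gens B.gens F.hom
  d_bar X := FreeLin.d_edge (MapCyl.degree A.gens B.gens F.hom) (MapCyl.diff A.gens B.gens F.hom)
    (MapCyl.Gen.tBar X)

variable {F}

/-- Agreement on the two inclusions already settles the objects and the letters of `A` and `B`; the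
other letters are compared as arrows. -/
theorem hom_ext {D : DGCat k} {Θ Θ' : mapCyl F ⟶ D} (hB : inclB F ≫ Θ = inclB F ≫ Θ')
    (hA : inclA F ≫ Θ = inclA F ≫ Θ')
    (ht : ∀ X, val Θ (MapCyl.t A.gens B.gens F.hom X) = val Θ' (MapCyl.t A.gens B.gens F.hom X))
    (ht' : ∀ X,
      val Θ (MapCyl.t' A.gens B.gens F.hom X) = val Θ' (MapCyl.t' A.gens B.gens F.hom X))
    (hHat : ∀ X,
      val Θ (MapCyl.tHat A.gens B.gens F.hom X) = val Θ' (MapCyl.tHat A.gens B.gens F.hom X))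
    (hCheck : ∀ X,
      val Θ (MapCyl.tCheck A.gens B.gens F.hom X) = val Θ' (MapCyl.tCheck A.gens B.gens F.hom X))
    (hBar : ∀ X,
      val Θ (MapCyl.tBar A.gens B.gens F.hom X) = val Θ' (MapCyl.tBar A.gens B.gens F.hom X))
    (hGen : ∀ {X Y : A.dg.Obj} (a : A.gens.Gen X Y),
      val Θ (MapCyl.tGen A.gens B.gens F.hom a) = val Θ' (MapCyl.tGen A.gens B.gens F.hom a)) :
    Θ = Θ' := by
  refine (gens F).dgFunctor_ext ?_ ?_
  · rintro ⟨X | X⟩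
    · exact congrArg (fun T : B.dg ⟶ D => T.toFunctor.obj X) hB
    · exact congrArg (fun T : A.dg ⟶ D => T.toFunctor.obj X) hA
  · rintro ⟨X⟩ ⟨Y⟩ e
    cases e with
    | ofB b =>
      have h := congrArg (fun T : B.dg ⟶ D => Arrow.mk (T.toFunctor.map (B.gens.val _ _ b))) hB
      change Arrow.mk (Θ.toFunctor.map ((inclB F).toFunctor.map _)) =
        Arrow.mk (Θ'.toFunctor.map ((inclB F).toFunctor.map _)) at h
      rwa [inclB_val] at h
    | ofA a =>
      have h := congrArg (fun T : A.dg ⟶ D => Arrow.mk (T.toFunctor.map (A.gens.val _ _ a))) hA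
      change Arrow.mk (Θ.toFunctor.map ((inclA F).toFunctor.map _)) =
        Arrow.mk (Θ'.toFunctor.map ((inclA F).toFunctor.map _)) at h
      rwa [inclA_val] at h
    | t X => exact ht X
    | t' X => exact ht' X
    | tHat X => exact hHat X
    | tCheck X => exact hCheck X
    | tBar X => exact hBar X
    | tGen a => exact hGen a

/-- The dg functor `Θ` out of the mapping cylinder is the one that corresponds to the dg functor
`Φ` on `B` and the coherent homotopy equivalence `E`. -/
structure IsDesc {D : DGCat k} (Φ : B.dg ⟶ D) {P Ψ : A.dg ⟶ D} (E : CohEquiv P Ψ)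
    (Θ : mapCyl F ⟶ D) : Prop where
  inclB_comp : inclB F ≫ Θ = Φ
  inclA_comp : inclA F ≫ Θ = Ψ
  map_t : ∀ X, val Θ (MapCyl.t A.gens B.gens F.hom X) = Arrow.mk (E.app X)
  map_t' : ∀ X, val Θ (MapCyl.t' A.gens B.gens F.hom X) = Arrow.mk (E.inv X)
  map_tHat : ∀ X, val Θ (MapCyl.tHat A.gens B.gens F.hom X) = Arrow.mk (E.hat X)
  map_tCheck : ∀ X, val Θ (MapCyl.tCheck A.gens B.gens F.hom X) = Arrow.mk (E.check X)
  map_tBar : ∀ X, val Θ (MapCyl.tBar A.gens B.gens F.hom X) = Arrow.mk (E.bar X)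
  map_tGen : ∀ {X Y : A.dg.Obj} (a : A.gens.Gen X Y),
    val Θ (MapCyl.tGen A.gens B.gens F.hom a) = Arrow.mk (E.map (A.gens.val X Y a))

namespace IsDesc

variable {D : DGCat k} {Φ : B.dg ⟶ D} {P Ψ : A.dg ⟶ D} {E : CohEquiv P Ψ} {Θ Θ' : mapCyl F ⟶ D}

theorem unique (h : IsDesc Φ E Θ) (h' : IsDesc Φ E Θ') : Θ = Θ' :=
  hom_ext (h.inclB_comp.trans h'.inclB_comp.symm) (h.inclA_comp.trans h'.inclA_comp.symm)
    (fun X => (h.map_t X).trans (h'.map_t X).symm)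
    (fun X => (h.map_t' X).trans (h'.map_t' X).symm)
    (fun X => (h.map_tHat X).trans (h'.map_tHat X).symm)
    (fun X => (h.map_tCheck X).trans (h'.map_tCheck X).symm)
    (fun X => (h.map_tBar X).trans (h'.map_tBar X).symm)
    (fun a => (h.map_tGen a).trans (h'.map_tGen a).symm)

/-- Both `Θ(t_f)` and `E.map f` are derivations in `f` relative to the same pair of dg functors, and
they agree on generators, so `derivation_ext` applies. -/
theorem map_tMap (h : IsDesc Φ E Θ) (hP : F.hom ≫ Φ = P) {X Y : A.dg.Obj} (f : X ⟶ Y) :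
    val Θ (MapCyl.tMap A.gens B.gens F.hom f) = Arrow.mk (E.map f) := by
  have hB := h.inclB_comp
  have hA := h.inclA_comp
  subst hB
  subst hA
  subst hP
  refine congrArg Arrow.mk ?_
  refine A.gens.derivation_ext (P := F.hom ≫ inclB F ≫ Θ) (Q := inclA F ≫ Θ)
    (S := ((univ F).mapTarget Θ).map) (T := E.map) ((univ F).mapTarget Θ).map_comp E.map_comp
    (fun {X Y} a => ?_) f
  have h1 := h.map_tGen a
  rw [← MapCyl.tMap_val] at h1
  exact (Arrow.mk_inj _ _).1 h1

end IsDesc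

/-! ### Construction of dg functors out of the mapping cylinder -/

section desc

variable {D : DGCat k} (Φ : B.dg ⟶ D) {Ψ : A.dg ⟶ D} (E : CohEquiv (F.hom ≫ Φ) Ψ)

/-- The values of `desc` on objects. -/
def descObj (Φ : B.dg ⟶ D) (Ψ : A.dg ⟶ D) (X : (mapCyl F).Obj) : D.Obj :=
  Sum.elim Φ.toFunctor.obj Ψ.toFunctor.obj X.obj

/-- The values of `desc` on generating morphisms. -/
def descGen : ∀ X Y : B.dg.Obj ⊕ A.dg.Obj, MapCyl.Gen A.gens B.gens F.hom X Y →
    (Sum.elim Φ.toFunctor.obj Ψ.toFunctor.obj X ⟶ Sum.elim Φ.toFunctor.obj Ψ.toFunctor.obj Y)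
  | _, _, .ofB b => Φ.toFunctor.map (B.gens.val _ _ b)
  | _, _, .ofA a => Ψ.toFunctor.map (A.gens.val _ _ a)
  | _, _, .t X => E.app X
  | _, _, .t' X => E.inv X
  | _, _, .tHat X => E.hat X
  | _, _, .tCheck X => E.check X
  | _, _, .tBar X => E.bar X
  | _, _, .tGen a => E.map (A.gens.val _ _ a)

/-- The linear functor underlying `desc`. -/
noncomputable def descLinear : LinearFunctorOn k (descObj (F := F) Φ Ψ) :=
  (gens F).linearFunctor (descObj Φ Ψ) (fun X Y e => descGen Φ E X.obj Y.obj e)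

theorem descLinear_edge {X Y : B.dg.Obj ⊕ A.dg.Obj} (e : MapCyl.Gen A.gens B.gens F.hom X Y) :
    (descLinear Φ E).map ⟨X⟩ ⟨Y⟩ (FreeLin.edge k e) = descGen Φ E X Y e :=
  (gens F).lift_val (descObj Φ Ψ) (fun X Y e => descGen Φ E X.obj Y.obj e)
    (X := ⟨X⟩) (Y := ⟨Y⟩) e

theorem descLinear_inclB {X Y : B.dg.Obj} (f : X ⟶ Y) :
    (descLinear Φ E).map _ _ ((inclB F).toFunctor.map f) = Φ.toFunctor.map f := by
  have h : (descLinear Φ E).precomp (inclB F) =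
      (⟨Φ.mapL, Φ.toFunctor.map_id, Φ.toFunctor.map_comp⟩ :
        LinearFunctorOn k Φ.toFunctor.obj) := by
    refine B.gens.linearFunctor_ext fun {X Y} b => ?_
    refine (congrArg ((descLinear Φ E).map _ _) (inclB_val F b)).trans ?_
    exact descLinear_edge Φ E (MapCyl.Gen.ofB b)
  exact congrArg (fun H : LinearFunctorOn k Φ.toFunctor.obj => H.map X Y f) h

theorem descLinear_inclA {X Y : A.dg.Obj} (f : X ⟶ Y) :
    (descLinear Φ E).map _ _ ((inclA F).toFunctor.map f) = Ψ.toFunctor.map f := by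
  have h : (descLinear Φ E).precomp (inclA F) =
      (⟨Ψ.mapL, Ψ.toFunctor.map_id, Ψ.toFunctor.map_comp⟩ :
        LinearFunctorOn k Ψ.toFunctor.obj) := by
    refine A.gens.linearFunctor_ext fun {X Y} b => ?_
    refine (congrArg ((descLinear Φ E).map _ _) (inclA_val F b)).trans ?_
    exact descLinear_edge Φ E (MapCyl.Gen.ofA b)
  exact congrArg (fun H : LinearFunctorOn k Ψ.toFunctor.obj => H.map X Y f) h

/-- This is needed to compute the image of `t_{da}` before compatibility with `d` is known. At that
stage there is only a linear functor, so the comparison of derivations is done directly on words. -/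
theorem descLinear_univ {X Y : A.dg.Obj} (f : X ⟶ Y) :
    (descLinear Φ E).map _ _ ((univ F).map f) = E.map f := by
  induction f using A.gens.hom_induction with
  | zero =>
    rw [_root_.map_zero, _root_.map_zero, _root_.map_zero]
    rfl
  | add f g hf hg =>
    rw [_root_.map_add, _root_.map_add, hf, hg, _root_.map_add]
    rfl
  | smul c f hf =>
    rw [_root_.map_smul, _root_.map_smul, hf, _root_.map_smul]
    rfl
  | word p =>
    induction p with
    | nil =>
      refine (congrArg _ ((univ F).map_id X)).trans ?_
      refine (_root_.map_zero _).trans (E.map_id X).symm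
    | cons p e ih =>
      rw [GeneratingMorphisms.word_cons, (univ F).map_comp (A.gens.word_mem p),
        E.map_comp (A.gens.word_mem p), _root_.map_add, _root_.map_smul]
      refine congrArg₂ (· + ·) (congrArg _ (((descLinear Φ E).map_comp _ _).trans
        (congrArg₂ _ (descLinear_inclB Φ E _) ?_))) (((descLinear Φ E).map_comp _ _).trans
        (congrArg₂ _ ih (descLinear_inclA Φ E _)))
      refine (congrArg _ (MapCyl.tMap_val A.gens B.gens F.hom e)).trans ?_
      exact descLinear_edge Φ E (MapCyl.Gen.tGen e)

theorem descGen_mem {X Y : B.dg.Obj ⊕ A.dg.Obj} (e : MapCyl.Gen A.gens B.gens F.hom X Y) :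
    descGen Φ E X Y e ∈ D.deg _ _ (MapCyl.degree A.gens B.gens F.hom X Y e) := by
  cases e with
  | ofB b => exact Φ.map_deg (B.gens.val_mem b)
  | ofA a => exact Ψ.map_deg (A.gens.val_mem a)
  | t X => exact E.app_mem X
  | t' X => exact E.inv_mem X
  | tHat X => exact E.hat_mem X
  | tCheck X => exact E.check_mem X
  | tBar X => exact E.bar_mem X
  | tGen a => exact E.map_mem (A.gens.val_mem a)

/-- Each letter of the cylinder has the differential prescribed for the corresponding datum in
`CohEquiv`. Hence the linear functor carries each equation of `univ F` to the equation of the same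
name for `E`. -/
theorem d_descGen {X Y : (mapCyl F).Obj} (e : (gens F).Gen X Y) :
    D.d _ _ (descGen Φ E X.obj Y.obj e) =
      (descLinear Φ E).map X Y ((mapCyl F).d X Y ((gens F).val X Y e)) := by
  let L := descLinear Φ E
  have ht (X) : L.map _ _ ((univ F).app X) = E.app X := descLinear_edge Φ E (MapCyl.Gen.t X)
  have ht' (X) : L.map _ _ ((univ F).inv X) = E.inv X := descLinear_edge Φ E (MapCyl.Gen.t' X)
  have hhat (X) : L.map _ _ ((univ F).hat X) = E.hat X := descLinear_edge Φ E (MapCyl.Gen.tHat X)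
  have hcheck (X) : L.map _ _ ((univ F).check X) = E.check X :=
    descLinear_edge Φ E (MapCyl.Gen.tCheck X)
  obtain ⟨X⟩ := X
  obtain ⟨Y⟩ := Y
  cases e with
  | ofB b =>
    change _ = L.map _ _ ((mapCyl F).d _ _ ((gens F).val _ _ (genB F b)))
    rw [← inclB_val, ← DGFunctor.map_d]
    exact (Φ.map_d _).symm.trans (descLinear_inclB Φ E _).symm
  | ofA a =>
    change _ = L.map _ _ ((mapCyl F).d _ _ ((gens F).val _ _ (genA F a)))
    rw [← inclA_val, ← DGFunctor.map_d]
    exact (Ψ.map_d _).symm.trans (descLinear_inclA Φ E _).symm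
  | t X =>
    change _ = L.map _ _ ((mapCyl F).d _ _ ((univ F).app X))
    rw [(univ F).d_app, _root_.map_zero]
    exact E.d_app X
  | t' X =>
    change _ = L.map _ _ ((mapCyl F).d _ _ ((univ F).inv X))
    rw [(univ F).d_inv, _root_.map_zero]
    exact E.d_inv X
  | tHat X =>
    change _ = L.map _ _ ((mapCyl F).d _ _ ((univ F).hat X))
    rw [(univ F).d_hat, _root_.map_sub, L.map_id, L.map_comp, ht, ht']
    exact E.d_hat X
  | tCheck X =>
    change _ = L.map _ _ ((mapCyl F).d _ _ ((univ F).check X))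
    rw [(univ F).d_check, _root_.map_sub, L.map_id, L.map_comp, ht, ht']
    exact E.d_check X
  | tBar X =>
    change _ = L.map _ _ ((mapCyl F).d _ _ ((univ F).bar X))
    rw [(univ F).d_bar, _root_.map_sub, L.map_comp, L.map_comp, ht, hhat, hcheck]
    exact E.d_bar X
  | tGen a =>
    refine (E.d_map (A.gens.val_mem a)).trans ?_
    have h : (gens F).val ⟨Sum.inl (F.hom.toFunctor.obj _)⟩ ⟨Sum.inr _⟩ (MapCyl.Gen.tGen a) =
        (univ F).map (A.gens.val _ _ a) := (MapCyl.tMap_val A.gens B.gens F.hom a).symm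
    refine Eq.trans ?_ (congrArg (fun z => L.map _ _ ((mapCyl F).d _ _ z)) h).symm
    change _ = L.map _ _ ((mapCyl F).d _ _ ((univ F).map (A.gens.val _ _ a)))
    rw [(univ F).d_map (A.gens.val_mem a), _root_.map_add, _root_.map_smul, _root_.map_sub,
      L.map_comp, L.map_comp, ht, ht, descLinear_inclA, descLinear_univ]
    have hB := descLinear_inclB Φ E (F.hom.toFunctor.map (A.gens.val _ _ a))
    exact congrArg (fun z => sgn k (A.gens.degree _ _ a) •
      (E.app _ ≫ Ψ.toFunctor.map (A.gens.val _ _ a) - z ≫ E.app _) +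
        E.map (A.dg.d _ _ (A.gens.val _ _ a))) hB.symm

/-- The dg functor out of the mapping cylinder that corresponds to a dg functor on `B` and a
coherent homotopy equivalence. -/
noncomputable def desc : mapCyl F ⟶ D :=
  (gens F).dgFunctor (descObj Φ Ψ) (fun X Y e => descGen Φ E X.obj Y.obj e)
    (fun e => descGen_mem Φ E e) (fun e => d_descGen Φ E e)

theorem isDesc_desc : IsDesc Φ E (desc Φ E) where
  inclB_comp := DGFunctor.ext_toFunctor (Functor.hext (fun _ => rfl)
    fun _ _ f => heq_of_eq (descLinear_inclB Φ E f))
  inclA_comp := DGFunctor.ext_toFunctor (Functor.hext (fun _ => rfl)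
    fun _ _ f => heq_of_eq (descLinear_inclA Φ E f))
  map_t X := congrArg Arrow.mk (descLinear_edge Φ E (MapCyl.Gen.t X))
  map_t' X := congrArg Arrow.mk (descLinear_edge Φ E (MapCyl.Gen.t' X))
  map_tHat X := congrArg Arrow.mk (descLinear_edge Φ E (MapCyl.Gen.tHat X))
  map_tCheck X := congrArg Arrow.mk (descLinear_edge Φ E (MapCyl.Gen.tCheck X))
  map_tBar X := congrArg Arrow.mk (descLinear_edge Φ E (MapCyl.Gen.tBar X))
  map_tGen a := congrArg Arrow.mk (descLinear_edge Φ E (MapCyl.Gen.tGen a))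

/-- The source of `E` is allowed to equal `F.hom ≫ Φ` only propositionally: in the applications this
equality is the commutativity of a square. -/
theorem exists_isDesc {P : A.dg ⟶ D} (hP : F.hom ≫ Φ = P) (E : CohEquiv P Ψ) :
    ∃ Θ : mapCyl F ⟶ D, IsDesc Φ E Θ := by
  subst hP
  exact ⟨desc Φ E, isDesc_desc Φ E⟩

end desc

end mapCyl

/-- A dg functor `q` with a homotopy from `q ≫ i` to the identity, whose components have one-sided
homotopy inverses, is bijective on cohomology if `q` maps the transport of a morphism along the
homotopy to the given morphism. -/
theorem Homotopy.bijective_mapCohomology {C D : DGCat k} {q : C ⟶ D} {i : D ⟶ C}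
    (H : Homotopy (q ≫ i) (𝟙 C)) (app : ∀ X : C.Obj, i.toFunctor.obj (q.toFunctor.obj X) ⟶ X)
    (happ : ∀ X, app X = H.app X) (inv : ∀ X : C.Obj, X ⟶ i.toFunctor.obj (q.toFunctor.obj X))
    (inv_mem : ∀ X, inv X ∈ C.deg _ _ 0) (d_inv : ∀ X, C.d _ _ (inv X) = 0)
    (hinv : ∀ X, ∃ c ∈ C.deg X X (-1), C.d X X c = 𝟙 X - inv X ≫ app X)
    (hsec : ∀ (X Y : C.Obj) (g : q.toFunctor.obj X ⟶ q.toFunctor.obj Y),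
      q.toFunctor.map (inv X ≫ i.toFunctor.map g ≫ app Y) = g) (X Y : C.Obj) (n : ℤ) :
    Function.Bijective (DGFunctor.mapCohomology q X Y n) := by
  have app_mem (X) : app X ∈ C.deg _ _ 0 := (happ X) ▸ H.app_mem X
  have d_app (X) : C.d _ _ (app X) = 0 := (happ X) ▸ H.d_app X
  constructor
  · refine (injective_iff_map_eq_zero _).2 fun x hx => ?_
    obtain ⟨⟨f, hf, hdf⟩, rfl⟩ := Submodule.Quotient.mk_surjective _ x
    obtain ⟨g, hg, hgf⟩ := (Submodule.Quotient.mk_eq_zero _).1 hx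
    change D.d _ _ g = q.toFunctor.map f at hgf
    replace hdf : C.d X Y f = 0 := hdf
    refine (Submodule.Quotient.mk_eq_zero _).2 ?_
    obtain ⟨c, hc, hdc⟩ := hinv X
    let s : i.toFunctor.obj (q.toFunctor.obj X) ⟶ Y := H.map f
    have hs : s ∈ C.deg _ _ (n - 1) := H.map_mem hf
    have hds : C.d _ _ s = sgn k n •
        (app X ≫ f - i.toFunctor.map (q.toFunctor.map f) ≫ app Y) := by
      refine (H.d_map hf).trans ?_
      rw [hdf, map_zero, add_zero, happ, happ]
      rfl
    -- This element is a primitive of `app X ≫ f`: the homotopy replaces that by `i(q f) ≫ app Y`,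
    -- which is exact because `q f = dg`.
    have hw : sgn k n • s + i.toFunctor.map g ≫ app Y ∈ C.deg _ _ (n - 1) := by
      refine add_mem (Submodule.smul_mem _ _ hs) ?_
      simpa using C.comp_mem (i.map_deg hg) (app_mem Y)
    -- Since `dc = 1 - inv X ≫ app X`, the first summand bounds `f - inv X ≫ app X ≫ f` and the
    -- second bounds the remainder.
    refine ⟨sgn k n • (c ≫ f) + inv X ≫ (sgn k n • s + i.toFunctor.map g ≫ app Y), ?_, ?_⟩
    · refine add_mem (Submodule.smul_mem _ _ ?_) ?_
      · have := C.comp_mem hc hf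
        rwa [neg_add_eq_sub] at this
      · simpa using C.comp_mem (inv_mem X) hw
    · change C.d _ _ _ = f
      rw [map_add, map_smul, C.leibniz _ hf, C.leibniz _ hw, hdf, hdc, d_inv, map_add, map_smul,
        hds, C.leibniz _ (app_mem Y), d_app, ← i.map_d, hgf, sgn_smul_sgn_smul]
      simp [sgn_zero, sgn_smul_sgn_smul]
  · intro x
    obtain ⟨⟨g, hg, hdg⟩, rfl⟩ := Submodule.Quotient.mk_surjective _ x
    replace hdg : D.d _ _ g = 0 := hdg
    have hmem : inv X ≫ i.toFunctor.map g ≫ app Y ∈ C.deg X Y n := by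
      simpa using C.comp_mem (inv_mem X) (C.comp_mem (i.map_deg hg) (app_mem Y))
    have hd : C.d X Y (inv X ≫ i.toFunctor.map g ≫ app Y) = 0 := by
      rw [C.leibniz _ (C.comp_mem (i.map_deg hg) (app_mem Y)), C.leibniz _ (app_mem Y), d_app,
        d_inv, ← i.map_d, hdg, i.map_zero]
      simp
    -- By `hsec` this cocycle is a strict preimage of `g`, so no coboundary correction is needed.
    refine ⟨Submodule.Quotient.mk ⟨inv X ≫ i.toFunctor.map g ≫ app Y, hmem, hd⟩, ?_⟩
    exact congrArg Submodule.Quotient.mk (Subtype.ext (hsec X Y g))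

namespace mapCyl

variable {A B : DGCatS k} (F : A ⟶ B)

/-! ### The projection is a quasi-equivalence -/

/-- The projection `q : M_F → B`. -/
noncomputable def proj : mapCyl F ⟶ B.dg := desc (𝟙 B.dg) (CohEquiv.refl F.hom)

theorem isProjection_proj : IsProjection F (proj F) where
  inclB_comp := (isDesc_desc (𝟙 B.dg) (CohEquiv.refl F.hom)).inclB_comp
  inclA_comp := (isDesc_desc (𝟙 B.dg) (CohEquiv.refl F.hom)).inclA_comp
  map_t := (isDesc_desc (𝟙 B.dg) (CohEquiv.refl F.hom)).map_t
  map_t' := (isDesc_desc (𝟙 B.dg) (CohEquiv.refl F.hom)).map_t'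
  map_tHat := (isDesc_desc (𝟙 B.dg) (CohEquiv.refl F.hom)).map_tHat
  map_tCheck := (isDesc_desc (𝟙 B.dg) (CohEquiv.refl F.hom)).map_tCheck
  map_tBar := (isDesc_desc (𝟙 B.dg) (CohEquiv.refl F.hom)).map_tBar
  map_tGen := (isDesc_desc (𝟙 B.dg) (CohEquiv.refl F.hom)).map_tGen

variable {F} in
theorem IsProjection.eq_proj {r : mapCyl F ⟶ B.dg} (h : IsProjection F r) : r = proj F :=
  IsDesc.unique (Φ := 𝟙 B.dg) (E := CohEquiv.refl F.hom)
    ⟨h.inclB_comp, h.inclA_comp, h.map_t, h.map_t', h.map_tHat, h.map_tCheck, h.map_tBar,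
      h.map_tGen⟩ (isDesc_desc _ _)

/-- The endofunctor of `M_F` given by the projection onto `B`. -/
noncomputable abbrev retr : mapCyl F ⟶ mapCyl F := proj F ≫ inclB F

theorem proj_inclB {X Y : B.dg.Obj} (f : X ⟶ Y) :
    (proj F).toFunctor.map ((inclB F).toFunctor.map f) = f :=
  descLinear_inclB (F := F) (𝟙 B.dg) (CohEquiv.refl F.hom) f

theorem retr_inclB {X Y : B.dg.Obj} (f : X ⟶ Y) :
    (retr F).toFunctor.map ((inclB F).toFunctor.map f) = (inclB F).toFunctor.map f :=
  congrArg (inclB F).toFunctor.map (proj_inclB F f)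

theorem retr_inclA {X Y : A.dg.Obj} (f : X ⟶ Y) :
    (retr F).toFunctor.map ((inclA F).toFunctor.map f) =
      (inclB F).toFunctor.map (F.hom.toFunctor.map f) :=
  congrArg (inclB F).toFunctor.map
    (descLinear_inclA (F := F) (𝟙 B.dg) (CohEquiv.refl F.hom) f)

theorem proj_app (X : A.dg.Obj) :
    (proj F).toFunctor.map ((univ F).app X) = 𝟙 (F.hom.toFunctor.obj X) :=
  descLinear_edge (F := F) (𝟙 B.dg) (CohEquiv.refl F.hom) (MapCyl.Gen.t X)

theorem proj_inv (X : A.dg.Obj) :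
    (proj F).toFunctor.map ((univ F).inv X) = 𝟙 (F.hom.toFunctor.obj X) :=
  descLinear_edge (F := F) (𝟙 B.dg) (CohEquiv.refl F.hom) (MapCyl.Gen.t' X)

theorem retr_app (X : A.dg.Obj) : (retr F).toFunctor.map ((univ F).app X) =
    𝟙 ((inclB F).toFunctor.obj (F.hom.toFunctor.obj X)) :=
  (congrArg (inclB F).toFunctor.map (proj_app F X)).trans ((inclB F).toFunctor.map_id _)

theorem retr_inv (X : A.dg.Obj) : (retr F).toFunctor.map ((univ F).inv X) =
    𝟙 ((inclB F).toFunctor.obj (F.hom.toFunctor.obj X)) :=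
  (congrArg (inclB F).toFunctor.map (proj_inv F X)).trans ((inclB F).toFunctor.map_id _)

theorem retr_hat (X : A.dg.Obj) : (retr F).toFunctor.map ((univ F).hat X) = 0 :=
  (congrArg (inclB F).toFunctor.map (descLinear_edge (F := F) (𝟙 B.dg) (CohEquiv.refl F.hom)
    (MapCyl.Gen.tHat X))).trans ((inclB F).map_zero _ _)

theorem retr_check (X : A.dg.Obj) : (retr F).toFunctor.map ((univ F).check X) = 0 :=
  (congrArg (inclB F).toFunctor.map (descLinear_edge (F := F) (𝟙 B.dg) (CohEquiv.refl F.hom)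
    (MapCyl.Gen.tCheck X))).trans ((inclB F).map_zero _ _)

theorem retr_bar (X : A.dg.Obj) : (retr F).toFunctor.map ((univ F).bar X) = 0 :=
  (congrArg (inclB F).toFunctor.map (descLinear_edge (F := F) (𝟙 B.dg) (CohEquiv.refl F.hom)
    (MapCyl.Gen.tBar X))).trans ((inclB F).map_zero _ _)

theorem retr_map {X Y : A.dg.Obj} (f : X ⟶ Y) : (retr F).toFunctor.map ((univ F).map f) = 0 :=
  (congrArg (inclB F).toFunctor.map
    (descLinear_univ (F := F) (𝟙 B.dg) (CohEquiv.refl F.hom) f)).trans ((inclB F).map_zero _ _)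

/-- The components of the homotopy from `retr F` to the identity. -/
noncomputable def contrApp :
    ∀ X : (mapCyl F).Obj, (retr F).toFunctor.obj X ⟶
      (𝟙 (mapCyl F) : mapCyl F ⟶ mapCyl F).toFunctor.obj X
  | ⟨.inl X⟩ => 𝟙 ((inclB F).toFunctor.obj X)
  | ⟨.inr X⟩ => (univ F).app X

/-- The values on generating morphisms of the homotopy from `retr F` to the identity. -/
noncomputable def contrGen : ∀ X Y : (mapCyl F).Obj, (gens F).Gen X Y →
    ((retr F).toFunctor.obj X ⟶ (𝟙 (mapCyl F) : mapCyl F ⟶ mapCyl F).toFunctor.obj Y)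
  -- The homotopy equation dictates the values. At `t'` it asks for a primitive of `t' ∘ t - 1`,
  -- namely `-t̂`. At `ť` the derivation rule then leaves `t ∘ ť` to be compared with `ť`'s
  -- correction `t ∘ t̂`; the equation becomes the one defining `d t̄` once `d ť` is expanded.
  | ⟨_⟩, ⟨_⟩, .ofB _ => 0
  | ⟨_⟩, ⟨_⟩, .ofA a => (univ F).map (A.gens.val _ _ a)
  | ⟨_⟩, ⟨_⟩, .t _ => 0
  | ⟨_⟩, ⟨_⟩, .t' X => -(univ F).hat X
  | ⟨_⟩, ⟨_⟩, .tHat _ => 0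
  | ⟨_⟩, ⟨_⟩, .tCheck X => (univ F).bar X
  | ⟨_⟩, ⟨_⟩, .tBar _ => 0
  | ⟨_⟩, ⟨_⟩, .tGen _ => 0

/-- The derivation underlying the homotopy from `retr F` to the identity. -/
noncomputable def contrMap {X Y : (mapCyl F).Obj} : (X ⟶ Y) →ₗ[k] ((retr F).toFunctor.obj X ⟶ Y) :=
  (gens F).twist (P := retr F) (Q := 𝟙 (mapCyl F)) (contrGen F)

theorem contrMap_comp {X Y Z : (mapCyl F).Obj} {m : ℤ} {f : X ⟶ Y}
    (hf : f ∈ (mapCyl F).deg X Y m) (g : Y ⟶ Z) :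
    contrMap F (f ≫ g) =
      sgn k m • ((retr F).toFunctor.map f ≫ contrMap F g) + contrMap F f ≫ g :=
  (gens F).twist_comp (contrGen F) hf g

theorem contrMap_id (X : (mapCyl F).Obj) : contrMap F (𝟙 X) = 0 :=
  (gens F).twist_id (contrGen F) X

theorem contrMap_app (X : A.dg.Obj) : contrMap F ((univ F).app X) = 0 :=
  (gens F).twist_val (contrGen F) (X := ⟨_⟩) (Y := ⟨_⟩) (MapCyl.Gen.t X)

theorem contrMap_inv (X : A.dg.Obj) : contrMap F ((univ F).inv X) = -(univ F).hat X :=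
  (gens F).twist_val (contrGen F) (X := ⟨_⟩) (Y := ⟨_⟩) (MapCyl.Gen.t' X)

theorem contrMap_hat (X : A.dg.Obj) : contrMap F ((univ F).hat X) = 0 :=
  (gens F).twist_val (contrGen F) (X := ⟨_⟩) (Y := ⟨_⟩) (MapCyl.Gen.tHat X)

theorem contrMap_check (X : A.dg.Obj) : contrMap F ((univ F).check X) = (univ F).bar X :=
  (gens F).twist_val (contrGen F) (X := ⟨_⟩) (Y := ⟨_⟩) (MapCyl.Gen.tCheck X)

/-- A derivation that vanishes on the letters of `B` vanishes on all words in them. -/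
theorem contrMap_inclB {X Y : B.dg.Obj} (f : X ⟶ Y) :
    contrMap F ((inclB F).toFunctor.map f) = 0 := by
  induction f using B.gens.hom_induction with
  | zero => rw [DGFunctor.map_zero, map_zero]
  | add f g hf hg => rw [DGFunctor.map_add, map_add, hf, hg, add_zero]
  | smul c f hf => rw [DGFunctor.map_smul, map_smul, hf, smul_zero]
  | word p =>
    induction p with
    | nil => exact (congrArg _ ((inclB F).toFunctor.map_id X)).trans (contrMap_id F _)
    | cons p e ih =>
      have h : contrMap F ((inclB F).toFunctor.map (B.gens.val _ _ e)) = 0 := by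
        rw [inclB_val]
        exact (gens F).twist_val (contrGen F) (genB F e)
      rw [GeneratingMorphisms.word_cons, Functor.map_comp,
        contrMap_comp F ((inclB F).map_deg (B.gens.word_mem p)), ih, h]
      simp

/-- The retraction acts on `A` as `F`, so both sides obey the same derivation rule, and they agree
on letters by the choice of `contrGen`. -/
theorem contrMap_inclA {X Y : A.dg.Obj} (f : X ⟶ Y) :
    contrMap F ((inclA F).toFunctor.map f) = (univ F).map f := by
  induction f using A.gens.hom_induction with
  | zero => rw [DGFunctor.map_zero, map_zero, map_zero]; rfl
  | add f g hf hg => rw [DGFunctor.map_add, map_add, hf, hg, map_add]; rfl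
  | smul c f hf => rw [DGFunctor.map_smul, map_smul, hf, map_smul]; rfl
  | word p =>
    induction p with
    | nil =>
      exact ((congrArg _ ((inclA F).toFunctor.map_id X)).trans (contrMap_id F _)).trans
        ((univ F).map_id X).symm
    | cons p e ih =>
      have h : contrMap F ((inclA F).toFunctor.map (A.gens.val _ _ e)) =
          (univ F).map (A.gens.val _ _ e) := by
        rw [inclA_val]
        exact (gens F).twist_val (contrGen F) (genA F e)
      rw [GeneratingMorphisms.word_cons, Functor.map_comp,
        contrMap_comp F ((inclA F).map_deg (A.gens.word_mem p)), ih, h,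
        (univ F).map_comp (A.gens.word_mem p), retr_inclA]
      rfl

/-- Every term of the derivation rule vanishes: `contrMap` kills `B` and the letters `t_a`, and the
retraction kills all `t_θ`. This disposes of the summand `t_{da}` when the homotopy equation is
checked at `t_a`. -/
theorem contrMap_map {X Y : A.dg.Obj} (f : X ⟶ Y) : contrMap F ((univ F).map f) = 0 := by
  induction f using A.gens.hom_induction with
  | zero => rw [map_zero, map_zero]
  | add f g hf hg => rw [map_add, map_add, hf, hg, add_zero]
  | smul c f hf => rw [map_smul, map_smul, hf, smul_zero]
  | word p =>
    induction p with
    | nil =>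
      refine (congrArg _ ((univ F).map_id X)).trans (map_zero _)
    | cons p e ih =>
      have h : contrMap F ((univ F).map (A.gens.val _ _ e)) = 0 := by
        have h' : (univ F).map (A.gens.val _ _ e) = (gens F).val
          ⟨Sum.inl (F.hom.toFunctor.obj _)⟩ ⟨Sum.inr _⟩ (MapCyl.Gen.tGen e) :=
          MapCyl.tMap_val A.gens B.gens F.hom e
        refine (congrArg (fun z => contrMap F z) h').trans ?_
        exact (gens F).twist_val (contrGen F) (X := ⟨_⟩) (Y := ⟨_⟩) (MapCyl.Gen.tGen e)
      have hw := A.gens.word_mem p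
      have hB : (F.hom ≫ inclB F).toFunctor.map (A.gens.word p) ∈ (mapCyl F).deg _ _ _ :=
        (F.hom ≫ inclB F).map_deg hw
      have h0 : contrMap F ((F.hom ≫ inclB F).toFunctor.map (A.gens.word p)) = 0 :=
        contrMap_inclB F _
      rw [GeneratingMorphisms.word_cons, (univ F).map_comp hw, map_add, map_smul,
        contrMap_comp F hB, contrMap_comp F ((univ F).map_mem hw), h, h0, ih, retr_map]
      simp

theorem contrApp_mem (X : (mapCyl F).Obj) : contrApp F X ∈ (mapCyl F).deg _ _ 0 := by
  obtain ⟨X | X⟩ := X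
  · exact (mapCyl F).id_mem _
  · exact (univ F).app_mem X

theorem d_contrApp (X : (mapCyl F).Obj) : (mapCyl F).d _ _ (contrApp F X) = 0 := by
  obtain ⟨X | X⟩ := X
  · exact (mapCyl F).d_id _
  · exact (univ F).d_app X

theorem contrGen_mem {X Y : (mapCyl F).Obj} (e : (gens F).Gen X Y) :
    contrGen F X Y e ∈ (mapCyl F).deg _ _ ((gens F).degree X Y e - 1) := by
  obtain ⟨X⟩ := X
  obtain ⟨Y⟩ := Y
  cases e with
  | ofA a => exact (univ F).map_mem (A.gens.val_mem a)
  | t' X => exact neg_mem ((univ F).hat_mem X)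
  | tCheck X => exact (univ F).bar_mem X
  | _ => exact zero_mem _

/-- The homotopy equation is assembled term by term, since its terms have types that match only
after unfolding, where rewriting would be fragile. -/
theorem d_eq_of_eq {C : DGCat k} {X Y : C.Obj} {n : ℤ} {s a a' r r' c c' : X ⟶ Y} (ha : a = a')
    (hr : r = r') (hc : c = c') (h : C.d X Y s = sgn k n • (a' - r') + c') :
    C.d X Y s = sgn k n • (a - r) + c := by
  subst ha hr hc
  exact h

theorem d_contrGen {X Y : (mapCyl F).Obj} (e : (gens F).Gen X Y) :
    (mapCyl F).d _ _ (contrGen F X Y e) = sgn k ((gens F).degree X Y e) •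
        (contrApp F X ≫ (𝟙 (mapCyl F) : mapCyl F ⟶ mapCyl F).toFunctor.map ((gens F).val X Y e) -
          (retr F).toFunctor.map ((gens F).val X Y e) ≫ contrApp F Y) +
      (gens F).twist (contrGen F) ((mapCyl F).d X Y ((gens F).val X Y e)) := by
  let M := mapCyl F
  let iB := (inclB F).toFunctor
  let iA := (inclA F).toFunctor
  let R := (retr F).toFunctor
  let U := univ F
  have hneg : sgn k (-1) = -1 := by rw [← zero_sub, sgn_sub_one, sgn_zero]
  have happ {X : A.dg.Obj} {Y : M.Obj} (f : iB.obj (F.hom.toFunctor.obj X) ⟶ Y) :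
      R.map (U.app X) ≫ f = f :=
    (congrArg (fun z => z ≫ f) (retr_app F X)).trans (Category.id_comp f)
  have hinv {X : A.dg.Obj} {Y : M.Obj} (f : iB.obj (F.hom.toFunctor.obj X) ⟶ Y) :
      R.map (U.inv X) ≫ f = f :=
    (congrArg (fun z => z ≫ f) (retr_inv F X)).trans (Category.id_comp f)
  have hzero {X Y Z : M.Obj} {g : X ⟶ Y} (hg : R.map g = 0) (f : R.obj Y ⟶ Z) :
      R.map g ≫ f = 0 := by rw [hg, Limits.zero_comp]
  -- The homotopy vanishes on `t` and the retraction sends `t` to an identity, so precomposing with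
  -- `t` leaves `contrMap` unchanged. This cancels the terms at `t̂`, `t̄` and `t_a`, where
  -- `contrGen` is zero.
  have hcomp {X : A.dg.Obj} {Y : M.Obj} (f : iA.obj X ⟶ Y) :
      contrMap F (U.app X ≫ f) = (contrMap F f : iB.obj (F.hom.toFunctor.obj X) ⟶ Y) := by
    rw [contrMap_comp F (U.app_mem X), sgn_zero, one_smul, contrMap_app, Limits.zero_comp,
      add_zero]
    exact happ _
  obtain ⟨X⟩ := X
  obtain ⟨Y⟩ := Y
  cases e with
  | ofB b =>
    have hval := inclB_val F b
    refine d_eq_of_eq (C := M) (X := iB.obj _) (Y := iB.obj _) (s := 0) (c' := 0)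
      (a' := iB.map (B.gens.val _ _ b)) (r' := iB.map (B.gens.val _ _ b))
      ((Category.id_comp _).trans hval.symm)
      ((Category.comp_id _).trans ((congrArg R.map hval.symm).trans (retr_inclB F _)))
      ((congrArg (fun z => contrMap F (M.d _ _ z)) hval.symm).trans ?_) (by simp)
    exact (congrArg (fun z => contrMap F z) ((inclB F).map_d _).symm).trans (contrMap_inclB F _)
  | ofA a =>
    have hval := inclA_val F a
    refine d_eq_of_eq (C := M) (X := iB.obj _) (Y := iA.obj _) (s := U.map (A.gens.val _ _ a))
      (c' := U.map (A.dg.d _ _ (A.gens.val _ _ a)))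
      (a' := U.app _ ≫ iA.map (A.gens.val _ _ a))
      (r' := iB.map (F.hom.toFunctor.map (A.gens.val _ _ a)) ≫ U.app _)
      (congrArg (fun z => U.app _ ≫ z) hval.symm)
      (congrArg (fun z => z ≫ U.app _) ((congrArg R.map hval.symm).trans (retr_inclA F _)))
      ((congrArg (fun z => contrMap F (M.d _ _ z)) hval.symm).trans ?_)
      (U.d_map (A.gens.val_mem a))
    exact (congrArg (fun z => contrMap F z) ((inclA F).map_d _).symm).trans (contrMap_inclA F _)
  | t X =>
    refine d_eq_of_eq (C := M) (X := iB.obj _) (Y := iA.obj X) (s := 0) (c' := 0)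
      (a' := U.app X) (r' := U.app X) (Category.id_comp _) (happ _) ?_ (by simp)
    exact (congrArg (fun z => contrMap F z) (U.d_app X)).trans (map_zero _)
  | t' X =>
    refine d_eq_of_eq (C := M) (X := iB.obj _) (Y := iB.obj _) (n := 0) (s := -U.hat X) (c' := 0)
      (a' := U.app X ≫ U.inv X) (r' := 𝟙 _) rfl (hinv _) ?_ ?_
    · exact (congrArg (fun z => contrMap F z) (U.d_inv X)).trans (map_zero _)
    · rw [map_neg, sgn_zero, one_smul, add_zero, ← neg_sub]
      exact congrArg _ (U.d_hat X)
  | tHat X =>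
    refine d_eq_of_eq (C := M) (X := iB.obj _) (Y := iB.obj _) (n := -1) (s := 0)
      (c' := U.hat X) (a' := U.hat X) (r' := 0) (Category.id_comp _)
      (hzero (retr_hat F X) _) ?_ (by simp [hneg])
    refine (congrArg (fun z => contrMap F z) (U.d_hat X)).trans ((map_sub _ _ _).trans
      ((congrArg₂ (fun x y => x - y) (contrMap_id F _)
        ((hcomp _).trans (contrMap_inv F X))).trans ?_))
    exact (zero_sub _).trans (neg_neg (U.hat X))
  | tCheck X =>
    refine d_eq_of_eq (C := M) (X := iB.obj _) (Y := iA.obj _) (n := -1) (s := U.bar X)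
      (c' := U.hat X ≫ U.app X) (a' := U.app X ≫ U.check X) (r' := 0) rfl
      (hzero (retr_check F X) _) ?_ ?_
    · refine (congrArg (fun z => contrMap F z) (U.d_check X)).trans ?_
      rw [map_sub, contrMap_id, contrMap_comp F (U.inv_mem X), sgn_zero, one_smul,
        contrMap_app, contrMap_inv, Limits.comp_zero, zero_add, zero_sub]
      exact (congrArg Neg.neg (Preadditive.neg_comp _ _)).trans (neg_neg (U.hat X ≫ U.app X))
    · rw [hneg, sub_zero, neg_smul, one_smul, neg_add_eq_sub]
      exact U.d_bar X
  | tBar X =>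
    refine d_eq_of_eq (C := M) (X := iB.obj _) (Y := iA.obj _) (n := -2) (s := 0)
      (c' := -U.bar X) (a' := U.bar X) (r' := 0) (Category.id_comp _)
      (hzero (retr_bar F X) _) ?_ ?_
    · have h : contrMap F (U.hat X ≫ U.app X) = 0 := by
        rw [contrMap_comp F (U.hat_mem X), contrMap_app, contrMap_hat]
        simp
      refine (congrArg (fun z => contrMap F z) (U.d_bar X)).trans ((map_sub _ _ _).trans
        ((congrArg₂ (fun x y => x - y) h ((hcomp _).trans (contrMap_check F X))).trans ?_))
      exact zero_sub (U.bar X)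
    · have : sgn k (-2) = 1 := by
        rw [show (-2 : ℤ) = -1 + -1 by norm_num, sgn_add, hneg]; simp
      simp [this]
  | tGen a =>
    have hval : U.map (A.gens.val _ _ a) = (gens F).val
        ⟨Sum.inl (F.hom.toFunctor.obj _)⟩ ⟨Sum.inr _⟩ (MapCyl.Gen.tGen a) :=
      MapCyl.tMap_val A.gens B.gens F.hom a
    refine d_eq_of_eq (C := M) (X := iB.obj _) (Y := iA.obj _) (n := A.gens.degree _ _ a - 1)
      (s := 0) (c' := sgn k (A.gens.degree _ _ a) • U.map (A.gens.val _ _ a))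
      (a' := U.map (A.gens.val _ _ a)) (r' := 0)
      ((Category.id_comp _).trans hval.symm)
      ((congrArg (fun z => R.map z ≫ U.app _) hval.symm).trans (hzero (retr_map F _) _))
      ((congrArg (fun z => contrMap F (M.d _ _ z)) hval.symm).trans ?_) ?_
    · refine (congrArg (fun z => contrMap F z) (U.d_map (A.gens.val_mem a))).trans ?_
      have hB := contrMap_comp F ((inclB F).map_deg (F.hom.map_deg (A.gens.val_mem a))) (U.app _)
      rw [contrMap_app, contrMap_inclB, Limits.zero_comp, Limits.comp_zero, smul_zero,
        add_zero] at hB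
      rw [map_add, map_smul, map_sub, contrMap_map, add_zero]
      exact congrArg _ ((congrArg₂
        (fun x y : iB.obj (F.hom.toFunctor.obj _) ⟶ iA.obj _ => x - y)
        ((hcomp _).trans (contrMap_inclA F _)) hB).trans (sub_zero (U.map (A.gens.val _ _ a))))
    · rw [sgn_sub_one]
      simp

/-- The homotopy from `retr F` to the identity. -/
noncomputable def contraction : Homotopy (retr F) (𝟙 (mapCyl F)) :=
  (gens F).homotopy (contrApp F) (contrApp_mem F) (d_contrApp F) (contrGen F) (contrGen_mem F)
    (d_contrGen F)

/-- The homotopy inverses of the components of `contraction`. -/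
noncomputable def contrInv : ∀ X : (mapCyl F).Obj, X ⟶ (retr F).toFunctor.obj X
  | ⟨.inl X⟩ => 𝟙 ((inclB F).toFunctor.obj X)
  | ⟨.inr X⟩ => (univ F).inv X

theorem contrInv_mem (X : (mapCyl F).Obj) : contrInv F X ∈ (mapCyl F).deg _ _ 0 := by
  obtain ⟨X | X⟩ := X
  · exact (mapCyl F).id_mem _
  · exact (univ F).inv_mem X

theorem d_contrInv (X : (mapCyl F).Obj) : (mapCyl F).d _ _ (contrInv F X) = 0 := by
  obtain ⟨X | X⟩ := X
  · exact (mapCyl F).d_id _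
  · exact (univ F).d_inv X

/-- The components of `contraction`. -/
noncomputable def contrComp (X : (mapCyl F).Obj) : (retr F).toFunctor.obj X ⟶ X := contrApp F X

/-- On `B` both maps are identities and `0` works; on `A` the primitive is `ť`. -/
theorem exists_contrInv_comp (X : (mapCyl F).Obj) : ∃ c ∈ (mapCyl F).deg X X (-1),
    (mapCyl F).d X X c = 𝟙 X - contrInv F X ≫ contrComp F X := by
  obtain ⟨X | X⟩ := X
  · refine ⟨(0 : (inclB F).toFunctor.obj X ⟶ (inclB F).toFunctor.obj X), zero_mem _,
      (((mapCyl F).d ((inclB F).toFunctor.obj X) ((inclB F).toFunctor.obj X)).map_zero).trans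
        (Eq.symm ?_)⟩
    exact sub_eq_zero.2 (Category.comp_id (𝟙 ((inclB F).toFunctor.obj X))).symm
  · exact ⟨(univ F).check X, (univ F).check_mem X, (univ F).d_check X⟩

theorem proj_contrComp (X : (mapCyl F).Obj) :
    (proj F).toFunctor.map (contrComp F X) = 𝟙 ((proj F).toFunctor.obj X) := by
  obtain ⟨X | X⟩ := X
  · exact (proj F).toFunctor.map_id _
  · exact proj_app F X

theorem proj_contrInv (X : (mapCyl F).Obj) :
    (proj F).toFunctor.map (contrInv F X) = 𝟙 ((proj F).toFunctor.obj X) := by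
  obtain ⟨X | X⟩ := X
  · exact (proj F).toFunctor.map_id _
  · exact proj_inv F X

theorem isQuasiEquivalence_proj : DGFunctor.IsQuasiEquivalence (proj F) where
  essSurj Y := by
    -- Since `q` retracts onto `B`, it is strictly surjective on objects; identities with zero
    -- primitives suffice.
    refine ⟨(inclB F).toFunctor.obj Y, 𝟙 Y, 𝟙 Y, ?_, ?_, ?_, ?_⟩
    · exact ⟨B.dg.id_mem Y, B.dg.d_id Y⟩
    · exact ⟨B.dg.id_mem Y, B.dg.d_id Y⟩
    · exact ⟨(0 : Y ⟶ Y), zero_mem _, (map_zero _).trans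
        (sub_eq_zero.2 (Category.comp_id (𝟙 Y)).symm).symm⟩
    · exact ⟨(0 : Y ⟶ Y), zero_mem _, (map_zero _).trans
        (sub_eq_zero.2 (Category.comp_id (𝟙 Y)).symm).symm⟩
  bijective := (contraction F).bijective_mapCohomology (contrComp F) (fun _ => rfl) (contrInv F)
    (contrInv_mem F) (d_contrInv F) (exists_contrInv_comp F) (fun X Y g => by
      rw [Functor.map_comp, Functor.map_comp, proj_contrComp, proj_contrInv]
      exact (Category.id_comp _).trans ((Category.comp_id _).trans (proj_inclB F g)))

end mapCyl

namespace mapCyl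

variable {A B A' B' A'' B'' : DGCatS k}

/-! ### Functoriality and the pushout square -/

theorem val_comp {F : A ⟶ B} {C D : DGCat k} (Θ : mapCyl F ⟶ C) (G : C ⟶ D)
    {X Y : MapCyl.Cat A.gens B.gens F.hom} (f : X ⟶ Y) :
    val (Θ ≫ G) f = G.toFunctor.mapArrow.obj (val Θ f) := rfl

section induced

variable {F : A ⟶ B} {F' : A' ⟶ B'} {α : A ⟶ A'} {β : B ⟶ B'}

/-- The formulas for `M(α, β)` are those of the dg functor classified by the universal equivalence
of `M_{F'}` restricted along `α`, which gives its existence and uniqueness. -/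
theorem isInducedMap_iff {Φ : mapCyl F ⟶ mapCyl F'} : IsInducedMap F F' α β Φ ↔
    IsDesc (β.hom ≫ inclB F') ((univ F').comap α.hom) Φ :=
  ⟨fun h => ⟨h.inclB_comp, h.inclA_comp, h.map_t, h.map_t', h.map_tHat, h.map_tCheck,
    h.map_tBar, h.map_tGen⟩, fun h => ⟨h.inclB_comp, h.inclA_comp, h.map_t, h.map_t', h.map_tHat,
    h.map_tCheck, h.map_tBar, h.map_tGen⟩⟩

theorem comp_eq_of_commSq (h : CommSq F α β F') :
    F.hom ≫ β.hom ≫ inclB F' = α.hom ≫ F'.hom ≫ inclB F' :=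
  congrArg (fun T : A ⟶ B' => T.hom ≫ inclB F') h.w

theorem exists_isInducedMap (h : CommSq F α β F') :
    ∃ Φ : mapCyl F ⟶ mapCyl F', IsInducedMap F F' α β Φ := by
  obtain ⟨Φ, hΦ⟩ := exists_isDesc (β.hom ≫ inclB F') (comp_eq_of_commSq h)
    ((univ F').comap α.hom)
  exact ⟨Φ, isInducedMap_iff.2 hΦ⟩

theorem IsInducedMap.unique {Φ Φ' : mapCyl F ⟶ mapCyl F'} (h : IsInducedMap F F' α β Φ)
    (h' : IsInducedMap F F' α β Φ') : Φ = Φ' :=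
  (isInducedMap_iff.1 h).unique (isInducedMap_iff.1 h')

theorem IsInducedMap.map_tMap {Φ : mapCyl F ⟶ mapCyl F'} (hΦ : IsInducedMap F F' α β Φ)
    (h : CommSq F α β F') {X Y : A.dg.Obj} (f : X ⟶ Y) :
    val Φ (MapCyl.tMap A.gens B.gens F.hom f) =
      Arrow.mk (MapCyl.tMap A'.gens B'.gens F'.hom (α.hom.toFunctor.map f)) :=
  (isInducedMap_iff.1 hΦ).map_tMap (comp_eq_of_commSq h) f

variable (α β) in
/-- The dg functor `M(α, β)`. -/
noncomputable def induced (h : CommSq F α β F') : mapCyl F ⟶ mapCyl F' :=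
  (exists_isInducedMap h).choose

theorem isInducedMap_induced (h : CommSq F α β F') : IsInducedMap F F' α β (induced α β h) :=
  (exists_isInducedMap h).choose_spec

/-- Both composites send `t`, `t'` to identities and the other added letters to zero. For `t_a` one
needs that `q'` kills `t_θ` for every `θ`, since `α(a)` may be any morphism. -/
theorem IsInducedMap.comp_proj {Φ : mapCyl F ⟶ mapCyl F'} (hΦ : IsInducedMap F F' α β Φ)
    (h : CommSq F α β F') : Φ ≫ proj F' = proj F ≫ β.hom := by
  have hq := isProjection_proj F
  have hq' := isProjection_proj F'
  -- The square identifies these objects only propositionally, so identities and zeros are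
  -- transported as arrows.
  have hobj (X : A.dg.Obj) : F'.hom.toFunctor.obj (α.hom.toFunctor.obj X) =
      β.hom.toFunctor.obj (F.hom.toFunctor.obj X) :=
    congrArg (fun T : A ⟶ B' => T.hom.toFunctor.obj X) h.w.symm
  have hid (X : A.dg.Obj) :
      Arrow.mk (𝟙 (F'.hom.toFunctor.obj (α.hom.toFunctor.obj X))) =
        β.hom.toFunctor.mapArrow.obj (Arrow.mk (𝟙 (F.hom.toFunctor.obj X))) :=
    (congrArg (fun Z : B'.dg.Obj => Arrow.mk (𝟙 Z)) (hobj X)).trans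
      (congrArg Arrow.mk (β.hom.toFunctor.map_id _)).symm
  have hzero (X Y : A.dg.Obj) :
      Arrow.mk (0 : F'.hom.toFunctor.obj (α.hom.toFunctor.obj X) ⟶
        F'.hom.toFunctor.obj (α.hom.toFunctor.obj Y)) =
        β.hom.toFunctor.mapArrow.obj
          (Arrow.mk (0 : F.hom.toFunctor.obj X ⟶ F.hom.toFunctor.obj Y)) :=
    (congrArg₂ (fun Z W : B'.dg.Obj => Arrow.mk (0 : Z ⟶ W)) (hobj X) (hobj Y)).trans
      (congrArg Arrow.mk (β.hom.map_zero _ _)).symm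
  refine hom_ext ?_ ?_ (fun X => ?_) (fun X => ?_) (fun X => ?_) (fun X => ?_) (fun X => ?_)
    (fun {X Y} a => ?_)
  · rw [← Category.assoc, hΦ.inclB_comp, Category.assoc, hq'.inclB_comp, ← Category.assoc,
      hq.inclB_comp, Category.comp_id, Category.id_comp]
  · rw [← Category.assoc, hΦ.inclA_comp, Category.assoc, hq'.inclA_comp, ← Category.assoc,
      hq.inclA_comp]
    exact congrArg (fun T : A ⟶ B' => T.hom) h.w.symm
  · rw [val_comp, val_comp, hΦ.map_t, hq.map_t]
    exact (hq'.map_t _).trans (hid X)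
  · rw [val_comp, val_comp, hΦ.map_t', hq.map_t']
    exact (hq'.map_t' _).trans (hid X)
  · rw [val_comp, val_comp, hΦ.map_tHat, hq.map_tHat]
    exact (hq'.map_tHat _).trans (hzero X X)
  · rw [val_comp, val_comp, hΦ.map_tCheck, hq.map_tCheck]
    exact (hq'.map_tCheck _).trans (hzero X X)
  · rw [val_comp, val_comp, hΦ.map_tBar, hq.map_tBar]
    exact (hq'.map_tBar _).trans (hzero X X)
  · rw [val_comp, val_comp, hΦ.map_tGen, hq.map_tGen]
    exact ((isDesc_desc (𝟙 B'.dg) (CohEquiv.refl F'.hom)).map_tMap rfl _).trans (hzero X Y)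

theorem isInducedMap_id (F : A ⟶ B) : IsInducedMap F F (𝟙 A) (𝟙 B) (𝟙 (mapCyl F)) where
  inclB_comp := rfl
  inclA_comp := rfl
  map_t _ := rfl
  map_t' _ := rfl
  map_tHat _ := rfl
  map_tCheck _ := rfl
  map_tBar _ := rfl
  map_tGen a := congrArg Arrow.mk (MapCyl.tMap_val A.gens B.gens F.hom a).symm

/-- Only `t_a` is not immediate: the second functor is evaluated on `t_{α(a)}`, where `map_tMap` is
required. -/
theorem IsInducedMap.comp {F'' : A'' ⟶ B''} {α' : A' ⟶ A''} {β' : B' ⟶ B''}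
    {Φ : mapCyl F ⟶ mapCyl F'} {Φ' : mapCyl F' ⟶ mapCyl F''} (hΦ : IsInducedMap F F' α β Φ)
    (hΦ' : IsInducedMap F' F'' α' β' Φ') (h' : CommSq F' α' β' F'') :
    IsInducedMap F F'' (α ≫ α') (β ≫ β') (Φ ≫ Φ') where
  inclB_comp := by
    rw [← Category.assoc, hΦ.inclB_comp, Category.assoc, hΦ'.inclB_comp]
    rfl
  inclA_comp := by
    rw [← Category.assoc, hΦ.inclA_comp, Category.assoc, hΦ'.inclA_comp]
    rfl
  map_t X := by rw [val_comp, hΦ.map_t]; exact hΦ'.map_t _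
  map_t' X := by rw [val_comp, hΦ.map_t']; exact hΦ'.map_t' _
  map_tHat X := by rw [val_comp, hΦ.map_tHat]; exact hΦ'.map_tHat _
  map_tCheck X := by rw [val_comp, hΦ.map_tCheck]; exact hΦ'.map_tCheck _
  map_tBar X := by rw [val_comp, hΦ.map_tBar]; exact hΦ'.map_tBar _
  map_tGen a := by rw [val_comp, hΦ.map_tGen]; exact hΦ'.map_tMap h' _

end induced

/-! ### The pushout square -/

section pushout

variable {F : A ⟶ B} {Φ : mapCyl (𝟙 A) ⟶ mapCyl F} {W : DGCat k} {u : mapCyl (𝟙 A) ⟶ W}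
  {w : B.dg ⟶ W}

/-- The map from the cylinder of `A` carries its copy of `A` and its added letters to those of
`M_F`, so a cocone prescribes exactly the data that determine a dg functor on `M_F`. Compatibility
of the cocone is needed only on the target copy of `A`, which lands in `B`, and to match the
derivations. -/
theorem IsInducedMap.isDesc_iff (hΦ : IsInducedMap (𝟙 A) F (𝟙 A) F Φ)
    (hc : inclB (𝟙 A) ≫ u = F.hom ≫ w) {Θ : mapCyl F ⟶ W} :
    IsDesc w ((univ (𝟙 A)).mapTarget u) Θ ↔ Φ ≫ Θ = u ∧ inclB F ≫ Θ = w := by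
  have hA : inclA (𝟙 A) ≫ Φ = inclA F := hΦ.inclA_comp
  have hsq : CommSq (𝟙 A) (𝟙 A) F F := ⟨rfl⟩
  constructor
  · intro h
    refine ⟨hom_ext ?_ ?_ (fun X => ?_) (fun X => ?_) (fun X => ?_) (fun X => ?_) (fun X => ?_)
      (fun {X Y} a => ?_), h.inclB_comp⟩
    · rw [← Category.assoc, hΦ.inclB_comp, Category.assoc, h.inclB_comp, hc]
    · rw [← Category.assoc, hA, h.inclA_comp]
    · rw [val_comp, hΦ.map_t]; exact h.map_t X
    · rw [val_comp, hΦ.map_t']; exact h.map_t' X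
    · rw [val_comp, hΦ.map_tHat]; exact h.map_tHat X
    · rw [val_comp, hΦ.map_tCheck]; exact h.map_tCheck X
    · rw [val_comp, hΦ.map_tBar]; exact h.map_tBar X
    · rw [val_comp, hΦ.map_tGen, ← MapCyl.tMap_val]
      exact h.map_tMap (E := (univ (𝟙 A)).mapTarget u) hc.symm _
  · rintro ⟨rfl, rfl⟩
    refine ⟨rfl, ?_, fun X => ?_, fun X => ?_, fun X => ?_, fun X => ?_, fun X => ?_,
      fun {X Y} a => ?_⟩
    · rw [← Category.assoc, hA]
    · exact (congrArg Θ.toFunctor.mapArrow.obj (hΦ.map_t X)).symm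
    · exact (congrArg Θ.toFunctor.mapArrow.obj (hΦ.map_t' X)).symm
    · exact (congrArg Θ.toFunctor.mapArrow.obj (hΦ.map_tHat X)).symm
    · exact (congrArg Θ.toFunctor.mapArrow.obj (hΦ.map_tCheck X)).symm
    · exact (congrArg Θ.toFunctor.mapArrow.obj (hΦ.map_tBar X)).symm
    · refine (congrArg Θ.toFunctor.mapArrow.obj ((hΦ.map_tMap hsq (A.gens.val X Y a)).trans
        (congrArg Arrow.mk (MapCyl.tMap_val A.gens B.gens F.hom a)))).symm

theorem IsInducedMap.isPushout (hΦ : IsInducedMap (𝟙 A) F (𝟙 A) F Φ) :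
    IsPushout (inclB (𝟙 A)) F.hom Φ (inclB F) := by
  have key (s : Limits.PushoutCocone (inclB (𝟙 A)) F.hom) :
      ∃ Θ : mapCyl F ⟶ s.pt, IsDesc s.inr ((univ (𝟙 A)).mapTarget s.inl) Θ :=
    exists_isDesc s.inr (P := ((𝟙 A : A ⟶ A).hom ≫ inclB (𝟙 A)) ≫ s.inl) s.condition.symm _
  choose Θ hΘ using key
  refine ⟨⟨hΦ.inclB_comp⟩, ⟨Limits.PushoutCocone.IsColimit.mk _ Θ
    (fun s => ((hΦ.isDesc_iff s.condition).1 (hΘ s)).1)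
    (fun s => ((hΦ.isDesc_iff s.condition).1 (hΘ s)).2) fun s m h1 h2 => ?_⟩⟩
  exact ((hΦ.isDesc_iff s.condition).2 ⟨h1, h2⟩).unique (hΘ s)

end pushout

end mapCyl

end DGCyl

theorem mainTheorem7 (k : Type u) [CommRing k] :
    ∃ (q : ∀ {A B : DGCatS k} (F : A ⟶ B), mapCyl F ⟶ B.dg)
      (M : ∀ {A B A' B' : DGCatS k} {F : A ⟶ B} {F' : A' ⟶ B'} (α : A ⟶ A') (β : B ⟶ B'),
        CommSq F α β F' → (mapCyl F ⟶ mapCyl F')),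
      -- `q` and `M` are given by the explicit formulas, which determine them uniquely
      (∀ {A B : DGCatS k} (F : A ⟶ B), mapCyl.IsProjection F (q F) ∧
        ∀ r : mapCyl F ⟶ B.dg, mapCyl.IsProjection F r → r = q F) ∧
      (∀ {A B A' B' : DGCatS k} {F : A ⟶ B} {F' : A' ⟶ B'} (α : A ⟶ A') (β : B ⟶ B')
        (h : CommSq F α β F'), mapCyl.IsInducedMap F F' α β (M α β h) ∧
        ∀ Φ : mapCyl F ⟶ mapCyl F', mapCyl.IsInducedMap F F' α β Φ → Φ = M α β h) ∧
      -- `M_F` is semifree and is the pushout of `Cyl(A) ← A → B`, where `Cyl(A) = M_{1_A}`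
      (∀ {A B : DGCatS k} (F : A ⟶ B), (mapCyl F).IsSemifree ∧
        IsPushout (mapCyl.inclB (𝟙 A)) F.hom
          (M (F := 𝟙 A) (F' := F) (𝟙 A) F ⟨rfl⟩) (mapCyl.inclB F)) ∧
      -- the factorization of `F` into a cofibration and a quasi-equivalence
      (∀ {A B : DGCatS k} (F : A ⟶ B), mapCyl.inclA F ≫ q F = F.hom ∧
        IsSemifreeExtension (mapCyl.inclA F) ∧ DGFunctor.IsQuasiEquivalence (q F)) ∧
      -- functoriality
      (∀ {A B A' B' : DGCatS k} {F : A ⟶ B} {F' : A' ⟶ B'} (α : A ⟶ A') (β : B ⟶ B')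
        (h : CommSq F α β F'),
        mapCyl.inclA F ≫ M α β h = α.hom ≫ mapCyl.inclA F' ∧
        M α β h ≫ q F' = q F ≫ β.hom) ∧
      (∀ {A B : DGCatS k} (F : A ⟶ B) (h : CommSq F (𝟙 A) (𝟙 B) F),
        M (𝟙 A) (𝟙 B) h = 𝟙 (mapCyl F)) ∧
      (∀ {A B A' B' A'' B'' : DGCatS k} {F : A ⟶ B} {F' : A' ⟶ B'} {F'' : A'' ⟶ B''}
        (α : A ⟶ A') (β : B ⟶ B') (α' : A' ⟶ A'') (β' : B' ⟶ B'')
        (h : CommSq F α β F') (h' : CommSq F' α' β' F''),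
        M α β h ≫ M α' β' h' = M (α ≫ α') (β ≫ β') (h.vert_comp h')) := by
  refine ⟨fun F => mapCyl.proj F, fun α β h => mapCyl.induced α β h, ?_, ?_, ?_, ?_, ?_, ?_, ?_⟩
  · exact fun F => ⟨mapCyl.isProjection_proj F, fun r hr => hr.eq_proj⟩
  · exact fun α β h => ⟨mapCyl.isInducedMap_induced h,
      fun Φ hΦ => hΦ.unique (mapCyl.isInducedMap_induced h)⟩
  · exact fun F => ⟨mapCyl.isSemifree F, (mapCyl.isInducedMap_induced _).isPushout⟩
  · exact fun F => ⟨(mapCyl.isProjection_proj F).inclA_comp, mapCyl.isSemifreeExtension_inclA F,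
      mapCyl.isQuasiEquivalence_proj F⟩
  · exact fun α β h => ⟨(mapCyl.isInducedMap_induced h).inclA_comp,
      (mapCyl.isInducedMap_induced h).comp_proj h⟩
  · exact fun F h => (mapCyl.isInducedMap_induced h).unique (mapCyl.isInducedMap_id F)
  · exact fun α β α' β' h h' => ((mapCyl.isInducedMap_induced h).comp
      (mapCyl.isInducedMap_induced h') h').unique (mapCyl.isInducedMap_induced _)
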